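/- Let $\tilde L\subset\mathbb R^m\times\mathbb R^n$ be a lattice such that the projection $\pi_1$ to $\mathbb R^m$ is injective on $\tilde L$ and the projection $\pi_2$ to $\mathbb R^n$ maps $\tilde L$ onto a dense set. Put $L=\pi_1(\tilde L)$ and let $x\mapsto x^*$ be the map $\pi_2\circ(\pi_1|_{\tilde L})^{-1}:L\to\mathbb R^n$. Let $\Omega\subset\mathbb R^n$ be compact, equal to the closure of its interior, with boundary of Lebesgue measure $0$ and with $0\in\operatorname{int}(\Omega)$, and let $\Lambda=\{x\in L\mid x^*\in\Omega\}$. Let $Q$ be a linear similarity of $\mathbb R^m$ with $QL=L$ which induces a linear map $A=Q^*$ of $\mathbb R^n$, i.e. $(Qx)^*=Ax^*$ for $x\in L$, all of whose complex eigenvalues have absolute value less than $1$. Let $$\Omega_Q=\{u\in\mathbb R^n\mid A\Omega+u\subset\Omega\},\qquad T=T_Q=\{v\in L\mid v^*\in\Omega_Q\},$$ and assume that $\Omega_Q$ has non-empty interior (that is, $Q$ is compatible with $\Lambda$) and that its boundary has Lebesgue measure $0$. For $S\subset\mathbb R^m$ write $S_s=\{x\in S\mid |x|\le s\}$. Let $p:L\to\mathbb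 R$ be the continuous $Q$-invariant density on $\Lambda$, i.e. $p$ vanishes off $\Lambda$; $p\ge0$ on $\Lambda$; $$p(x)=\lim_{s\to\infty}\frac{|\det Q|}{\#T_s}\sum_{v\in T_s}p\bigl(Q^{-1}(x-v)\bigr)\quad(x\in L),\qquad \lim_{s\to\infty}\frac1{\#\Lambda_s}\sum_{x\in\Lambda_s}p(x)=1;$$ and $p(x)=\operatorname{vol}(\Omega)\,f(x^*)$ for $x\in\Lambda$, with a continuous function $f:\mathbb R^n\to\mathbb C$ that has support in $\Omega$. Then for all $k\in\mathbb R^m$ the limits $$g(k)=\lim_{s\to\infty}\frac1{\#T_s}\sum_{v\in T_s}e^{-2\pi i k\cdot v},\qquad h(k)=\lim_{s\to\infty}\frac1{\#\Lambda_s}\sum_{w\in\Lambda_s}p(w)\,e^{-2\pi i k\cdot w}$$ exist, and $$h(k)=\prod_{N=0}^{\infty}g\bigl((Q^t)^Nk\bigr),$$ where the product converges unconditionally (it may be zero). Consequently the Bragg spectrum of $(\Lambda,p)$ is supported inside that of $T_Q$. Here, for a set $S$ with weights $w\ge0$, the diffraction measure is the positive measure $\hat\gamma$ that is the Fourier transform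 of the autocorrelation $\gamma=\lim_{s\to\infty}\frac1{\#S_s}\sum_{x,y\in S_s}w(x)w(y)\delta_{x-y}$ (vague limit), the Bragg spectrum is the point part of $\hat\gamma$, and $T_Q$ carries the weights $1$. That is, if $\hat\gamma_{(\Lambda,p)}(\{k\})\neq0$, then $\hat\gamma_{T_Q}(\{k\})\neq0$. -/

import Mathlib

open MeasureTheory Filter Topology
open scoped FourierTransform SchwartzMap

noncomputable section

/-- Euclidean space of dimension `d`. -/
abbrev Euc (d : ℕ) : Type := EuclideanSpace ℝ (Fin d)

/-- A cut and project scheme with physical space `ℝ^m` and internal space `ℝ^n`: a lattice in the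
product (a discrete subgroup spanning over `ℝ`) on which the first projection is injective and whose
second projection is dense. -/
structure CutProjectScheme (m n : ℕ) where
  lattice : Submodule ℤ (Euc m × Euc n)
  discrete : DiscreteTopology lattice
  span_eq_top : Submodule.span ℝ (lattice : Set (Euc m × Euc n)) = ⊤
  fst_injOn : Set.InjOn Prod.fst (lattice : Set (Euc m × Euc n))
  snd_dense : Dense (Prod.snd '' (lattice : Set (Euc m × Euc n)))

namespace CutProjectScheme

variable {m n : ℕ} (C : CutProjectScheme m n)

/-- The projection `L = π₁(L̃)` of the lattice to physical space. -/
def L : Set (Euc m) := Prod.fst '' (C.lattice : Set (Euc m × Euc n))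

open Classical in
/-- The map `x ↦ x^*` from `L` to internal space (with the value `0` off `L`). -/
def starMap (x : Euc m) : Euc n :=
  if h : ∃ y, (x, y) ∈ C.lattice then h.choose else 0

theorem starMap_eq_iff {x : Euc m} (hx : x ∈ C.L) (y : Euc n) :
    C.starMap x = y ↔ (x, y) ∈ C.lattice := by
  have h : ∃ y, (x, y) ∈ C.lattice := by
    obtain ⟨⟨a, b⟩, hab, rfl⟩ := hx
    exact ⟨b, hab⟩
  have hs : (x, C.starMap x) ∈ C.lattice := by
    unfold starMap
    rw [dif_pos h]
    exact h.choose_spec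
  constructor
  · rintro rfl
    exact hs
  · intro hy
    exact (Prod.ext_iff.1 (C.fst_injOn hs hy rfl)).2

/-- `Λ(W) = {x ∈ L | x^* ∈ W}`. -/
def modelSet (W : Set (Euc n)) : Set (Euc m) := {x | x ∈ C.L ∧ C.starMap x ∈ W}

/-- `A` is the linear map `Q^*` of internal space induced by `Q`, i.e. `(Q x)^* = A x^*` on `L`.
As `L^*` is dense, there is at most one such `A`. -/
def IsInducedBy (A : Euc n →ₗ[ℝ] Euc n) (Q : Euc m ≃L[ℝ] Euc m) : Prop :=
  ∀ x ∈ C.L, C.starMap (Q x) = A (C.starMap x)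

end CutProjectScheme

/-- Window conditions: compact, closure of its interior, boundary of Lebesgue measure zero. -/
structure IsWindow {n : ℕ} (Ω : Set (Euc n)) : Prop where
  isCompact : IsCompact Ω
  eq_closure_interior : Ω = closure (interior Ω)
  volume_frontier : volume (frontier Ω) = 0

/-- A linear similarity `Q = q R`, with `R` orthogonal and `q ≠ 0`. -/
def IsLinearSimilarity {m : ℕ} (Q : Euc m ≃L[ℝ] Euc m) : Prop :=
  ∃ (q : ℝ) (R : Euc m ≃ₗᵢ[ℝ] Euc m), q ≠ 0 ∧ ∀ x, Q x = q • R x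

/-- `Ω_Q = {u | A Ω + u ⊆ Ω}`, where `A = Q^*`. -/
def translationWindow {n : ℕ} (A : Euc n →ₗ[ℝ] Euc n) (Ω : Set (Euc n)) : Set (Euc n) :=
  {u | ∀ y ∈ Ω, A y + u ∈ Ω}

/-- `T_s = {x ∈ T | |x| ≤ s}`. -/
def truncation {m : ℕ} (T : Set (Euc m)) (s : ℝ) : Set (Euc m) := {x | x ∈ T ∧ ‖x‖ ≤ s}

/-- The mean `(1 / #T_s) ∑_{x ∈ T_s} F x`; `T_s` is finite for every model set `T`. -/
def ballMean {m : ℕ} {K : Type} [Field K] (T : Set (Euc m)) (F : Euc m → K) (s : ℝ) : K :=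
  ((truncation T s).ncard : K)⁻¹ * ∑ᶠ x ∈ truncation T s, F x

/-- `(1 / #T_s) ∑_{x ∈ T_s} w(x) exp(-2πi k·x)`. -/
def fourierBohrMean {m : ℕ} (T : Set (Euc m)) (w : Euc m → ℝ) (k : Euc m) (s : ℝ) : ℂ :=
  ballMean T
    (fun x => (w x : ℂ) * Complex.exp (-(2 * Real.pi * Complex.I * ((inner ℝ k x : ℝ) : ℂ)))) s

/-- The averaged Fourier–Bohr coefficient: the limit of `fourierBohrMean T w k s` as `s → ∞`. -/
def fourierBohr {m : ℕ} (T : Set (Euc m)) (w : Euc m → ℝ) (k : Euc m) : ℂ :=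
  limUnder atTop (fourierBohrMean T w k)

/-- `p` is a `Q`-invariant density on `Λ = Λ(Ω)`, where `A = Q^*`. A function on `L` that vanishes
off `Λ` is given by its extension by zero to `ℝ^m`. -/
structure IsInvariantDensity {m n : ℕ} (C : CutProjectScheme m n) (Ω : Set (Euc n))
    (Q : Euc m ≃L[ℝ] Euc m) (A : Euc n →ₗ[ℝ] Euc n) (p : Euc m → ℝ) : Prop where
  eq_zero_off : ∀ x, x ∉ C.modelSet Ω → p x = 0
  nonneg : ∀ x ∈ C.modelSet Ω, 0 ≤ p x
  invariant : ∀ x ∈ C.L,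
    Tendsto (fun s : ℝ => |LinearMap.det (Q : Euc m →ₗ[ℝ] Euc m)| *
        ballMean (C.modelSet (translationWindow A Ω)) (fun v => p (Q.symm (x - v))) s)
      atTop (𝓝 (p x))
  normalized : Tendsto (ballMean (C.modelSet Ω) p) atTop (𝓝 1)

/-- `p` lies in `𝒞(Λ)`: on `Λ = Λ(Ω)` one has `p x = vol(Ω) f(x^*)` for a continuous
complex-valued function `f` on internal space with support in `Ω`. -/
def MemContinuousClass {m n : ℕ} (C : CutProjectScheme m n) (Ω : Set (Euc n))
    (p : Euc m → ℝ) : Prop :=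
  ∃ f : Euc n → ℂ, Continuous f ∧ Function.support f ⊆ Ω ∧
    ∀ x ∈ C.modelSet Ω, (p x : ℂ) = ((volume Ω).toReal : ℂ) * f (C.starMap x)

/-- `γ` is the auto-correlation of the weighted comb `∑_{x ∈ T} w(x) δ_x`, `w ≥ 0`: the vague limit
of the measures `(1 / #T_s) ∑_{x, y ∈ T_s} w(x) w(y) δ_{x - y}` as `s → ∞`. -/
def IsAutocorrelation {m : ℕ} (T : Set (Euc m)) (w : Euc m → ℝ) (γ : Measure (Euc m)) : Prop :=
  IsLocallyFiniteMeasure γ ∧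
    ∀ φ : Euc m → ℝ, Continuous φ → HasCompactSupport φ →
      Tendsto (fun s : ℝ =>
          ballMean T (fun x => ∑ᶠ y ∈ truncation T s, w x * w y * φ (x - y)) s)
        atTop (𝓝 (∫ z, φ z ∂γ))

/-- `ν` is the diffraction measure of the weighted comb `∑_{x ∈ T} w(x) δ_x`: the positive measure
that is the Fourier transform, as a tempered distribution, of the auto-correlation. -/
def IsDiffractionMeasure {m : ℕ} (T : Set (Euc m)) (w : Euc m → ℝ) (ν : Measure (Euc m)) : Prop :=
  IsLocallyFiniteMeasure ν ∧
    ∃ γ : Measure (Euc m), IsAutocorrelation T w γ ∧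
      ∀ φ : 𝓢(Euc m, ℂ),
        Integrable (𝓕 φ : 𝓢(Euc m, ℂ)) γ ∧ Integrable φ ν ∧
          ∫ z, (𝓕 φ : 𝓢(Euc m, ℂ)) z ∂γ = ∫ k, φ k ∂ν

/-- The positions of the Bragg peaks: the points that carry the point part of the diffraction
measure `ν`. -/
def braggPeaks {m : ℕ} (ν : Measure (Euc m)) : Set (Euc m) := {k | ν {k} ≠ 0}

end

noncomputable section

/-! ### Lattice points over a compact window: packing, covering, and comparison of sums with
integrals. -/

namespace CutProjectScheme

variable {m n : ℕ} (C : CutProjectScheme m n)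

/-! The whole question is moved to internal space, where averages over a model set become integrals
over its window. Call k a dual frequency if the phase exp(-2πi k·x) on L equals χ(x^*) for a
continuous character χ of ℝ^n (`IsDualCharacter`). For such k one finds g(k) = vol(Ω_Q)⁻¹ ∫_{Ω_Q} χ
and h(k) = ∫ χ f; for every other k both limits exist and are 0.

The underlying equidistribution is proved for any family of weights satisfying `IsAveraging`. Limits
along an ultrafilter always exist and give a positive functional on C_c(ℝ^n). It is invariant under
the dense group L^*, hence under all translations, so it is a positive multiple c of Lebesgue
measure (`exists_umean_eq_integral`). The constant c may depend on the ultrafilter, but it cancels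
in the quotients that define the means. Windows with null boundary are reached by continuous
approximation. If the phase has a nonzero mean, the means of its translates produce the character χ
(`umean_phase_eq_zero`).

By density of L^* and continuity of f, invariance of p becomes f(u) = κ ∫_{Ω_Q} f(A⁻¹(u - v)) dv
(`refinement_equation`). Integrating against χ and applying Fubini gives ∫ χ f = g(k) ∫ (χ∘A) f
(`integral_character_mul_recursion`), and χ∘A is the character of Qᵗk. On iteration the remainder ∫
(χ∘A^N) f tends to ∫ f = 1. Since the powers of A have summable norms and χ - 1 is O(‖u‖), the
factors differ from 1 by a summable sequence, so the product converges unconditionally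
(`hasProd_character`).

For the Bragg peaks, the autocorrelation is computed as an explicit comb on L. Testing its Fourier
transform with Gaussians that shrink to k turns the mass at k into a limit of Gaussian-weighted sums
over the lattice, to which the same equidistribution applies. The result is a positive multiple of
|∫_W χ F|² (`measure_singleton_of_isDualCharacter`), so one step of the recursion yields the
inclusion of spectra. -/

instance : DiscreteTopology C.lattice := C.discrete

instance : IsZLattice ℝ C.lattice := ⟨C.span_eq_top⟩

instance : Countable C.lattice := countable_of_Lindelof_of_discrete

theorem finite_inter_lattice {K : Set (Euc m × Euc n)} (hK : Bornology.IsBounded K) :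
    (K ∩ (C.lattice : Set (Euc m × Euc n))).Finite := by
  refine Metric.finite_isBounded_inter_isClosed ?_ hK ?_
  · exact ⟨C.discrete⟩
  · have : DiscreteTopology C.lattice.toAddSubgroup := C.discrete
    exact AddSubgroup.isClosed_of_discrete (H := C.lattice.toAddSubgroup)

theorem eq_zero_of_fst_eq_zero {z : Euc m × Euc n} (h : z ∈ C.lattice) (h0 : z.1 = 0) : z = 0 :=
  C.fst_injOn h C.lattice.zero_mem h0

/-- Differences of such points have bounded second component, so only finitely many of them are
short; none of the nonzero ones has first component 0, by injectivity. The bounds `2 * r` and `r ≤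
1` are tailored to the packing by balls in `tsum_le_lintegral`. -/
theorem exists_separation {K : Set (Euc n)} (hK : IsCompact K) :
    ∃ r : ℝ, 0 < r ∧ r ≤ 1 ∧ ∀ z ∈ C.lattice, ∀ z' ∈ C.lattice, z.2 ∈ K → z'.2 ∈ K → z ≠ z' →
      2 * r ≤ dist z.1 z'.1 := by
  obtain ⟨D, hD⟩ := hK.isBounded.subset_closedBall 0
  have hS := C.finite_inter_lattice
    (K := {z | z ≠ 0} ∩ (Metric.closedBall 0 2 ×ˢ Metric.closedBall 0 (D + D)))
    ((Metric.isBounded_closedBall.prod Metric.isBounded_closedBall).subset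
      Set.inter_subset_right)
  set S := ({z | z ≠ 0} ∩ (Metric.closedBall (0 : Euc m) 2 ×ˢ Metric.closedBall (0 : Euc n) (D + D)))
    ∩ (C.lattice : Set (Euc m × Euc n))
  have h1 : ∀ᶠ ε in 𝓝[>] (0 : ℝ), ∀ z ∈ S, ε < ‖z.1‖ := by
    rw [Filter.eventually_all_finite hS]
    intro z hz
    have : 0 < ‖z.1‖ := norm_pos_iff.2 fun h0 => hz.1.1 (C.eq_zero_of_fst_eq_zero hz.2 h0)
    exact Filter.Eventually.filter_mono nhdsWithin_le_nhds (eventually_lt_nhds this)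
  -- This forces any violating difference into the ball of radius 2, hence into the finite set `S`.
  have h2 : ∀ᶠ ε in 𝓝[>] (0 : ℝ), ε < 2 :=
    Filter.Eventually.filter_mono nhdsWithin_le_nhds (eventually_lt_nhds two_pos)
  obtain ⟨ε, ⟨h1, h2⟩, h3⟩ := ((h1.and h2).and self_mem_nhdsWithin).exists
  refine ⟨ε / 2, half_pos h3, by linarith, fun z hz z' hz' hk hk' hne => ?_⟩
  rw [mul_div_cancel₀ _ (two_ne_zero)]
  by_contra! hlt
  have : z - z' ∈ S := by
    refine ⟨⟨sub_ne_zero.2 hne, ?_, ?_⟩, C.lattice.sub_mem hz hz'⟩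
    · rw [mem_closedBall_zero_iff, Prod.fst_sub, ← dist_eq_norm]
      linarith
    · have e1 := mem_closedBall_zero_iff.1 (hD hk)
      have e2 := mem_closedBall_zero_iff.1 (hD hk')
      rw [mem_closedBall_zero_iff, Prod.snd_sub]
      exact (norm_sub_le _ _).trans (add_le_add e1 e2)
  have := h1 _ this
  rw [Prod.fst_sub, ← dist_eq_norm] at this
  linarith

/-- A fundamental domain provides a lattice point near (t, 0), whose second component lies in a
fixed ball. By density and compactness, one of finitely many lattice vectors corrects that component
into W, at bounded cost in physical space. -/
theorem exists_relatively_dense {W : Set (Euc n)} (hW : (interior W).Nonempty) :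
    ∃ R : ℝ, ∀ t : Euc m, ∃ z ∈ C.lattice, z.2 ∈ W ∧ dist t z.1 ≤ R := by
  have := ZLattice.module_free ℝ C.lattice
  let b := (Module.Free.chooseBasis ℤ C.lattice).ofZLatticeBasis ℝ
  obtain ⟨ρ, hρ⟩ : ∃ ρ : ℝ, ∀ z : Euc m × Euc n, ∃ y ∈ C.lattice, ‖z - y‖ ≤ ρ := by
    refine ⟨∑ i, ‖b i‖, fun z => ⟨ZSpan.floor b z, ?_, ?_⟩⟩
    · exact (Module.Basis.ofZLatticeBasis_span ℝ C.lattice _).le (ZSpan.floor b z).2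
    · exact ZSpan.norm_fract_le b z
  have hcov : Metric.closedBall (0 : Euc n) ρ ⊆
      ⋃ l : C.lattice, (fun y => y - l.1.2) ⁻¹' interior W := by
    intro y _
    have hop : IsOpen ((fun v => y - v) ⁻¹' interior W) :=
      isOpen_interior.preimage (by fun_prop)
    obtain ⟨w, hw⟩ := hW
    obtain ⟨v, hv, ⟨l, hl, rfl⟩⟩ := C.snd_dense.inter_open_nonempty _ hop ⟨y - w, by simpa using hw⟩
    exact Set.mem_iUnion.2 ⟨⟨l, hl⟩, hv⟩
  obtain ⟨t, ht⟩ := (isCompact_closedBall (0 : Euc n) ρ).elim_finite_subcover _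
    (fun l => isOpen_interior.preimage (by fun_prop)) hcov
  refine ⟨ρ + ∑ l ∈ t, ‖l.1.1‖, fun x => ?_⟩
  obtain ⟨y, hy, hyn⟩ := hρ (x, 0)
  have hy1 : ‖x - y.1‖ ≤ ρ := (norm_fst_le ((x, 0) - y)).trans hyn
  have hy2 : ‖y.2‖ ≤ ρ := by simpa using (norm_snd_le ((x, 0) - y)).trans hyn
  obtain ⟨l, hlt, hl⟩ := Set.mem_iUnion₂.1 (ht (mem_closedBall_zero_iff.2 hy2))
  refine ⟨y - l.1, C.lattice.sub_mem hy l.2, interior_subset hl, ?_⟩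
  rw [dist_eq_norm, Prod.fst_sub, ← sub_add]
  refine (norm_add_le _ _).trans (add_le_add hy1 ?_)
  exact Finset.single_le_sum (f := fun l : C.lattice => ‖l.1.1‖) (fun _ _ => norm_nonneg _) hlt

open scoped ENNReal NNReal

/-- Packing: disjoint balls of radius r around the points, on each of which b dominates the value of
a at the centre. -/
theorem tsum_le_lintegral {K : Set (Euc n)} (hK : IsCompact K) :
    ∃ B : ℝ≥0∞, B ≠ ∞ ∧ ∀ a b : Euc m → ℝ≥0∞, (∀ x y, dist x y ≤ 1 → a x ≤ b y) →
      ∑' z : C.lattice, K.indicator (fun _ => a z.1.1) z.1.2 ≤ B * ∫⁻ y, b y := by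
  classical
  obtain ⟨r, hr0, hr1, hr⟩ := C.exists_separation hK
  have hv0 : volume (Metric.ball (0 : Euc m) r) ≠ 0 := (Metric.measure_ball_pos _ _ hr0).ne'
  have hvt : volume (Metric.ball (0 : Euc m) r) ≠ ∞ := measure_ball_lt_top.ne
  refine ⟨(volume (Metric.ball (0 : Euc m) r))⁻¹, ENNReal.inv_ne_top.2 hv0, fun a b hab => ?_⟩
  let s : C.lattice → Set (Euc m) := fun z => if z.1.2 ∈ K then Metric.ball z.1.1 r else ∅
  have hs : ∀ z, MeasurableSet (s z) := fun z => by
    dsimp only [s]; split_ifs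
    · exact measurableSet_ball
    · exact MeasurableSet.empty
  have hd : Pairwise (Function.onFun Disjoint s) := by
    intro z z' hzz
    simp only [Function.onFun, s]
    split_ifs with h1 h2
    · refine Metric.ball_disjoint_ball ?_
      have := hr z.1 z.2 z'.1 z'.2 h1 h2 (fun h => hzz (Subtype.ext h))
      linarith
    all_goals simp
  have key : ∀ z : C.lattice, K.indicator (fun _ => a z.1.1) z.1.2 ≤
      (volume (Metric.ball (0 : Euc m) r))⁻¹ * (volume.withDensity b) (s z) := by
    intro z
    by_cases hz : z.1.2 ∈ K
    · rw [Set.indicator_of_mem hz, withDensity_apply _ (hs z)]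
      simp only [s, if_pos hz]
      have : ∫⁻ _ in Metric.ball z.1.1 r, a z.1.1 ≤ ∫⁻ y in Metric.ball z.1.1 r, b y := by
        refine setLIntegral_mono' measurableSet_ball fun y hy => hab _ _ ?_
        rw [dist_comm]
        exact (Metric.mem_ball.1 hy).le.trans hr1
      rw [setLIntegral_const, Measure.addHaar_ball_center] at this
      calc a z.1.1 = (volume (Metric.ball (0 : Euc m) r))⁻¹ *
            (a z.1.1 * volume (Metric.ball (0 : Euc m) r)) := by
            rw [mul_comm (a _), ← mul_assoc, ENNReal.inv_mul_cancel hv0 hvt, one_mul]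
        _ ≤ _ := by gcongr
    · simp [Set.indicator_of_notMem hz]
  calc _ ≤ ∑' z : C.lattice, (volume (Metric.ball (0 : Euc m) r))⁻¹ *
        (volume.withDensity b) (s z) := ENNReal.tsum_le_tsum key
    _ ≤ _ := by
      rw [ENNReal.tsum_mul_left]
      gcongr
      refine (tsum_meas_le_meas_iUnion_of_disjoint _ hs hd).trans ?_
      refine (measure_mono (Set.subset_univ _)).trans ?_
      rw [withDensity_apply _ MeasurableSet.univ, setLIntegral_univ]

/-- Covering, the counterpart of the packing bound: balls of radius R around the points exhaust
physical space. -/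
theorem lintegral_le_tsum {W : Set (Euc n)} (hW : (interior W).Nonempty) :
    ∃ R : ℝ, ∃ B : ℝ≥0∞, B ≠ ∞ ∧ ∀ a b : Euc m → ℝ≥0∞, (∀ x y, dist y x ≤ R → b y ≤ a x) →
      ∫⁻ y, b y ≤ B * ∑' z : C.lattice, W.indicator (fun _ => a z.1.1) z.1.2 := by
  classical
  obtain ⟨R, hR⟩ := C.exists_relatively_dense hW
  refine ⟨R, volume (Metric.closedBall (0 : Euc m) R), measure_closedBall_lt_top.ne,
    fun a b hab => ?_⟩
  let s : C.lattice → Set (Euc m) := fun z => if z.1.2 ∈ W then Metric.closedBall z.1.1 R else ∅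
  have hU : ⋃ z, s z = Set.univ := by
    refine Set.eq_univ_of_forall fun t => ?_
    obtain ⟨z, hz, hzW, hzt⟩ := hR t
    refine Set.mem_iUnion.2 ⟨⟨z, hz⟩, ?_⟩
    simp only [s, if_pos hzW]
    exact hzt
  rw [← setLIntegral_univ, ← hU, ← ENNReal.tsum_mul_left]
  refine (lintegral_iUnion_le _ _).trans (ENNReal.tsum_le_tsum fun z => ?_)
  by_cases hz : z.1.2 ∈ W
  · simp only [s, if_pos hz, Set.indicator_of_mem hz]
    calc _ ≤ ∫⁻ _ in Metric.closedBall z.1.1 R, a z.1.1 :=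
          setLIntegral_mono' measurableSet_closedBall fun y hy => hab _ _ hy
      _ = _ := by
        rw [setLIntegral_const, mul_comm, Measure.addHaar_closedBall_center]
  · simp [s, if_neg hz]

end CutProjectScheme

/-! ### Averaging weights: balls and Gaussians. -/

namespace CutProjectScheme

variable {m n : ℕ} (C : CutProjectScheme m n)

open scoped ENNReal NNReal

/-- A family of weights on physical space whose averages over the lattice points with second
component in a compact set are bounded, asymptotically translation invariant and not negligible. -/
structure IsAveraging (a : ℝ → Euc m → ℝ) : Prop where
  nonneg : ∀ᶠ s in atTop, ∀ x, 0 ≤ a s x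
  bound : ∀ K : Set (Euc n), IsCompact K → ∃ B : ℝ≥0, ∀ᶠ s in atTop,
    ∑' z : C.lattice, K.indicator (fun _ => ENNReal.ofReal (a s z.1.1)) z.1.2 ≤ B
  shift : ∀ K : Set (Euc n), IsCompact K → ∀ t : Euc m, Tendsto (fun s =>
    ∑' z : C.lattice, K.indicator (fun _ => ENNReal.ofReal |a s (z.1.1 + t) - a s z.1.1|) z.1.2)
      atTop (𝓝 0)
  lower : ∀ W : Set (Euc n), (interior W).Nonempty → ∃ c : ℝ≥0, 0 < c ∧ ∀ᶠ s in atTop,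
    c ≤ ∑' z : C.lattice, W.indicator (fun _ => ENNReal.ofReal (a s z.1.1)) z.1.2

/-- The weight `s⁻ᵐ` on the ball of radius `s`. -/
def ballWeight (m : ℕ) (s : ℝ) (x : Euc m) : ℝ :=
  (Metric.closedBall (0 : Euc m) s).indicator (fun _ => (s ^ m)⁻¹) x

/-- The Gaussian weight of width `s`. -/
def gaussWeight (m : ℕ) (s : ℝ) (x : Euc m) : ℝ :=
  (s ^ m)⁻¹ * Real.exp (-(Real.pi / s ^ 2) * ‖x‖ ^ 2)

theorem tendsto_shell (m : ℕ) (τ : ℝ) :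
    Tendsto (fun s : ℝ => (s ^ m)⁻¹ * ((s + τ) ^ m - (s - τ) ^ m)) atTop (𝓝 0) := by
  have h1 : Tendsto (fun s : ℝ => (1 + τ * s⁻¹) ^ m - (1 - τ * s⁻¹) ^ m) atTop
      (𝓝 ((1 + τ * 0) ^ m - (1 - τ * 0) ^ m)) := by
    have := tendsto_inv_atTop_zero (𝕜 := ℝ)
    exact ((this.const_mul τ).const_add 1 |>.pow m).sub ((this.const_mul τ).const_sub 1 |>.pow m)
  simp only [mul_zero, add_zero, sub_zero, sub_self] at h1
  refine h1.congr' ?_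
  filter_upwards [eventually_gt_atTop 0] with s hs
  rw [← inv_pow, mul_sub, ← mul_pow, ← mul_pow]
  congr 2 <;> field_simp

theorem lintegral_indicator_closedBall (c r : ℝ) (hr : 0 ≤ r) :
    ∫⁻ y, (Metric.closedBall (0 : Euc m) r).indicator (fun _ => ENNReal.ofReal c) y =
      ENNReal.ofReal (c) * (ENNReal.ofReal (r ^ m) * volume (Metric.ball (0 : Euc m) 1)) := by
  rw [lintegral_indicator measurableSet_closedBall, setLIntegral_const,
    Measure.addHaar_closedBall _ _ hr, finrank_euclideanSpace_fin]

theorem ballWeight_bound {K : Set (Euc n)} (hK : IsCompact K) : ∃ B : ℝ≥0, ∀ᶠ s in atTop,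
    ∑' z : C.lattice, K.indicator (fun _ => ENNReal.ofReal (ballWeight m s z.1.1)) z.1.2 ≤ B := by
  obtain ⟨B, hB, h⟩ := C.tsum_le_lintegral hK
  have hv : volume (Metric.ball (0 : Euc m) 1) ≠ ∞ := measure_ball_lt_top.ne
  refine ⟨(B * (ENNReal.ofReal (2 ^ m) * volume (Metric.ball (0 : Euc m) 1))).toNNReal, ?_⟩
  filter_upwards [eventually_ge_atTop 1] with s hs
  rw [ENNReal.coe_toNNReal (by finiteness)]
  have hs0 : 0 < s := by linarith
  refine (h (fun x => ENNReal.ofReal (ballWeight m s x)) (fun y => (Metric.closedBall (0 : Euc m)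
    (s + 1)).indicator (fun _ => ENNReal.ofReal ((s ^ m)⁻¹)) y) ?_).trans ?_
  · intro x y hxy
    by_cases hx : x ∈ Metric.closedBall (0 : Euc m) s
    · rw [Set.indicator_of_mem]
      · simp [ballWeight, Set.indicator_of_mem hx]
      · rw [Metric.mem_closedBall] at hx ⊢
        linarith [dist_triangle y x 0, dist_comm x y]
    · simp [ballWeight, Set.indicator_of_notMem hx]
  · rw [lintegral_indicator_closedBall _ _ (by linarith), ← mul_assoc (ENNReal.ofReal _),
      ← ENNReal.ofReal_mul (by positivity), ← inv_pow, ← mul_pow]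
    gcongr
    rw [inv_mul_le_iff₀ hs0]
    linarith

/-- The weight and its translate differ only near the sphere of radius s, in a shell of width 2τ
whose volume is o(s^m). The extra 1 in τ pays for the displacement allowed by `tsum_le_lintegral`.
-/
theorem ballWeight_shift {K : Set (Euc n)} (hK : IsCompact K) (t : Euc m) : Tendsto (fun s =>
    ∑' z : C.lattice, K.indicator (fun _ =>
      ENNReal.ofReal |ballWeight m s (z.1.1 + t) - ballWeight m s z.1.1|) z.1.2) atTop (𝓝 0) := by
  obtain ⟨B, hB, h⟩ := C.tsum_le_lintegral hK
  have hv : volume (Metric.ball (0 : Euc m) 1) ≠ ∞ := measure_ball_lt_top.ne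
  set τ : ℝ := ‖t‖ + 1
  have hlim : Tendsto (fun s : ℝ => B * (ENNReal.ofReal ((s ^ m)⁻¹ * ((s + τ) ^ m - (s - τ) ^ m)) *
      volume (Metric.ball (0 : Euc m) 1))) atTop (𝓝 0) := by
    have := ENNReal.tendsto_ofReal (tendsto_shell m τ)
    rw [ENNReal.ofReal_zero] at this
    have := ENNReal.Tendsto.const_mul (ENNReal.Tendsto.mul_const this (Or.inr hv)) (Or.inr hB)
    simpa using this
  refine tendsto_of_tendsto_of_tendsto_of_le_of_le' tendsto_const_nhds hlim
    (Eventually.of_forall fun _ => zero_le) ?_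
  filter_upwards [eventually_ge_atTop (τ + 1)] with s hs
  have hτ : 0 < τ := by positivity
  have hs0 : 0 < s := by linarith
  have hsub : Metric.ball (0 : Euc m) (s - τ) ⊆ Metric.closedBall (0 : Euc m) (s + τ) :=
    Metric.ball_subset_closedBall.trans (Metric.closedBall_subset_closedBall (by linarith))
  refine (h (fun x => ENNReal.ofReal |ballWeight m s (x + t) - ballWeight m s x|)
    (fun y => (Metric.closedBall (0 : Euc m) (s + τ) \ Metric.ball 0 (s - τ)).indicator
      (fun _ => ENNReal.ofReal ((s ^ m)⁻¹)) y) ?_).trans ?_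
  · intro x y hxy
    by_cases hy : y ∈ Metric.closedBall (0 : Euc m) (s + τ) \ Metric.ball 0 (s - τ)
    · rw [Set.indicator_of_mem hy]
      refine ENNReal.ofReal_le_ofReal ?_
      have : 0 ≤ (s ^ m)⁻¹ := by positivity
      simp only [ballWeight, Set.indicator]
      split_ifs <;> simp [abs_of_nonneg, this]
    · have e1 : ‖x‖ ≤ ‖y‖ + 1 := by
        have := norm_sub_norm_le x y; rw [← dist_eq_norm] at this; linarith
      have e2 : ‖y‖ ≤ ‖x‖ + 1 := by
        have := norm_sub_norm_le y x; rw [← dist_eq_norm, dist_comm] at this; linarith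
      have e3 : ‖x + t‖ ≤ ‖x‖ + ‖t‖ := norm_add_le _ _
      have e4 : ‖x‖ ≤ ‖x + t‖ + ‖t‖ := by simpa using norm_sub_le (x + t) t
      have e5 : x + t ∈ Metric.closedBall (0 : Euc m) s ↔ x ∈ Metric.closedBall (0 : Euc m) s := by
        rw [Set.mem_sdiff, mem_closedBall_zero_iff, mem_ball_zero_iff] at hy
        rw [mem_closedBall_zero_iff, mem_closedBall_zero_iff]
        by_cases hh : ‖y‖ ≤ s + τ
        · have hy2 : ‖y‖ < s - τ := not_not.1 fun h' => hy ⟨hh, h'⟩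
          constructor <;> intro <;> simp only [τ] at * <;> linarith
        · push Not at hh
          constructor <;> intro <;> simp only [τ] at * <;> linarith
      have e6 : ballWeight m s (x + t) = ballWeight m s x := by
        unfold ballWeight
        by_cases hx : x ∈ Metric.closedBall (0 : Euc m) s
        · rw [Set.indicator_of_mem hx, Set.indicator_of_mem (e5.2 hx)]
        · rw [Set.indicator_of_notMem hx, Set.indicator_of_notMem (mt e5.1 hx)]
      simp [e6]
  · rw [lintegral_indicator (measurableSet_closedBall.diff measurableSet_ball), setLIntegral_const,
      measure_sdiff hsub measurableSet_ball.nullMeasurableSet measure_ball_lt_top.ne,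
      Measure.addHaar_closedBall _ _ (by linarith),
      Measure.addHaar_ball_of_pos _ (0 : Euc m) (show 0 < s - τ by linarith),
      finrank_euclideanSpace_fin,
      ENNReal.ofReal_mul (by positivity), ENNReal.ofReal_sub _ (pow_nonneg (by linarith) _),
      mul_assoc, ENNReal.sub_mul (fun _ _ => hv)]

theorem ballWeight_lower {W : Set (Euc n)} (hW : (interior W).Nonempty) :
    ∃ c : ℝ≥0, 0 < c ∧ ∀ᶠ s in atTop, c ≤
      ∑' z : C.lattice, W.indicator (fun _ => ENNReal.ofReal (ballWeight m s z.1.1)) z.1.2 := by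
  obtain ⟨R, B, hB, h⟩ := C.lintegral_le_tsum hW
  set V := volume (Metric.ball (0 : Euc m) 1)
  have hv : V ≠ ∞ := measure_ball_lt_top.ne
  have hv0 : V ≠ 0 := (Metric.measure_ball_pos _ _ one_pos).ne'
  -- Testing the comparison on constants rules out B = 0, since physical space has positive volume.
  have hB0 : B ≠ 0 := by
    rintro rfl
    have := h (fun _ => 1) (fun _ => 1) (fun _ _ _ => le_rfl)
    rw [zero_mul, lintegral_const, one_mul, nonpos_iff_eq_zero] at this
    exact hv0 (measure_mono_null (Set.subset_univ _) this)
  have hfin : B⁻¹ * (ENNReal.ofReal ((1 / 2) ^ m) * V) ≠ ∞ := by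
    have := ENNReal.inv_ne_top.2 hB0
    finiteness
  refine ⟨(B⁻¹ * (ENNReal.ofReal ((1 / 2) ^ m) * V)).toNNReal, ?_, ?_⟩
  · rw [ENNReal.toNNReal_pos_iff, pos_iff_ne_zero]
    refine ⟨?_, hfin.lt_top⟩
    refine mul_ne_zero (ENNReal.inv_ne_zero.2 hB) (mul_ne_zero ?_ hv0)
    rw [ENNReal.ofReal_ne_zero_iff]
    positivity
  filter_upwards [eventually_ge_atTop (2 * |R| + 1)] with s hs
  have hs0 : 0 < s := by linarith [abs_nonneg R]
  rw [ENNReal.coe_toNNReal hfin, ENNReal.inv_mul_le_iff hB0 hB]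
  have hRn := abs_nonneg R
  have hRl := le_abs_self R
  refine le_trans ?_ (h (fun x => ENNReal.ofReal (ballWeight m s x)) (fun y =>
    (Metric.closedBall (0 : Euc m) (s / 2)).indicator (fun _ => ENNReal.ofReal ((s ^ m)⁻¹)) y) ?_)
  · rw [lintegral_indicator_closedBall _ _ (by linarith), ← mul_assoc (ENNReal.ofReal _),
      ← ENNReal.ofReal_mul (by positivity), ← inv_pow, ← mul_pow]
    refine le_of_eq ?_
    congr 3
    field_simp
  · intro x y hxy
    by_cases hy : y ∈ Metric.closedBall (0 : Euc m) (s / 2)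
    · rw [Set.indicator_of_mem hy, ballWeight, Set.indicator_of_mem]
      rw [Metric.mem_closedBall] at hy ⊢
      linarith [dist_triangle x y 0, dist_comm x y]
    · simp [Set.indicator_of_notMem hy]

theorem isAveraging_ballWeight : C.IsAveraging (ballWeight m) where
  nonneg := by
    filter_upwards [eventually_ge_atTop 0] with s hs x
    exact Set.indicator_nonneg (fun _ _ => by positivity) _
  bound _ hK := C.ballWeight_bound hK
  shift _ hK t := C.ballWeight_shift hK t
  lower _ hW := C.ballWeight_lower hW

/-- A Lipschitz bound for the Gaussian profile that keeps Gaussian decay, expressed at a nearby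
third radius w. In use, u and v are the scaled norms of x and x + t, and w that of the integration
variable. -/
theorem exp_neg_sub_exp_neg_le {c u v w : ℝ} (hu : 0 ≤ u) (hv : 0 ≤ v) (hw : 0 ≤ w)
    (huw : |u - w| ≤ c) (hvw : |v - w| ≤ c) :
    |Real.exp (-Real.pi * v ^ 2) - Real.exp (-Real.pi * u ^ 2)| ≤
      |v - u| * (Real.pi * (1 + 2 * c) * Real.exp (Real.pi * c ^ 2)) *
        Real.exp (-(Real.pi / 4) * w ^ 2) := by
  wlog huv : u ≤ v generalizing u v
  · rw [abs_sub_comm, abs_sub_comm v]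
    exact this hv hu hvw huw (le_of_not_ge huv)
  have hc : 0 ≤ c := (abs_nonneg _).trans huw
  have hpi := Real.pi_pos
  have hpi3 := Real.pi_gt_three
  rw [abs_le] at huw hvw
  have h1 : 1 - Real.pi * (v ^ 2 - u ^ 2) ≤ Real.exp (-(Real.pi * (v ^ 2 - u ^ 2))) := by
    linarith [Real.add_one_le_exp (-(Real.pi * (v ^ 2 - u ^ 2)))]
  have h2 : Real.exp (-Real.pi * v ^ 2) =
      Real.exp (-(Real.pi * (v ^ 2 - u ^ 2))) * Real.exp (-Real.pi * u ^ 2) := by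
    rw [← Real.exp_add]; ring_nf
  have h3 : Real.exp (-Real.pi * v ^ 2) ≤ Real.exp (-Real.pi * u ^ 2) := by
    apply Real.exp_le_exp.2; nlinarith [mul_self_le_mul_self hu huv]
  rw [abs_sub_comm, abs_of_nonneg (by linarith), abs_of_nonneg (by linarith)]
  have hE := Real.exp_pos (-Real.pi * u ^ 2)
  have h4 : Real.exp (-Real.pi * u ^ 2) - Real.exp (-Real.pi * v ^ 2) ≤
      Real.pi * (v - u) * (v + u) * Real.exp (-Real.pi * u ^ 2) := by
    rw [h2]; nlinarith [mul_le_mul_of_nonneg_right h1 hE.le]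
  -- Half of the Gaussian exponent is spent on absorbing the linear factor.
  have h5 : v + u ≤ (1 + 2 * c) * Real.exp (Real.pi / 2 * u ^ 2) := by
    have : 1 + u ^ 2 ≤ Real.exp (Real.pi / 2 * u ^ 2) := by
      nlinarith [Real.add_one_le_exp (Real.pi / 2 * u ^ 2), sq_nonneg u]
    have h6 : v + u ≤ 2 * u + 2 * c := by linarith
    nlinarith [sq_nonneg (u - 1), mul_nonneg hc (sq_nonneg u)]
  -- The other half moves from u to w through w² ≤ 2u² + 2c², which is where the rate π/4 comes
  -- from.
  have h7 : Real.exp (Real.pi / 2 * u ^ 2) * Real.exp (-Real.pi * u ^ 2) ≤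
      Real.exp (Real.pi * c ^ 2) * Real.exp (-(Real.pi / 4) * w ^ 2) := by
    rw [← Real.exp_add, ← Real.exp_add]
    apply Real.exp_le_exp.2
    have : w ^ 2 ≤ 2 * u ^ 2 + 2 * c ^ 2 := by
      have : w ≤ u + c := by linarith
      nlinarith [sq_nonneg (u - c)]
    nlinarith [sq_nonneg c]
  calc _ ≤ Real.pi * (v - u) * (v + u) * Real.exp (-Real.pi * u ^ 2) := h4
    _ ≤ Real.pi * (v - u) * ((1 + 2 * c) * Real.exp (Real.pi / 2 * u ^ 2)) *
        Real.exp (-Real.pi * u ^ 2) := by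
      have : 0 ≤ v - u := by linarith
      gcongr
    _ = Real.pi * (v - u) * (1 + 2 * c) * (Real.exp (Real.pi / 2 * u ^ 2) *
        Real.exp (-Real.pi * u ^ 2)) := by ring
    _ ≤ Real.pi * (v - u) * (1 + 2 * c) * (Real.exp (Real.pi * c ^ 2) *
        Real.exp (-(Real.pi / 4) * w ^ 2)) := by
      have : 0 ≤ v - u := by linarith
      gcongr
    _ = _ := by ring


theorem lintegral_gaussian (m : ℕ) (D : ℝ) {s : ℝ} (hs : 0 < s) :
    ∫⁻ y : Euc m, ENNReal.ofReal ((s ^ m)⁻¹ * (D * Real.exp (-(Real.pi / 4) * (‖y‖ / s) ^ 2))) =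
      ENNReal.ofReal (D * 2 ^ m) := by
  have hpi := Real.pi_pos
  have hb : 0 < Real.pi / (4 * s ^ 2) := by positivity
  have h1 := GaussianFourier.integral_rexp_neg_mul_sq_norm (V := Euc m) hb
  have h2 : (Real.pi / (Real.pi / (4 * s ^ 2))) ^ (Module.finrank ℝ (Euc m) / 2 : ℝ) =
      (2 * s) ^ m := by
    rw [finrank_euclideanSpace_fin, show Real.pi / (Real.pi / (4 * s ^ 2)) = (2 * s) ^ (2 : ℝ) by
      rw [Real.rpow_two]; field_simp; norm_num, ← Real.rpow_mul (by positivity),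
      mul_div_cancel₀ _ (two_ne_zero), Real.rpow_natCast]
  rw [h2] at h1
  have hint : Integrable fun y : Euc m => Real.exp (-(Real.pi / (4 * s ^ 2)) * ‖y‖ ^ 2) := by
    refine Integrable.of_integral_ne_zero ?_
    rw [h1]; positivity
  have h3 : ∀ y : Euc m, ENNReal.ofReal ((s ^ m)⁻¹ *
      (D * Real.exp (-(Real.pi / 4) * (‖y‖ / s) ^ 2))) = ENNReal.ofReal ((s ^ m)⁻¹ * D) *
        ENNReal.ofReal (Real.exp (-(Real.pi / (4 * s ^ 2)) * ‖y‖ ^ 2)) := by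
    intro y
    rw [← mul_assoc, ENNReal.ofReal_mul' (Real.exp_pos _).le]
    congr 3
    field_simp
  simp_rw [h3]
  rw [lintegral_const_mul' _ _ ENNReal.ofReal_ne_top, ← ofReal_integral_eq_lintegral_ofReal hint
    (Eventually.of_forall fun _ => (Real.exp_pos _).le), h1, ← ENNReal.ofReal_mul' (by positivity)]
  congr 1
  rw [mul_pow]
  field_simp

theorem gaussWeight_eq {s : ℝ} (x : Euc m) :
    gaussWeight m s x = (s ^ m)⁻¹ * Real.exp (-Real.pi * (‖x‖ / s) ^ 2) := by
  unfold gaussWeight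
  congr 2
  rw [div_pow]
  ring

theorem gaussWeight_bound {K : Set (Euc n)} (hK : IsCompact K) : ∃ B : ℝ≥0, ∀ᶠ s in atTop,
    ∑' z : C.lattice, K.indicator (fun _ => ENNReal.ofReal (gaussWeight m s z.1.1)) z.1.2 ≤ B := by
  obtain ⟨B, hB, h⟩ := C.tsum_le_lintegral hK
  refine ⟨(B * ENNReal.ofReal (Real.exp Real.pi * 2 ^ m)).toNNReal, ?_⟩
  filter_upwards [eventually_ge_atTop 1] with s hs
  have hs0 : 0 < s := by linarith
  have hpi := Real.pi_pos
  rw [ENNReal.coe_toNNReal (by finiteness), ← lintegral_gaussian m _ hs0]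
  refine h (fun x => ENNReal.ofReal (gaussWeight m s x)) _ fun x y hxy => ?_
  rw [gaussWeight_eq, ← Real.exp_add]
  refine ENNReal.ofReal_le_ofReal ?_
  gcongr
  have e2 : ‖y‖ / s ≤ ‖x‖ / s + 1 := by
    have := norm_sub_norm_le y x; rw [← dist_eq_norm, dist_comm] at this
    rw [div_add' _ _ _ hs0.ne']
    gcongr; linarith
  have : (‖y‖ / s) ^ 2 ≤ 2 * (‖x‖ / s) ^ 2 + 2 := by
    have : 0 ≤ ‖y‖ / s := by positivity
    nlinarith [sq_nonneg (‖x‖ / s - 1)]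
  nlinarith [sq_nonneg (‖x‖ / s)]

theorem gaussWeight_shift {K : Set (Euc n)} (hK : IsCompact K) (t : Euc m) : Tendsto (fun s =>
    ∑' z : C.lattice, K.indicator (fun _ =>
      ENNReal.ofReal |gaussWeight m s (z.1.1 + t) - gaussWeight m s z.1.1|) z.1.2) atTop (𝓝 0) := by
  obtain ⟨B, hB, h⟩ := C.tsum_le_lintegral hK
  -- Both x and x + t lie within c of y, and so do their scaled norms once s ≥ 1. Scaling leaves a
  -- spare factor s⁻¹ in the final bound.
  set c : ℝ := ‖t‖ + 1
  set D : ℝ := ‖t‖ * (Real.pi * (1 + 2 * c) * Real.exp (Real.pi * c ^ 2))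
  have hpi := Real.pi_pos
  have hlim : Tendsto (fun s : ℝ => B * ENNReal.ofReal ((s⁻¹ * D) * 2 ^ m)) atTop (𝓝 0) := by
    have : Tendsto (fun s : ℝ => (s⁻¹ * D) * 2 ^ m) atTop (𝓝 ((0 * D) * 2 ^ m)) :=
      (tendsto_inv_atTop_zero.mul_const D).mul_const _
    have := ENNReal.Tendsto.const_mul (ENNReal.tendsto_ofReal this) (Or.inr hB)
    simpa using this
  refine tendsto_of_tendsto_of_tendsto_of_le_of_le' tendsto_const_nhds hlim
    (Eventually.of_forall fun _ => zero_le) ?_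
  filter_upwards [eventually_ge_atTop 1] with s hs
  have hs0 : 0 < s := by linarith
  rw [← lintegral_gaussian m _ hs0]
  refine h (fun x => ENNReal.ofReal |gaussWeight m s (x + t) - gaussWeight m s x|) _
    fun x y hxy => ?_
  have hdiv : ∀ u v : Euc m, |‖u‖ / s - ‖v‖ / s| ≤ ‖u - v‖ / s := fun u v => by
    rw [← sub_div, abs_div, abs_of_pos hs0]
    gcongr
    exact abs_norm_sub_norm_le u v
  have hdiv' : ∀ u v : Euc m, ‖u - v‖ ≤ c → |‖u‖ / s - ‖v‖ / s| ≤ c := fun u v huv =>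
    (hdiv u v).trans ((div_le_self (norm_nonneg _) hs).trans huv)
  rw [dist_eq_norm] at hxy
  have hxc : ‖x - y‖ ≤ c := hxy.trans (by simp [c])
  have hxtc : ‖x + t - y‖ ≤ c := by
    rw [add_sub_right_comm]
    exact (norm_add_le _ _).trans (by simp only [c]; linarith)
  have key := exp_neg_sub_exp_neg_le (div_nonneg (norm_nonneg x) hs0.le)
    (div_nonneg (norm_nonneg (x + t)) hs0.le) (div_nonneg (norm_nonneg y) hs0.le)
    (hdiv' _ _ hxc) (hdiv' _ _ hxtc)
  have hvu : |‖x + t‖ / s - ‖x‖ / s| ≤ s⁻¹ * ‖t‖ := by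
    have := hdiv (x + t) x
    rwa [add_sub_cancel_left, div_eq_inv_mul ‖t‖] at this
  rw [gaussWeight_eq, gaussWeight_eq, ← mul_sub, abs_mul, abs_of_pos (by positivity)]
  refine ENNReal.ofReal_le_ofReal ?_
  gcongr
  refine key.trans ?_
  simp only [D, ← mul_assoc s⁻¹]
  have : 0 ≤ c := by positivity
  gcongr

/-- On the ball of radius s the Gaussian weight is at least exp(-π) times the ball weight. -/
theorem gaussWeight_lower {W : Set (Euc n)} (hW : (interior W).Nonempty) :
    ∃ c : ℝ≥0, 0 < c ∧ ∀ᶠ s in atTop, c ≤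
      ∑' z : C.lattice, W.indicator (fun _ => ENNReal.ofReal (gaussWeight m s z.1.1)) z.1.2 := by
  obtain ⟨c, hc, h⟩ := C.ballWeight_lower hW
  have hpi := Real.pi_pos
  refine ⟨(Real.exp (-Real.pi)).toNNReal * c,
    mul_pos (Real.toNNReal_pos.2 (Real.exp_pos _)) hc, ?_⟩
  filter_upwards [h, eventually_gt_atTop 0] with s hs hs0
  rw [ENNReal.coe_mul]
  refine (mul_le_mul_right hs _).trans ?_
  rw [← ENNReal.tsum_mul_left]
  refine ENNReal.tsum_le_tsum fun z => ?_
  by_cases hz : z.1.2 ∈ W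
  · rw [Set.indicator_of_mem hz, Set.indicator_of_mem hz, ← ENNReal.ofReal,
      ← ENNReal.ofReal_mul (Real.exp_pos _).le, gaussWeight_eq]
    refine ENNReal.ofReal_le_ofReal ?_
    unfold ballWeight
    by_cases hx : z.1.1 ∈ Metric.closedBall (0 : Euc m) s
    · rw [Set.indicator_of_mem hx, mul_comm]
      gcongr
      rw [mem_closedBall_zero_iff] at hx
      have : (‖z.1.1‖ / s) ^ 2 ≤ 1 :=
        pow_le_one₀ (by positivity) ((div_le_one hs0).2 hx)
      nlinarith
    · rw [Set.indicator_of_notMem hx, mul_zero]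
      positivity
  · simp [Set.indicator_of_notMem hz]

theorem isAveraging_gaussWeight : C.IsAveraging (gaussWeight m) where
  nonneg := by
    filter_upwards [eventually_ge_atTop 0] with s hs x
    unfold gaussWeight
    positivity
  bound _ hK := C.gaussWeight_bound hK
  shift _ hK t := C.gaussWeight_shift hK t
  lower _ hW := C.gaussWeight_lower hW

end CutProjectScheme

/-! ### Means along an ultrafilter. -/

namespace CutProjectScheme

variable {m n : ℕ} (C : CutProjectScheme m n)

open scoped ENNReal NNReal

/-- The sum of a function on the lattice, weighted by a function on physical space. -/
def wsum (a : Euc m → ℝ) (f : C.lattice → ℂ) : ℂ := ∑' z : C.lattice, (a z.1.1 : ℂ) * f z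

/-- `f` is bounded by `M` and lives on the lattice points with second component in `K`. -/
def IsDominated (K : Set (Euc n)) (M : ℝ≥0) (f : C.lattice → ℂ) : Prop :=
  ∀ z : C.lattice, ‖f z‖ ≤ K.indicator (fun _ => (M : ℝ)) z.1.2

/-- `f` is bounded and lives on the lattice points with second component in a compact set. -/
def IsAdmissible (f : C.lattice → ℂ) : Prop := ∃ K M, IsCompact K ∧ C.IsDominated K M f

/-- The limit of weighted sums along an ultrafilter. -/
def umean (U : Ultrafilter ℝ) (a : ℝ → Euc m → ℝ) (f : C.lattice → ℂ) : ℂ :=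
  limUnder (U : Filter ℝ) (fun s => C.wsum (a s) f)

variable {C}

theorem IsDominated.mono {K K' : Set (Euc n)} {M M' : ℝ≥0} {f : C.lattice → ℂ}
    (h : C.IsDominated K M f) (hK : K ⊆ K') (hM : M ≤ M') : C.IsDominated K' M' f := fun z =>
  (h z).trans <| (Set.indicator_le_indicator_of_subset hK (fun _ => M.2) _).trans <|
    Set.indicator_le_indicator (NNReal.coe_le_coe.2 hM)

theorem isDominated_of {K : Set (Euc n)} {M : ℝ≥0} {f : C.lattice → ℂ}
    (h1 : ∀ z, ‖f z‖ ≤ M) (h0 : ∀ z, z.1.2 ∉ K → f z = 0) : C.IsDominated K M f := fun z => by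
  by_cases hz : z.1.2 ∈ K
  · rw [Set.indicator_of_mem hz]; exact h1 z
  · rw [Set.indicator_of_notMem hz, h0 z hz, norm_zero]

theorem IsAdmissible.add {f g : C.lattice → ℂ} (hf : C.IsAdmissible f) (hg : C.IsAdmissible g) :
    C.IsAdmissible (fun z => f z + g z) := by
  obtain ⟨K, M, hK, hf⟩ := hf
  obtain ⟨K', M', hK', hg⟩ := hg
  refine ⟨K ∪ K', M + M', hK.union hK', fun z => ?_⟩
  have h1 := hf.mono (Set.subset_union_left (t := K')) le_rfl z
  have h2 := hg.mono (Set.subset_union_right (s := K)) le_rfl z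
  refine (norm_add_le _ _).trans ((add_le_add h1 h2).trans (le_of_eq ?_))
  by_cases hz : z.1.2 ∈ K ∪ K' <;> simp [Set.indicator, hz]

theorem IsAdmissible.mul_left {f : C.lattice → ℂ} (hf : C.IsAdmissible f) {e : C.lattice → ℂ}
    {M' : ℝ≥0} (he : ∀ z, ‖e z‖ ≤ M') : C.IsAdmissible (fun z => e z * f z) := by
  obtain ⟨K, M, hK, hf⟩ := hf
  refine ⟨K, M' * M, hK, fun z => ?_⟩
  rw [norm_mul]
  refine (mul_le_mul (he z) (hf z) (norm_nonneg _) M'.2).trans (le_of_eq ?_)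
  by_cases hz : z.1.2 ∈ K <;> simp [Set.indicator, hz]

theorem IsAdmissible.const_mul {f : C.lattice → ℂ} (hf : C.IsAdmissible f) (c : ℂ) :
    C.IsAdmissible (fun z => c * f z) :=
  hf.mul_left (e := fun _ => c) (M' := ‖c‖₊) (fun _ => le_rfl)

theorem IsAdmissible.translate {f : C.lattice → ℂ} (hf : C.IsAdmissible f) (l : C.lattice) :
    C.IsAdmissible (fun z => f (z + l)) := by
  obtain ⟨K, M, hK, hf⟩ := hf
  refine ⟨(fun y => y - l.1.2) '' K, M, hK.image (by fun_prop), fun z => (hf _).trans ?_⟩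
  by_cases hz : (z + l).1.2 ∈ K
  · rw [Set.indicator_of_mem hz, Set.indicator_of_mem]
    exact ⟨_, hz, by simp⟩
  · rw [Set.indicator_of_notMem hz]
    exact Set.indicator_nonneg (fun _ _ => M.2) _

theorem IsDominated.tsum_enorm_le {K : Set (Euc n)} {M : ℝ≥0} {f : C.lattice → ℂ}
    (h : C.IsDominated K M f) (a : Euc m → ℝ) :
    ∑' z : C.lattice, ‖(a z.1.1 : ℂ) * f z‖ₑ ≤
      M * ∑' z : C.lattice, K.indicator (fun _ => ENNReal.ofReal |a z.1.1|) z.1.2 := by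
  rw [← ENNReal.tsum_mul_left]
  refine ENNReal.tsum_le_tsum fun z => ?_
  have := h z
  by_cases hz : z.1.2 ∈ K
  · rw [Set.indicator_of_mem hz] at this ⊢
    rw [enorm_mul, mul_comm]
    have h1 : ‖(a z.1.1 : ℂ)‖ₑ = ENNReal.ofReal |a z.1.1| := by
      rw [← ofReal_norm, Complex.norm_real, Real.norm_eq_abs]
    have h2 : ‖f z‖ₑ ≤ M := by
      rw [← ofReal_norm, ← ENNReal.ofReal_coe_nnreal]
      exact ENNReal.ofReal_le_ofReal this
    rw [h1]
    gcongr
  · rw [Set.indicator_of_notMem hz] at this ⊢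
    have : f z = 0 := norm_le_zero_iff.1 this
    simp [this]

variable {a : ℝ → Euc m → ℝ}

theorem IsAveraging.bound_abs (ha : C.IsAveraging a) {K : Set (Euc n)} (hK : IsCompact K) :
    ∃ B : ℝ≥0, ∀ᶠ s in atTop,
      ∑' z : C.lattice, K.indicator (fun _ => ENNReal.ofReal |a s z.1.1|) z.1.2 ≤ B := by
  obtain ⟨B, hB⟩ := ha.bound K hK
  refine ⟨B, ?_⟩
  filter_upwards [hB, ha.nonneg] with s hs h0
  simpa only [abs_of_nonneg (h0 _)] using hs

/-- One constant and one range of s serve all dominated f. This uniformity gives continuity of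
translated means and allows f to vary with s in `tendsto_ballMean_of_shift`. -/
theorem IsAveraging.wsum_bound (ha : C.IsAveraging a) {K : Set (Euc n)} (hK : IsCompact K) :
    ∃ B : ℝ≥0, ∀ᶠ s in atTop, ∀ (M : ℝ≥0) (f : C.lattice → ℂ), C.IsDominated K M f →
      Summable (fun z : C.lattice => (a s z.1.1 : ℂ) * f z) ∧ ‖C.wsum (a s) f‖ ≤ M * B := by
  obtain ⟨B, hB⟩ := ha.bound_abs hK
  refine ⟨B, ?_⟩
  filter_upwards [hB] with s hs M f hf
  have h1 : ∑' z : C.lattice, ‖(a s z.1.1 : ℂ) * f z‖ₑ ≤ M * B :=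
    (hf.tsum_enorm_le _).trans (by gcongr)
  have h2 := tsum_enorm_ne_top_iff_summable_norm.1 (ne_top_of_le_ne_top (by finiteness) h1)
  refine ⟨h2.of_norm, ?_⟩
  have h3 := enorm_tsum_le_tsum_enorm.trans h1
  rw [← ofReal_norm] at h3
  have := ENNReal.toReal_mono (by finiteness) h3
  rwa [ENNReal.toReal_ofReal (norm_nonneg _)] at this

theorem IsAveraging.summable (ha : C.IsAveraging a) {f : C.lattice → ℂ} (hf : C.IsAdmissible f) :
    ∀ᶠ s in atTop, Summable (fun z : C.lattice => (a s z.1.1 : ℂ) * f z) := by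
  obtain ⟨K, M, hK, hf⟩ := hf
  obtain ⟨B, hB⟩ := ha.wsum_bound hK
  filter_upwards [hB] with s hs using (hs M f hf).1

variable {U : Ultrafilter ℝ}

/-- The weighted sums eventually stay in a compact disc, where an ultrafilter must converge; hence
`limUnder` returns a genuine limit. -/
theorem tendsto_umean (ha : C.IsAveraging a) (hU : (U : Filter ℝ) ≤ atTop) {f : C.lattice → ℂ}
    (hf : C.IsAdmissible f) :
    Tendsto (fun s => C.wsum (a s) f) U (𝓝 (C.umean U a f)) := by
  obtain ⟨K, M, hK, hf⟩ := hf
  obtain ⟨B, hB⟩ := ha.wsum_bound hK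
  have h1 : ∀ᶠ s in (U : Filter ℝ), C.wsum (a s) f ∈ Metric.closedBall (0 : ℂ) (M * B) := by
    filter_upwards [hU hB] with s hs
    exact mem_closedBall_zero_iff.2 (hs M f hf).2
  obtain ⟨x, -, hx⟩ := (isCompact_closedBall (0 : ℂ) (M * B)).ultrafilter_le_nhds
    (U.map fun s => C.wsum (a s) f) (by
      rw [Ultrafilter.coe_map, le_principal_iff]; exact h1)
  exact tendsto_nhds_limUnder ⟨x, by rwa [Ultrafilter.coe_map] at hx⟩

theorem umean_add (ha : C.IsAveraging a) (hU : (U : Filter ℝ) ≤ atTop) {f g : C.lattice → ℂ}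
    (hf : C.IsAdmissible f) (hg : C.IsAdmissible g) :
    C.umean U a (fun z => f z + g z) = C.umean U a f + C.umean U a g := by
  refine tendsto_nhds_unique (tendsto_umean ha hU (hf.add hg)) ?_
  refine ((tendsto_umean ha hU hf).add (tendsto_umean ha hU hg)).congr' ?_
  filter_upwards [hU (ha.summable hf), hU (ha.summable hg)] with s h1 h2
  rw [wsum, wsum, wsum, ← h1.tsum_add h2]
  simp_rw [mul_add]

theorem umean_const_mul (ha : C.IsAveraging a) (hU : (U : Filter ℝ) ≤ atTop) {f : C.lattice → ℂ}
    (hf : C.IsAdmissible f) (c : ℂ) :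
    C.umean U a (fun z => c * f z) = c * C.umean U a f := by
  refine tendsto_nhds_unique (tendsto_umean ha hU (hf.const_mul c)) ?_
  refine ((tendsto_umean ha hU hf).const_mul c).congr fun s => ?_
  rw [wsum, wsum, ← tsum_mul_left]
  simp_rw [mul_left_comm]

theorem umean_sub (ha : C.IsAveraging a) (hU : (U : Filter ℝ) ≤ atTop) {f g : C.lattice → ℂ}
    (hf : C.IsAdmissible f) (hg : C.IsAdmissible g) :
    C.umean U a (fun z => f z - g z) = C.umean U a f - C.umean U a g := by
  have := umean_add ha hU hf (hg.const_mul (-1))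
  rw [umean_const_mul ha hU hg] at this
  simpa [sub_eq_add_neg] using this

theorem exists_norm_umean_le (ha : C.IsAveraging a) (hU : (U : Filter ℝ) ≤ atTop)
    {K : Set (Euc n)} (hK : IsCompact K) :
    ∃ B : ℝ≥0, ∀ (M : ℝ≥0) (f : C.lattice → ℂ), C.IsDominated K M f →
      ‖C.umean U a f‖ ≤ M * B := by
  obtain ⟨B, hB⟩ := ha.wsum_bound hK
  refine ⟨B, fun M f hf => ?_⟩
  refine le_of_tendsto (tendsto_umean ha hU ⟨K, M, hK, hf⟩).norm ?_
  filter_upwards [hU hB] with s hs using (hs M f hf).2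

/-- Monotonicity of the mean, from eventual nonnegativity of the weights. It supplies both the
positivity needed for the Riesz theorem and the control of approximation defects. -/
theorem norm_umean_le_umean (ha : C.IsAveraging a) (hU : (U : Filter ℝ) ≤ atTop)
    {f : C.lattice → ℂ} {r : C.lattice → ℝ} (hr : C.IsAdmissible (fun z => (r z : ℂ)))
    (hfr : ∀ z, ‖f z‖ ≤ r z) : ‖C.umean U a f‖ ≤ (C.umean U a (fun z => (r z : ℂ))).re := by
  have hf : C.IsAdmissible f := by
    obtain ⟨K, M, hK, hr⟩ := hr
    refine ⟨K, M, hK, fun z => (hfr z).trans ((le_abs_self _).trans ?_)⟩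
    simpa [Complex.norm_real] using hr z
  refine le_of_tendsto_of_tendsto (tendsto_umean ha hU hf).norm
    ((Complex.continuous_re.tendsto _).comp (tendsto_umean ha hU hr)) ?_
  filter_upwards [hU (ha.summable hf), hU (ha.summable hr), hU ha.nonneg] with s h1 h2 h0
  have h3 : Summable fun z : C.lattice => a s z.1.1 * r z := by
    rw [← Complex.summable_ofReal]; simpa using h2
  have h4 : (C.wsum (a s) fun z => (r z : ℂ)).re = ∑' z : C.lattice, a s z.1.1 * r z := by
    rw [wsum, ← Complex.ofReal_re (∑' z : C.lattice, a s z.1.1 * r z), Complex.ofReal_tsum]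
    simp
  simp only [Function.comp]
  rw [h4]
  refine tsum_of_norm_bounded h3.hasSum fun z => ?_
  rw [norm_mul, Complex.norm_real, Real.norm_eq_abs, abs_of_nonneg (h0 _)]
  exact mul_le_mul_of_nonneg_left (hfr z) (h0 _)

theorem umean_ofReal_im (ha : C.IsAveraging a) (hU : (U : Filter ℝ) ≤ atTop)
    {r : C.lattice → ℝ} (hr : C.IsAdmissible (fun z => (r z : ℂ))) :
    (C.umean U a (fun z => (r z : ℂ))).im = 0 := by
  refine tendsto_nhds_unique ((Complex.continuous_im.tendsto _).comp (tendsto_umean ha hU hr)) ?_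
  refine tendsto_const_nhds.congr fun s => ?_
  simp only [Function.comp, wsum]
  rw [← Complex.ofReal_im (∑' z : C.lattice, a s z.1.1 * r z), Complex.ofReal_tsum]
  simp

theorem umean_translate (ha : C.IsAveraging a) (hU : (U : Filter ℝ) ≤ atTop) {f : C.lattice → ℂ}
    (hf : C.IsAdmissible f) (l : C.lattice) :
    C.umean U a (fun z => f (z + l)) = C.umean U a f := by
  have hfl := hf.translate l
  rw [← sub_eq_zero, ← norm_le_zero_iff]
  have h1 := ((tendsto_umean ha hU hfl).sub (tendsto_umean ha hU hf)).norm
  obtain ⟨K, M, hK, hd⟩ := id hf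
  have h2 := (ha.shift K hK (-l.1.1)).mono_left hU
  have h3 : Tendsto (fun s => (M : ℝ≥0∞) * ∑' z : C.lattice, K.indicator (fun _ =>
      ENNReal.ofReal |a s (z.1.1 + -l.1.1) - a s z.1.1|) z.1.2) U (𝓝 0) := by
    simpa using ENNReal.Tendsto.const_mul h2 (Or.inr ENNReal.coe_ne_top)
  have h4 := (ENNReal.tendsto_toReal ENNReal.zero_ne_top).comp h3
  refine le_of_tendsto_of_tendsto h1 h4 ?_
  filter_upwards [hU (ha.summable hfl), hU (ha.summable hf),
    h3.eventually (gt_mem_nhds ENNReal.zero_lt_top)] with s s1 s2 s3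
  -- Reindexing moves the translation from f to the weight, where the `shift` property applies.
  have e1 : ∀ z : C.lattice, (a s z.1.1 : ℂ) * f (z + l) =
      (fun z : C.lattice => (a s (z.1.1 + -l.1.1) : ℂ) * f z) (Equiv.addRight l z) := by
    intro z; simp
  have s1' : Summable (fun z : C.lattice => (a s (z.1.1 + -l.1.1) : ℂ) * f z) := by
    rw [← (Equiv.addRight l).summable_iff]
    exact s1.congr e1
  have e2 : C.wsum (a s) (fun z => f (z + l)) - C.wsum (a s) f =
      C.wsum (fun x => a s (x + -l.1.1) - a s x) f := by
    rw [wsum, tsum_congr e1, (Equiv.addRight l).tsum_eq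
      (fun z : C.lattice => (a s (z.1.1 + -l.1.1) : ℂ) * f z), wsum, wsum, ← s1'.tsum_sub s2]
    refine tsum_congr fun z => ?_
    push_cast; ring
  rw [e2]
  have h5 := enorm_tsum_le_tsum_enorm.trans (hd.tsum_enorm_le (fun x => a s (x + -l.1.1) - a s x))
  rw [← ofReal_norm] at h5
  have := ENNReal.toReal_mono s3.ne h5
  rwa [ENNReal.toReal_ofReal (norm_nonneg _)] at this

theorem isAdmissible_of_hasCompactSupport {F : Euc n → ℂ} (hF : Continuous F)
    (hc : HasCompactSupport F) : C.IsAdmissible (fun z => F z.1.2) := by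
  obtain ⟨M, hM⟩ := hF.bounded_above_of_compact_support hc
  refine ⟨tsupport F, M.toNNReal, hc, isDominated_of (fun z => ?_) (fun z hz => ?_)⟩
  · exact (hM _).trans (Real.le_coe_toNNReal _)
  · exact image_eq_zero_of_notMem_tsupport hz

theorem continuous_umean_translate (ha : C.IsAveraging a) (hU : (U : Filter ℝ) ≤ atTop)
    {e : C.lattice → ℂ} (he : ∀ z, ‖e z‖ ≤ 1) {F : Euc n → ℂ} (hF : Continuous F)
    (hc : HasCompactSupport F) :
    Continuous fun u : Euc n => C.umean U a (fun z => e z * F (z.1.2 + u)) := by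
  have hadm : ∀ u : Euc n, C.IsAdmissible (fun z => e z * F (z.1.2 + u)) := fun u =>
    (isAdmissible_of_hasCompactSupport (F := fun y => F (y + u)) (by fun_prop)
      (hc.comp_homeomorph (Homeomorph.addRight u))).mul_left (M' := 1) (by simpa using he)
  rw [continuous_iff_continuousAt]
  intro u₀
  obtain ⟨D, hD⟩ := hc.isCompact.isBounded.subset_closedBall 0
  -- This ball contains the supports of all translates of F by vectors within distance 1 of u₀, so
  -- one constant bounds every difference; uniform continuity of F does the rest.
  obtain ⟨B, hB⟩ := exists_norm_umean_le ha hU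
    (isCompact_closedBall (0 : Euc n) (D + ‖u₀‖ + 1))
  rw [Metric.continuousAt_iff]
  intro ε hε
  have huc := hc.uniformContinuous_of_continuous hF
  have hε' : 0 < ε / (B + 1) := by positivity
  obtain ⟨δ, hδ, h⟩ := Metric.uniformContinuous_iff.1 huc _ hε'
  refine ⟨min δ 1, lt_min hδ one_pos, fun {u} hu => ?_⟩
  rw [lt_min_iff] at hu
  rw [dist_eq_norm, ← umean_sub ha hU (hadm u) (hadm u₀)]
  refine (hB (ε / (B + 1)).toNNReal _ (isDominated_of (fun z => ?_) (fun z hz => ?_))).trans_lt ?_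
  · rw [← mul_sub, norm_mul, Real.coe_toNNReal _ hε'.le, ← dist_eq_norm]
    refine (mul_le_of_le_one_left dist_nonneg (he z)).trans (h ?_).le
    rw [dist_add_left]; exact hu.1
  · have hz' : D + ‖u₀‖ + 1 < ‖z.1.2‖ := by simpa using hz
    have hvan : ∀ v : Euc n, ‖v‖ ≤ ‖u₀‖ + 1 → F (z.1.2 + v) = 0 := by
      intro v hv
      refine image_eq_zero_of_notMem_tsupport fun hmem => ?_
      have h1 := mem_closedBall_zero_iff.1 (hD hmem)
      have h2 : ‖z.1.2‖ ≤ ‖z.1.2 + v‖ + ‖v‖ := by simpa using norm_sub_le (z.1.2 + v) v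
      linarith
    rw [hvan u₀ (by linarith), hvan u, sub_self]
    have := norm_sub_norm_le u u₀
    rw [← dist_eq_norm] at this
    linarith
  · rw [Real.coe_toNNReal _ hε'.le, div_mul_eq_mul_div, div_lt_iff₀ (by positivity)]
    nlinarith [B.2]

end CutProjectScheme

/-! ### Equidistribution in internal space and dual characters. -/

namespace CutProjectScheme

variable {m n : ℕ} {C : CutProjectScheme m n}

open scoped ENNReal NNReal CompactlySupported

variable {a : ℝ → Euc m → ℝ} {U : Ultrafilter ℝ}

theorem isAdmissible_comp (F : C_c(Euc n, ℝ)) :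
    C.IsAdmissible (fun z => ((F z.1.2 : ℝ) : ℂ)) :=
  isAdmissible_of_hasCompactSupport (F := fun y => ((F y : ℝ) : ℂ)) (by fun_prop)
    (F.hasCompactSupport.comp_left (g := fun r : ℝ => (r : ℂ)) Complex.ofReal_zero)

/-- The mean along an ultrafilter as a positive functional on the functions of compact support on
internal space. -/
def umeanFunctional (ha : C.IsAveraging a) (hU : (U : Filter ℝ) ≤ atTop) :
    C_c(Euc n, ℝ) →ₚ[ℝ] ℝ :=
  PositiveLinearMap.mk₀
    { toFun := fun F => (C.umean U a (fun z => ((F z.1.2 : ℝ) : ℂ))).re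
      map_add' := fun F G => by
        rw [← Complex.add_re, ← umean_add ha hU (isAdmissible_comp F) (isAdmissible_comp G)]
        simp
      map_smul' := fun c F => by
        have := umean_const_mul ha hU (isAdmissible_comp F) (c : ℂ)
        rw [RingHom.id_apply, smul_eq_mul, ← Complex.re_ofReal_mul, ← this]
        simp }
    (fun F hF => by
      refine (norm_nonneg (C.umean U a (fun _ => 0))).trans ?_
      exact norm_umean_le_umean ha hU (isAdmissible_comp F) (fun z => by
        rw [norm_zero]; exact hF z.1.2))

theorem umeanFunctional_apply (ha : C.IsAveraging a) (hU : (U : Filter ℝ) ≤ atTop)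
    (F : C_c(Euc n, ℝ)) :
    umeanFunctional ha hU F = (C.umean U a (fun z => ((F z.1.2 : ℝ) : ℂ))).re := rfl

/-- Invariance under L^* comes from translating lattice points; density of L^* and continuity in u
extend it to all of internal space. -/
theorem umean_translate_of_continuous (ha : C.IsAveraging a) (hU : (U : Filter ℝ) ≤ atTop)
    {F : Euc n → ℂ} (hF : Continuous F) (hc : HasCompactSupport F) (u : Euc n) :
    C.umean U a (fun z => F (z.1.2 + u)) = C.umean U a (fun z => F z.1.2) := by
  have h1 := continuous_umean_translate ha hU (e := fun _ => 1) (by simp) hF hc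
  simp only [one_mul] at h1
  have h2 := Continuous.ext_on C.snd_dense h1 (continuous_const
    (y := C.umean U a (fun z => F z.1.2))) ?_
  · exact congrFun h2 u
  · rintro _ ⟨l, hl, rfl⟩
    exact umean_translate ha hU (isAdmissible_of_hasCompactSupport hF hc) ⟨l, hl⟩

theorem exists_umean_eq_integral_real (ha : C.IsAveraging a) (hU : (U : Filter ℝ) ≤ atTop) :
    ∃ c : ℝ, ∀ F : C_c(Euc n, ℝ),
      (C.umean U a (fun z => ((F z.1.2 : ℝ) : ℂ))).re = c * ∫ y, F y := by
  set μ := RealRMK.rieszMeasure (umeanFunctional ha hU)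
  -- With invariance, uniqueness of Haar measure makes the Riesz measure a multiple of Lebesgue
  -- measure.
  have hinv : μ.IsAddLeftInvariant := by
    refine ⟨fun u => ?_⟩
    have : (Measure.map (u + ·) μ).Regular := Measure.Regular.map (Homeomorph.addLeft u)
    refine Measure.ext_of_integral_eq_on_compactlySupported fun F => ?_
    rw [show ∫ y, F y ∂Measure.map (u + ·) μ = ∫ y, F (u + y) ∂μ from
      (Homeomorph.addLeft u).measurableEmbedding.integral_map F]
    let G : C_c(Euc n, ℝ) := ⟨⟨fun y => F (u + y), by fun_prop⟩,
      F.hasCompactSupport.comp_homeomorph (Homeomorph.addLeft u)⟩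
    have h1 : ∫ y, F (u + y) ∂μ = umeanFunctional ha hU G :=
      RealRMK.integral_rieszMeasure (umeanFunctional ha hU) G
    have h2 : ∫ y, F y ∂μ = umeanFunctional ha hU F :=
      RealRMK.integral_rieszMeasure (umeanFunctional ha hU) F
    rw [h1, h2, umeanFunctional_apply, umeanFunctional_apply]
    have := umean_translate_of_continuous ha hU (F := fun y => ((F y : ℝ) : ℂ)) (by fun_prop)
      (F.hasCompactSupport.comp_left (g := fun r : ℝ => (r : ℂ)) Complex.ofReal_zero) u
    rw [← this]
    simp only [add_comm _ u]
    rfl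
  have hμ := Measure.isAddLeftInvariant_eq_smul μ volume
  refine ⟨(μ.addHaarScalarFactor volume : ℝ≥0), fun F => ?_⟩
  rw [← umeanFunctional_apply ha hU, ← RealRMK.integral_rieszMeasure]
  change ∫ x, F x ∂μ = _
  conv_lhs => rw [hμ]
  rw [integral_smul_nnreal_measure]
  rfl

theorem exists_umean_eq_integral (ha : C.IsAveraging a) (hU : (U : Filter ℝ) ≤ atTop) :
    ∃ c : ℝ, 0 < c ∧ ∀ F : Euc n → ℂ, Continuous F → HasCompactSupport F →
      C.umean U a (fun z => F z.1.2) = c * ∫ y, F y := by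
  obtain ⟨c, hc⟩ := exists_umean_eq_integral_real ha hU
  have hreal : ∀ F : C_c(Euc n, ℝ), C.umean U a (fun z => ((F z.1.2 : ℝ) : ℂ)) =
      c * ((∫ y, F y : ℝ) : ℂ) := fun F => by
    apply Complex.ext
    · rw [hc F, ← Complex.ofReal_mul, Complex.ofReal_re]
    · rw [umean_ofReal_im ha hU (isAdmissible_comp F), ← Complex.ofReal_mul, Complex.ofReal_im]
  refine ⟨c, ?_, fun F hF hFc => ?_⟩
  -- Positivity of c: a bump equal to 1 on the unit ball has mean bounded below by the `lower`
  -- property.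
  · obtain ⟨f, hf1, -, hfc, hf01⟩ := exists_continuous_one_zero_of_isCompact
      (isCompact_closedBall (0 : Euc n) 1) isClosed_empty (Set.disjoint_empty _)
    let F : C_c(Euc n, ℝ) := ⟨f, hfc⟩
    obtain ⟨b, hb, hlow⟩ := ha.lower (Metric.closedBall 0 1) ⟨0, by
      rw [mem_interior_iff_mem_nhds]; exact Metric.closedBall_mem_nhds _ one_pos⟩
    have h1 : (b : ℝ) ≤ (C.umean U a (fun z => ((F z.1.2 : ℝ) : ℂ))).re := by
      refine ge_of_tendsto ((Complex.continuous_re.tendsto _).comp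
        (tendsto_umean ha hU (isAdmissible_comp F))) ?_
      filter_upwards [hU hlow, hU ha.nonneg, hU (ha.summable (isAdmissible_comp F))]
        with s h1 h2 h3
      have h4 : Summable fun z : C.lattice => a s z.1.1 * F z.1.2 := by
        rw [← Complex.summable_ofReal]; simpa using h3
      have h5 : (C.wsum (a s) fun z => ((F z.1.2 : ℝ) : ℂ)).re =
          ∑' z : C.lattice, a s z.1.1 * F z.1.2 := by
        rw [wsum, ← Complex.ofReal_re (∑' z : C.lattice, a s z.1.1 * F z.1.2),
          Complex.ofReal_tsum]
        simp
      have h6 : ∀ z : C.lattice, 0 ≤ a s z.1.1 * F z.1.2 := fun z =>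
        mul_nonneg (h2 _) (hf01 _).1
      simp only [Function.comp]
      rw [h5, ← ENNReal.ofReal_le_ofReal_iff (tsum_nonneg h6),
        ENNReal.ofReal_tsum_of_nonneg h6 h4, ENNReal.ofReal_coe_nnreal]
      refine h1.trans (ENNReal.tsum_le_tsum fun z => ?_)
      by_cases hz : z.1.2 ∈ Metric.closedBall (0 : Euc n) 1
      · rw [Set.indicator_of_mem hz]
        have : F z.1.2 = 1 := hf1 hz
        rw [this, mul_one]
      · rw [Set.indicator_of_notMem hz]; exact zero_le
    rw [hc F] at h1
    have h2 : 0 ≤ ∫ y, F y := integral_nonneg fun y => (hf01 y).1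
    have h3 : 0 < c * ∫ y, F y := lt_of_lt_of_le (NNReal.coe_pos.2 hb) h1
    exact pos_of_mul_pos_left h3 h2
  · let R : C_c(Euc n, ℝ) := ⟨⟨fun y => (F y).re, by fun_prop⟩,
      hFc.comp_left (g := Complex.re) Complex.zero_re⟩
    let I : C_c(Euc n, ℝ) := ⟨⟨fun y => (F y).im, by fun_prop⟩,
      hFc.comp_left (g := Complex.im) Complex.zero_im⟩
    have h1 : (fun z : C.lattice => F z.1.2) = fun z : C.lattice =>
        ((R z.1.2 : ℝ) : ℂ) + Complex.I * ((I z.1.2 : ℝ) : ℂ) := by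
      ext z
      rw [mul_comm]
      exact (Complex.re_add_im _).symm
    rw [h1, umean_add ha hU (isAdmissible_comp R) ((isAdmissible_comp I).const_mul _),
      umean_const_mul ha hU (isAdmissible_comp I), hreal R, hreal I,
      ← integral_re_add_im (hF.integrable_of_hasCompactSupport hFc)]
    change _ = (c : ℂ) * (((∫ y, (F y).re : ℝ) : ℂ) + ((∫ y, (F y).im : ℝ) : ℂ) * Complex.I)
    change (c : ℂ) * ((∫ y, (F y).re : ℝ) : ℂ) +
      Complex.I * ((c : ℂ) * ((∫ y, (F y).im : ℝ) : ℂ)) = _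
    ring

/-- The phase `exp(-2πi k·x)`. -/
def phase (k x : Euc m) : ℂ := Complex.exp (-(2 * Real.pi * Complex.I * ((inner ℝ k x : ℝ) : ℂ)))

theorem phase_add (k x y : Euc m) : phase k (x + y) = phase k x * phase k y := by
  rw [phase, phase, phase, ← Complex.exp_add, inner_add_right]
  push_cast; ring_nf

theorem phase_zero_left (x : Euc m) : phase 0 x = 1 := by simp [phase]

theorem phase_zero_right (k : Euc m) : phase k 0 = 1 := by simp [phase]

theorem norm_phase (k x : Euc m) : ‖phase k x‖ = 1 := by
  rw [phase, show -(2 * Real.pi * Complex.I * ((inner ℝ k x : ℝ) : ℂ)) =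
    ((-(2 * Real.pi * inner ℝ k x) : ℝ) : ℂ) * Complex.I by push_cast; ring,
    Complex.norm_exp_ofReal_mul_I]

variable (C) in
/-- `χ` is the continuous character of internal space that restricts to `x^* ↦ exp(-2πi k·x)`. -/
structure IsDualCharacter (k : Euc m) (χ : Euc n → ℂ) : Prop where
  continuous : Continuous χ
  apply_snd : ∀ z ∈ C.lattice, χ z.2 = phase k z.1

namespace IsDualCharacter

variable {k : Euc m} {χ : Euc n → ℂ}

/-- Multiplicativity holds on L^* because the phase is multiplicative on the lattice; it extends by
density in one variable at a time. -/
theorem map_add (h : C.IsDualCharacter k χ) (u v : Euc n) : χ (u + v) = χ u * χ v := by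
  have hχ := h.continuous
  have h1 : ∀ z ∈ C.lattice, ∀ v, χ (z.2 + v) = χ z.2 * χ v := by
    intro z hz v
    refine congrFun (Continuous.ext_on (f := fun v => χ (z.2 + v)) (g := fun v => χ z.2 * χ v)
      C.snd_dense (by fun_prop) (by fun_prop) ?_) v
    rintro _ ⟨w, hw, rfl⟩
    simp only
    rw [← Prod.snd_add, h.apply_snd _ (C.lattice.add_mem hz hw), h.apply_snd _ hz,
      h.apply_snd _ hw, Prod.fst_add, phase_add]
  refine congrFun (Continuous.ext_on (f := fun u => χ (u + v)) (g := fun u => χ u * χ v)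
    C.snd_dense (by fun_prop) (by fun_prop) ?_) u
  rintro _ ⟨w, hw, rfl⟩
  exact h1 w hw v

theorem norm_eq_one (h : C.IsDualCharacter k χ) (u : Euc n) : ‖χ u‖ = 1 := by
  have hχ := h.continuous
  refine congrFun (Continuous.ext_on (f := fun u => ‖χ u‖) (g := fun _ => (1 : ℝ))
    C.snd_dense (by fun_prop) (by fun_prop) ?_) u
  rintro _ ⟨w, hw, rfl⟩
  simp only [h.apply_snd _ hw, norm_phase]

theorem map_zero (h : C.IsDualCharacter k χ) : χ 0 = 1 := by
  simpa [phase_zero_right] using h.apply_snd 0 C.lattice.zero_mem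

theorem map_neg (h : C.IsDualCharacter k χ) (u : Euc n) :
    χ (-u) = (starRingEnd ℂ) (χ u) := by
  have h1 : χ (-u) * χ u = 1 := by rw [← h.map_add, neg_add_cancel, h.map_zero]
  have h2 : χ u * (starRingEnd ℂ) (χ u) = 1 := by
    rw [Complex.mul_conj, Complex.normSq_eq_norm_sq, h.norm_eq_one]; simp
  calc χ (-u) = χ (-u) * (χ u * (starRingEnd ℂ) (χ u)) := by rw [h2, mul_one]
    _ = _ := by rw [← mul_assoc, h1, one_mul]

end IsDualCharacter

theorem isDualCharacter_zero : C.IsDualCharacter 0 (fun _ => 1) :=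
  ⟨continuous_const, fun z _ => (phase_zero_left z.1).symm⟩

/-- If the phase does not extend to a continuous character of internal space, then all its means
vanish. -/
theorem umean_phase_eq_zero (ha : C.IsAveraging a) (hU : (U : Filter ℝ) ≤ atTop) {k : Euc m}
    (hk : ¬ ∃ χ, C.IsDualCharacter k χ) {F : Euc n → ℂ} (hF : Continuous F)
    (hc : HasCompactSupport F) : C.umean U a (fun z => phase k z.1.1 * F z.1.2) = 0 := by
  by_contra h0
  set I := C.umean U a (fun z => phase k z.1.1 * F z.1.2) with hI
  have hadm : C.IsAdmissible (fun z => phase k z.1.1 * F z.1.2) :=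
    (isAdmissible_of_hasCompactSupport hF hc).mul_left (M' := 1)
      (fun z => (norm_phase k z.1.1).le)
  have hcont := continuous_umean_translate ha hU (e := fun z => phase k z.1.1)
    (fun z => (norm_phase k z.1.1).le) hF hc
  -- If the mean I is nonzero, the normalized means of the translates of F define a continuous
  -- function of u. Invariance under a lattice vector l shows that its value at l^* is the conjugate
  -- of the phase of l, so its conjugate is the forbidden dual character.
  refine hk ⟨fun u => (starRingEnd ℂ) (C.umean U a
    (fun z => phase k z.1.1 * F (z.1.2 + u)) * I⁻¹), by fun_prop, fun l hl => ?_⟩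
  have h1 := umean_translate ha hU hadm ⟨l, hl⟩
  have h2 : C.umean U a (fun z => phase k z.1.1 * F (z.1.2 + l.2)) * phase k l.1 = I := by
    rw [hI, ← h1, mul_comm, ← umean_const_mul ha hU]
    · congr 1
      ext z
      simp only [Submodule.coe_add, Prod.fst_add, Prod.snd_add, phase_add]
      ring
    · exact (isAdmissible_of_hasCompactSupport (F := fun y => F (y + l.2)) (by fun_prop)
        (hc.comp_homeomorph (Homeomorph.addRight l.2))).mul_left (M' := 1)
          (fun z => (norm_phase k z.1.1).le)
  have h3 : phase k l.1 * (starRingEnd ℂ) (phase k l.1) = 1 := by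
    rw [Complex.mul_conj, Complex.normSq_eq_norm_sq, norm_phase]; simp
  have h4 : C.umean U a (fun z => phase k z.1.1 * F (z.1.2 + l.2)) =
      I * (starRingEnd ℂ) (phase k l.1) := by
    rw [← h2, mul_assoc, h3, mul_one]
  rw [h4, mul_right_comm, mul_inv_cancel₀ h0, one_mul, Complex.conj_conj]

/-- A continuous function on a compact set with null boundary, extended by zero, differs from a
continuous function by a function below a continuous one of small integral. -/
theorem exists_continuous_approx {V : Set (Euc n)} (hV : IsCompact V)
    (hV0 : volume (frontier V) = 0) {ε : ℝ} (hε : 0 < ε) :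
    ∃ D : Euc n → ℝ, Continuous D ∧ HasCompactSupport D ∧ (∀ y, 0 ≤ D y) ∧ ∫ y, D y ≤ ε ∧
      ∀ F : Euc n → ℂ, Continuous F →
        Continuous (V.indicator fun y => F y - (D y : ℂ) * F y) := by
  obtain ⟨O, hO, hOo, hOv⟩ := (frontier V).exists_isOpen_lt_of_lt (μ := volume)
    (ENNReal.ofReal ε) (by rw [hV0]; exact ENNReal.ofReal_pos.2 hε)
  have hcf : IsCompact (frontier V) := hV.of_isClosed_subset isClosed_frontier
    (hV.isClosed.frontier_subset)
  obtain ⟨D, hD1, hD0, hDc, hD01⟩ := exists_continuous_one_zero_of_isCompact hcf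
    hOo.isClosed_compl (Set.disjoint_compl_right_iff_subset.2 hO)
  refine ⟨D, D.continuous, hDc, fun y => (hD01 y).1, ?_, fun F hF => ?_⟩
  · have hOf : volume O ≠ ∞ := (hOv.trans ENNReal.ofReal_lt_top).ne
    calc ∫ y, D y ≤ ∫ y, O.indicator (fun _ => (1 : ℝ)) y := by
          refine integral_mono (D.continuous.integrable_of_hasCompactSupport hDc)
            ((integrable_indicator_iff hOo.measurableSet).2 (integrableOn_const hOf)) fun y => ?_
          by_cases hy : y ∈ O
          · rw [Set.indicator_of_mem hy]; exact (hD01 y).2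
          · rw [Set.indicator_of_notMem hy, hD0 hy]; rfl
      _ = (volume O).toReal := by
          rw [integral_indicator hOo.measurableSet, setIntegral_const]; simp [Measure.real]
      _ ≤ ε := ENNReal.toReal_le_of_le_ofReal hε.le hOv.le
  -- Since D = 1 on the frontier, F - D F vanishes there and the cut-off creates no jump.
  · refine continuous_indicator (fun y hy => ?_) (Continuous.continuousOn (by fun_prop))
    rw [hD1 hy]; simp

theorem isAdmissible_indicator {V : Set (Euc n)} (hV : IsCompact V) {F : Euc n → ℂ}
    (hF : Continuous F) : C.IsAdmissible (fun z => V.indicator F z.1.2) := by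
  obtain ⟨M, hM⟩ := hV.exists_bound_of_continuousOn hF.continuousOn
  refine ⟨V, M.toNNReal, hV, fun z => ?_⟩
  dsimp only
  by_cases hz : z.1.2 ∈ V
  · rw [Set.indicator_of_mem hz, Set.indicator_of_mem hz]
    exact (hM _ hz).trans (Real.le_coe_toNNReal _)
  · rw [Set.indicator_of_notMem hz, Set.indicator_of_notMem hz, norm_zero]

/-- The defect of the approximation in `exists_continuous_approx` is small in the mean. -/
theorem norm_umean_sub_le (ha : C.IsAveraging a) (hU : (U : Filter ℝ) ≤ atTop)
    {e : C.lattice → ℂ} (he : ∀ z, ‖e z‖ ≤ 1) {V : Set (Euc n)} (hV : IsCompact V)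
    {F : Euc n → ℂ} (hF : Continuous F) {M : ℝ} (hM0 : 0 ≤ M) (hM : ∀ y ∈ V, ‖F y‖ ≤ M)
    {c : ℝ} (hc : ∀ F : Euc n → ℂ, Continuous F → HasCompactSupport F →
      C.umean U a (fun z => F z.1.2) = c * ∫ y, F y)
    {D : Euc n → ℝ} (hD : Continuous D) (hDc : HasCompactSupport D) (hD0 : ∀ y, 0 ≤ D y) :
    ‖C.umean U a (fun z => e z * V.indicator F z.1.2) -
      C.umean U a (fun z => e z * V.indicator (fun y => F y - (D y : ℂ) * F y) z.1.2)‖ ≤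
        M * (c * ∫ y, D y) := by
  have hDc' : HasCompactSupport (fun y => (D y : ℂ)) :=
    hDc.comp_left (g := fun r : ℝ => (r : ℂ)) Complex.ofReal_zero
  have hMD : C.IsAdmissible (fun z => ((M * D z.1.2 : ℝ) : ℂ)) := by
    simpa using (isAdmissible_of_hasCompactSupport (C := C) (by fun_prop) hDc').const_mul (M : ℂ)
  rw [← umean_sub ha hU ((isAdmissible_indicator hV hF).mul_left (M' := 1) (by simpa using he))
    ((isAdmissible_indicator hV (by fun_prop)).mul_left (M' := 1) (by simpa using he))]
  refine (norm_umean_le_umean ha hU hMD fun z => ?_).trans ?_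
  · rw [← mul_sub, norm_mul]
    refine (mul_le_of_le_one_left (norm_nonneg _) (he z)).trans ?_
    by_cases hz : z.1.2 ∈ V
    · rw [Set.indicator_of_mem hz, Set.indicator_of_mem hz, sub_sub_cancel, norm_mul,
        Complex.norm_real, Real.norm_eq_abs, abs_of_nonneg (hD0 _), mul_comm]
      exact mul_le_mul_of_nonneg_right (hM _ hz) (hD0 _)
    · rw [Set.indicator_of_notMem hz, Set.indicator_of_notMem hz, sub_zero, norm_zero]
      exact mul_nonneg hM0 (hD0 _)
  · simp only [Complex.ofReal_mul]
    rw [umean_const_mul ha hU (isAdmissible_of_hasCompactSupport (by fun_prop) hDc'),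
      hc _ (by fun_prop) hDc', integral_complex_ofReal, ← Complex.ofReal_mul, ← Complex.ofReal_mul,
      Complex.ofReal_re]

theorem eq_of_norm_sub_le_mul {E : Type*} [NormedAddCommGroup E] {x y : E} {B : ℝ}
    (h : ∀ ε : ℝ, 0 < ε → ‖x - y‖ ≤ B * ε) : x = y := by
  rw [← sub_eq_zero, ← norm_le_zero_iff]
  have h1 : Tendsto (fun ε : ℝ => B * ε) (𝓝[>] 0) (𝓝 (B * 0)) :=
    ((continuous_const.mul continuous_id).tendsto 0).mono_left nhdsWithin_le_nhds
  rw [mul_zero] at h1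
  exact ge_of_tendsto h1 (by filter_upwards [self_mem_nhdsWithin] with ε hε using h ε hε)

theorem umean_indicator (ha : C.IsAveraging a) (hU : (U : Filter ℝ) ≤ atTop)
    {c : ℝ} (hc0 : 0 < c) (hc : ∀ F : Euc n → ℂ, Continuous F → HasCompactSupport F →
      C.umean U a (fun z => F z.1.2) = c * ∫ y, F y)
    {V : Set (Euc n)} (hV : IsCompact V) (hV0 : volume (frontier V) = 0)
    {F : Euc n → ℂ} (hF : Continuous F) :
    C.umean U a (fun z => V.indicator F z.1.2) = c * ∫ y in V, F y := by
  obtain ⟨M, hM⟩ := hV.exists_bound_of_continuousOn hF.continuousOn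
  replace hM : ∀ y ∈ V, ‖F y‖ ≤ |M| := fun y hy => (hM y hy).trans (le_abs_self M)
  -- One term is the defect of the mean, the other the defect of the integral; each is at most |M| c
  -- ∫ D.
  refine eq_of_norm_sub_le_mul (B := |M| * c + c * |M|) fun ε hε => ?_
  obtain ⟨D, hD, hDc, hD0, hDε, hind⟩ := exists_continuous_approx hV hV0 hε
  have h1 := norm_umean_sub_le ha hU (e := fun _ => 1) (by simp) hV hF (abs_nonneg M) hM hc hD hDc
    hD0
  simp only [one_mul] at h1
  have hcs : HasCompactSupport (V.indicator fun y => F y - (D y : ℂ) * F y) :=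
    HasCompactSupport.intro hV fun y hy => Set.indicator_of_notMem hy _
  rw [hc _ (hind F hF) hcs, integral_indicator hV.measurableSet] at h1
  have hi1 : IntegrableOn F V := hF.continuousOn.integrableOn_compact hV
  have hi2 : IntegrableOn (fun y => (D y : ℂ) * F y) V :=
    (Continuous.continuousOn (by fun_prop)).integrableOn_compact hV
  rw [integral_sub hi1 hi2, mul_sub, ← sub_add] at h1
  have hDi := hD.integrable_of_hasCompactSupport hDc (μ := volume)
  have h2 : ‖∫ y in V, (D y : ℂ) * F y‖ ≤ |M| * ε := by
    calc _ ≤ ∫ y in V, |M| * D y := by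
          refine norm_integral_le_of_norm_le (hDi.integrableOn.const_mul _) ?_
          filter_upwards [ae_restrict_mem hV.measurableSet] with y hy
          rw [norm_mul, Complex.norm_real, Real.norm_eq_abs, abs_of_nonneg (hD0 _), mul_comm]
          exact mul_le_mul_of_nonneg_right (hM _ hy) (hD0 _)
      _ = |M| * ∫ y in V, D y := integral_const_mul _ _
      _ ≤ |M| * ∫ y, D y := by
          refine mul_le_mul_of_nonneg_left (setIntegral_le_integral hDi ?_) (abs_nonneg M)
          exact Eventually.of_forall hD0
      _ ≤ _ := by gcongr
  have h3 : ‖(c : ℂ) * ∫ y in V, (D y : ℂ) * F y‖ ≤ c * (|M| * ε) := by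
    rw [norm_mul, Complex.norm_real, Real.norm_eq_abs, abs_of_pos hc0]
    gcongr
  have h4 : |M| * (c * ∫ y, D y) ≤ |M| * (c * ε) := by gcongr
  refine (norm_le_add_norm_add _ ((c : ℂ) * ∫ y in V, (D y : ℂ) * F y)).trans ?_
  linarith

theorem umean_phase_indicator (ha : C.IsAveraging a) (hU : (U : Filter ℝ) ≤ atTop)
    {k : Euc m} (hk : ¬ ∃ χ, C.IsDualCharacter k χ)
    {V : Set (Euc n)} (hV : IsCompact V) (hV0 : volume (frontier V) = 0)
    {F : Euc n → ℂ} (hF : Continuous F) :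
    C.umean U a (fun z => phase k z.1.1 * V.indicator F z.1.2) = 0 := by
  obtain ⟨c, hc0, hc⟩ := exists_umean_eq_integral ha hU
  obtain ⟨M, hM⟩ := hV.exists_bound_of_continuousOn hF.continuousOn
  replace hM : ∀ y ∈ V, ‖F y‖ ≤ |M| := fun y hy => (hM y hy).trans (le_abs_self M)
  refine eq_of_norm_sub_le_mul (B := |M| * c) fun ε hε => ?_
  obtain ⟨D, hD, hDc, hD0, hDε, hind⟩ := exists_continuous_approx hV hV0 hε
  have h1 := norm_umean_sub_le ha hU (e := fun z => phase k z.1.1)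
    (fun z => (norm_phase k z.1.1).le) hV hF (abs_nonneg M) hM hc hD hDc hD0
  rw [umean_phase_eq_zero ha hU hk (hind F hF)
    (HasCompactSupport.intro hV fun y hy => Set.indicator_of_notMem hy _)] at h1
  refine h1.trans ?_
  rw [← mul_assoc]
  gcongr

theorem umean_character_indicator (ha : C.IsAveraging a) (hU : (U : Filter ℝ) ≤ atTop)
    {c : ℝ} (hc0 : 0 < c) (hc : ∀ F : Euc n → ℂ, Continuous F → HasCompactSupport F →
      C.umean U a (fun z => F z.1.2) = c * ∫ y, F y)
    {k : Euc m} {χ : Euc n → ℂ} (hχ : C.IsDualCharacter k χ)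
    {V : Set (Euc n)} (hV : IsCompact V) (hV0 : volume (frontier V) = 0)
    {F : Euc n → ℂ} (hF : Continuous F) :
    C.umean U a (fun z => phase k z.1.1 * V.indicator F z.1.2) = c * ∫ y in V, χ y * F y := by
  rw [← umean_indicator ha hU hc0 hc hV hV0 (F := fun y => χ y * F y) (hχ.continuous.mul hF)]
  congr 1
  ext z
  rw [← hχ.apply_snd z.1 z.2]
  by_cases hz : z.1.2 ∈ V <;> simp [Set.indicator, hz]

end CutProjectScheme

/-! ### Limits of ball means over model sets. -/

namespace CutProjectScheme

variable {m n : ℕ} {C : CutProjectScheme m n}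

theorem mem_modelSet_iff {W : Set (Euc n)} {z : Euc m × Euc n} (hz : z ∈ C.lattice) :
    z.1 ∈ C.modelSet W ↔ z.2 ∈ W := by
  have hL : z.1 ∈ C.L := ⟨z, hz, rfl⟩
  have hs : C.starMap z.1 = z.2 := (C.starMap_eq_iff hL z.2).2 hz
  simp [modelSet, hL, hs]

theorem starMap_fst {z : Euc m × Euc n} (hz : z ∈ C.lattice) : C.starMap z.1 = z.2 :=
  (C.starMap_eq_iff ⟨z, hz, rfl⟩ z.2).2 hz

theorem mem_lattice_of_mem_L {x : Euc m} (hx : x ∈ C.L) : (x, C.starMap x) ∈ C.lattice :=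
  (C.starMap_eq_iff hx _).1 rfl

theorem truncation_modelSet (W : Set (Euc n)) (s : ℝ) : truncation (C.modelSet W) s =
    (fun z : C.lattice => z.1.1) '' {z | ‖z.1.1‖ ≤ s ∧ z.1.2 ∈ W} := by
  ext x
  constructor
  · rintro ⟨⟨hxL, hxW⟩, hxs⟩
    exact ⟨⟨_, mem_lattice_of_mem_L hxL⟩, ⟨hxs, hxW⟩, rfl⟩
  · rintro ⟨z, ⟨hzs, hzW⟩, rfl⟩
    exact ⟨(mem_modelSet_iff z.2).2 hzW, hzs⟩

theorem finite_setOf_lattice {W : Set (Euc n)} (hW : IsCompact W) (s : ℝ) :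
    {z : C.lattice | ‖z.1.1‖ ≤ s ∧ z.1.2 ∈ W}.Finite := by
  have := C.finite_inter_lattice (Metric.isBounded_closedBall (x := (0 : Euc m)) (r := s)
    |>.prod hW.isBounded)
  refine Set.Finite.of_finite_image (f := Subtype.val) (this.subset ?_)
    Subtype.val_injective.injOn
  rintro _ ⟨z, ⟨h1, h2⟩, rfl⟩
  exact ⟨⟨mem_closedBall_zero_iff.2 h1, h2⟩, z.2⟩

theorem finite_truncation {W : Set (Euc n)} (hW : IsCompact W) (s : ℝ) :
    (truncation (C.modelSet W) s).Finite := by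
  rw [truncation_modelSet]
  exact (finite_setOf_lattice hW s).image _

theorem finsum_truncation {W : Set (Euc n)} (hW : IsCompact W) (s : ℝ)
    (Φ : Euc m → ℂ) : ((s ^ m)⁻¹ : ℝ) * ∑ᶠ x ∈ truncation (C.modelSet W) s, Φ x =
      C.wsum (ballWeight m s) (fun z => W.indicator (fun _ => Φ z.1.1) z.1.2) := by
  have hinj : Function.Injective fun z : C.lattice => z.1.1 := fun z z' h =>
    Subtype.ext (C.fst_injOn z.2 z'.2 h)
  have hfin := finite_setOf_lattice (C := C) hW s
  rw [truncation_modelSet, finsum_mem_image hinj.injOn, finsum_mem_def,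
    ← tsum_eq_finsum (L := SummationFilter.unconditional _) (hfin.subset Set.support_indicator_subset), wsum, ← tsum_mul_left]
  refine tsum_congr fun z => ?_
  unfold ballWeight
  by_cases h1 : ‖z.1.1‖ ≤ s <;> by_cases h2 : z.1.2 ∈ W <;> simp [Set.indicator, h1, h2]

/-- Numerator and count carry the same factor s⁻ᵐ, so the mean is a quotient of two weighted lattice
sums and any limiting density constant will cancel. -/
theorem ballMean_modelSet {W : Set (Euc n)} (hW : IsCompact W) {s : ℝ} (hs : 0 < s)
    (Φ : Euc m → ℂ) : ballMean (C.modelSet W) Φ s =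
      C.wsum (ballWeight m s) (fun z => W.indicator (fun _ => Φ z.1.1) z.1.2) /
        C.wsum (ballWeight m s) (fun z => W.indicator (fun _ => 1) z.1.2) := by
  rw [← finsum_truncation hW s, ← finsum_truncation hW s (fun _ => 1)]
  have h1 : ∑ᶠ x ∈ truncation (C.modelSet W) s, (1 : ℂ) =
      ((truncation (C.modelSet W) s).ncard : ℂ) := by
    rw [finsum_mem_eq_finite_toFinset_sum _ (finite_truncation hW s), Finset.sum_const,
      Set.ncard_eq_toFinset_card _ (finite_truncation hW s)]
    simp
  have h2 : (((s ^ m)⁻¹ : ℝ) : ℂ) ≠ 0 := by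
    rw [Complex.ofReal_ne_zero]; positivity
  rw [h1, ballMean, mul_div_mul_left _ _ h2, div_eq_inv_mul]

theorem ofReal_ballMean {W : Set (Euc n)} (hW : IsCompact W) (s : ℝ) (F : Euc m → ℝ) :
    ((ballMean (C.modelSet W) F s : ℝ) : ℂ) =
      ballMean (C.modelSet W) (fun x => ((F x : ℝ) : ℂ)) s := by
  have hfin := finite_truncation (C := C) hW s
  rw [ballMean, ballMean, finsum_mem_eq_finite_toFinset_sum _ hfin,
    finsum_mem_eq_finite_toFinset_sum _ hfin]
  push_cast
  rfl

/-- Compact sets with null boundary and non-empty interior. -/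
structure IsRegularWindow (W : Set (Euc n)) : Prop where
  isCompact : IsCompact W
  volume_frontier : volume (frontier W) = 0
  nonempty_interior : (interior W).Nonempty

theorem IsRegularWindow.volume_pos {W : Set (Euc n)} (hW : IsRegularWindow W) :
    0 < (volume W).toReal :=
  ENNReal.toReal_pos (Measure.measure_pos_of_nonempty_interior _ hW.nonempty_interior).ne'
    hW.isCompact.measure_ne_top

theorem wsum_indicator_one (ha : C.IsAveraging (ballWeight m)) {U : Ultrafilter ℝ}
    (hU : (U : Filter ℝ) ≤ atTop) {c : ℝ} (hc0 : 0 < c)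
    (hc : ∀ F : Euc n → ℂ, Continuous F → HasCompactSupport F →
      C.umean U (ballWeight m) (fun z => F z.1.2) = c * ∫ y, F y)
    {W : Set (Euc n)} (hW : IsRegularWindow W) :
    Tendsto (fun s => C.wsum (ballWeight m s) (fun z => W.indicator (fun _ => 1) z.1.2)) U
      (𝓝 (c * (volume W).toReal)) := by
  have h1 := tendsto_umean ha hU (isAdmissible_indicator (C := C) hW.isCompact
    (F := fun _ => 1) continuous_const)
  rw [umean_indicator ha hU hc0 hc hW.isCompact hW.volume_frontier continuous_const,
    setIntegral_const] at h1
  simpa [Measure.real] using h1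

/-- Along each ultrafilter numerator and denominator have limits with the same factor c, so the
quotient is independent of the ultrafilter and the limit is genuine. The second set V allows
summands that live on a smaller window than the normalization, as pair correlations do. -/
theorem tendsto_ballMean_of_isDualCharacter {W V : Set (Euc n)} (hW : IsRegularWindow W)
    (hV : IsCompact V) (hV0 : volume (frontier V) = 0) {F : Euc n → ℂ} (hF : Continuous F)
    {k : Euc m} {χ : Euc n → ℂ} (hχ : C.IsDualCharacter k χ) {Φ : Euc m → ℂ}
    (hΦ : ∀ z ∈ C.lattice, W.indicator (fun _ => Φ z.1) z.2 = phase k z.1 * V.indicator F z.2) :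
    Tendsto (ballMean (C.modelSet W) Φ) atTop
      (𝓝 ((∫ y in V, χ y * F y) / ((volume W).toReal : ℂ))) := by
  have ha := C.isAveraging_ballWeight
  rw [tendsto_iff_ultrafilter]
  intro U hU
  obtain ⟨c, hc0, hc⟩ := exists_umean_eq_integral ha hU
  have h1 := tendsto_umean ha hU ((isAdmissible_indicator (C := C) hV hF).mul_left (M' := 1)
    (e := fun z => phase k z.1.1) (fun z => (norm_phase k z.1.1).le))
  rw [umean_character_indicator ha hU hc0 hc hχ hV hV0 hF] at h1
  have h2 := wsum_indicator_one ha hU hc0 hc hW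
  have hc' : (c : ℂ) ≠ 0 := Complex.ofReal_ne_zero.2 hc0.ne'
  have hvol : ((volume W).toReal : ℂ) ≠ 0 := Complex.ofReal_ne_zero.2 hW.volume_pos.ne'
  have h3 := h1.div h2 (mul_ne_zero hc' hvol)
  rw [mul_div_mul_left _ _ hc'] at h3
  refine h3.congr' ?_
  filter_upwards [hU (eventually_gt_atTop 0)] with s hs
  rw [ballMean_modelSet hW.isCompact hs]
  simp_rw [fun z : C.lattice => hΦ z.1 z.2]
  rfl

theorem tendsto_ballMean_zero {W V : Set (Euc n)} (hW : IsRegularWindow W)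
    (hV : IsCompact V) (hV0 : volume (frontier V) = 0) {F : Euc n → ℂ} (hF : Continuous F)
    {k : Euc m} (hk : ¬ ∃ χ, C.IsDualCharacter k χ) {Φ : Euc m → ℂ}
    (hΦ : ∀ z ∈ C.lattice, W.indicator (fun _ => Φ z.1) z.2 = phase k z.1 * V.indicator F z.2) :
    Tendsto (ballMean (C.modelSet W) Φ) atTop (𝓝 0) := by
  have ha := C.isAveraging_ballWeight
  rw [tendsto_iff_ultrafilter]
  intro U hU
  obtain ⟨c, hc0, hc⟩ := exists_umean_eq_integral ha hU
  have h1 := tendsto_umean ha hU ((isAdmissible_indicator (C := C) hV hF).mul_left (M' := 1)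
    (e := fun z => phase k z.1.1) (fun z => (norm_phase k z.1.1).le))
  rw [umean_phase_indicator ha hU hk hV hV0 hF] at h1
  have h2 := wsum_indicator_one ha hU hc0 hc hW
  have hc' : (c : ℂ) ≠ 0 := Complex.ofReal_ne_zero.2 hc0.ne'
  have hvol : ((volume W).toReal : ℂ) ≠ 0 := Complex.ofReal_ne_zero.2 hW.volume_pos.ne'
  have h3 := h1.div h2 (mul_ne_zero hc' hvol)
  rw [zero_div] at h3
  refine h3.congr' ?_
  filter_upwards [hU (eventually_gt_atTop 0)] with s hs
  rw [ballMean_modelSet hW.isCompact hs]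
  simp_rw [fun z : C.lattice => hΦ z.1 z.2]
  rfl

theorem tendsto_ballMean_real {W V : Set (Euc n)} (hW : IsRegularWindow W)
    (hV : IsCompact V) (hV0 : volume (frontier V) = 0) {F : Euc n → ℝ} (hF : Continuous F)
    {Φ : Euc m → ℝ}
    (hΦ : ∀ z ∈ C.lattice, W.indicator (fun _ => Φ z.1) z.2 = V.indicator F z.2) :
    Tendsto (ballMean (C.modelSet W) Φ) atTop (𝓝 ((∫ y in V, F y) / (volume W).toReal)) := by
  have h := tendsto_ballMean_of_isDualCharacter (C := C) hW hV hV0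
    (F := fun y => ((F y : ℝ) : ℂ)) (by fun_prop) isDualCharacter_zero
    (Φ := fun x => ((Φ x : ℝ) : ℂ)) (fun z hz => by
      have := congrArg (fun r : ℝ => (r : ℂ)) (hΦ z hz)
      rw [phase_zero_left, one_mul]
      by_cases h1 : z.2 ∈ W <;> by_cases h2 : z.2 ∈ V <;> simp_all [Set.indicator])
  simp only [one_mul] at h
  rw [integral_complex_ofReal, ← Complex.ofReal_div] at h
  have h2 := (Complex.continuous_re.tendsto _).comp h
  rw [Complex.ofReal_re] at h2
  refine h2.congr fun s => ?_
  rw [Function.comp, ← ofReal_ballMean hW.isCompact, Complex.ofReal_re]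

theorem tendsto_fourierBohrMean {W : Set (Euc n)} (hW : IsRegularWindow W) {w : Euc m → ℝ}
    {F : Euc n → ℝ} (hF : Continuous F) (hw : ∀ z ∈ C.lattice, z.2 ∈ W → w z.1 = F z.2)
    {k : Euc m} {χ : Euc n → ℂ} (hχ : C.IsDualCharacter k χ) :
    Tendsto (fourierBohrMean (C.modelSet W) w k) atTop
      (𝓝 ((∫ y in W, χ y * F y) / ((volume W).toReal : ℂ))) := by
  refine tendsto_ballMean_of_isDualCharacter hW hW.isCompact hW.volume_frontier
    (F := fun y => ((F y : ℝ) : ℂ)) (by fun_prop) hχ fun z hz => ?_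
  by_cases h1 : z.2 ∈ W
  · simp only [Set.indicator_of_mem h1]
    rw [hw z hz h1, mul_comm]; rfl
  · simp [Set.indicator_of_notMem h1]

theorem tendsto_fourierBohrMean_zero {W : Set (Euc n)} (hW : IsRegularWindow W) {w : Euc m → ℝ}
    {F : Euc n → ℝ} (hF : Continuous F) (hw : ∀ z ∈ C.lattice, z.2 ∈ W → w z.1 = F z.2)
    {k : Euc m} (hk : ¬ ∃ χ, C.IsDualCharacter k χ) :
    Tendsto (fourierBohrMean (C.modelSet W) w k) atTop (𝓝 0) := by
  refine tendsto_ballMean_zero hW hW.isCompact hW.volume_frontier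
    (F := fun y => ((F y : ℝ) : ℂ)) (by fun_prop) hk fun z hz => ?_
  by_cases h1 : z.2 ∈ W
  · simp only [Set.indicator_of_mem h1]
    rw [hw z hz h1, mul_comm]; rfl
  · simp [Set.indicator_of_notMem h1]

end CutProjectScheme

/-! ### Powers of the contraction, and characters near the origin. -/

namespace CutProjectScheme

open scoped ENNReal NNReal

section Spectral

open scoped Matrix.Norms.Operator

/-- By Gelfand's formula the norms are eventually below ρ^N for some ρ strictly between the spectral
radius and 1. Dimension 0 is treated apart, as the matrix ring is then trivial. -/
theorem summable_norm_pow_of_spectrum {d : ℕ} (M : Matrix (Fin d) (Fin d) ℂ)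
    (hM : ∀ z ∈ spectrum ℂ M, ‖z‖ < 1) : Summable fun N : ℕ => ‖M ^ N‖ := by
  rcases subsingleton_or_nontrivial (Matrix (Fin d) (Fin d) ℂ) with hs | hs
  · have : (fun N : ℕ => ‖M ^ N‖) = fun _ => 0 := by
      ext N; rw [Subsingleton.elim (M ^ N) 0, norm_zero]
    rw [this]; exact summable_zero
  have h1 : spectralRadius ℂ M < (1 : ℝ≥0) :=
    spectrum.spectralRadius_lt_of_forall_lt M (r := 1) fun z hz => hM z hz
  obtain ⟨ρ, hρ1, hρ2⟩ := ENNReal.lt_iff_exists_nnreal_btwn.1 h1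
  have h2 := (spectrum.pow_nnnorm_pow_one_div_tendsto_nhds_spectralRadius M).eventually_lt_const hρ1
  have hρ : (ρ : ℝ) < 1 := by exact_mod_cast hρ2
  refine (summable_geometric_of_lt_one ρ.2 hρ).of_norm_bounded_eventually_nat ?_
  filter_upwards [h2, eventually_gt_atTop 0] with N hN hN0
  have hN' : (N : ℝ) ≠ 0 := by positivity
  rw [one_div, ENNReal.rpow_inv_lt_iff (by positivity), ENNReal.rpow_natCast] at hN
  rw [norm_norm]
  exact_mod_cast hN.le

theorem norm_map_ofReal {d : ℕ} (M : Matrix (Fin d) (Fin d) ℝ) :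
    ‖M.map (algebraMap ℝ ℂ)‖ = ‖M‖ := by
  rw [Matrix.linfty_opNorm_def, Matrix.linfty_opNorm_def]
  simp

theorem norm_entry_le {d : ℕ} (M : Matrix (Fin d) (Fin d) ℝ) (i j : Fin d) : ‖M i j‖ ≤ ‖M‖ := by
  rw [Matrix.linfty_opNorm_def, ← coe_nnnorm, NNReal.coe_le_coe]
  exact (Finset.single_le_sum (f := fun j => ‖M i j‖₊) (fun _ _ => zero_le)
    (Finset.mem_univ j)).trans (Finset.le_sup (f := fun i => ∑ j, ‖M i j‖₊) (Finset.mem_univ i))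

theorem summable_norm_pow {d : ℕ} (A : Euc d →ₗ[ℝ] Euc d)
    (hA : ∀ z : ℂ, Polynomial.aeval z (LinearMap.charpoly A) = 0 → ‖z‖ < 1) :
    ∃ ρ : ℕ → ℝ, Summable ρ ∧ ∀ N y, ‖(A ^ N) y‖ ≤ ρ N * ‖y‖ := by
  let b := (EuclideanSpace.basisFun (Fin d) ℝ).toBasis
  let M := LinearMap.toMatrix b b A
  have h1 : Summable fun N : ℕ => ‖M ^ N‖ := by
    have := summable_norm_pow_of_spectrum (M.map (algebraMap ℝ ℂ)) fun z hz => by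
      refine hA z ?_
      rw [Matrix.mem_spectrum_iff_isRoot_charpoly, Matrix.charpoly_map,
        LinearMap.charpoly_toMatrix, Polynomial.IsRoot, Polynomial.eval_map_algebraMap] at hz
      exact hz
    refine this.congr fun N => ?_
    rw [← norm_map_ofReal, Matrix.map_pow]
  -- Passing from entries to operators is linear in finite dimension, hence bounded; this trades the
  -- matrix norm for the Euclidean operator norm.
  let T : (Fin d → Fin d → ℝ) →ₗ[ℝ] (Euc d →L[ℝ] Euc d) :=
    (LinearMap.toContinuousLinearMap (𝕜 := ℝ) (E := Euc d) (F' := Euc d)).toLinearMap ∘ₗ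
      (Matrix.toLin b b).toLinearMap ∘ₗ (Matrix.ofLinearEquiv ℝ).toLinearMap
  let T' := LinearMap.toContinuousLinearMap T
  refine ⟨fun N => ‖T'‖ * ‖M ^ N‖, h1.mul_left _, fun N y => ?_⟩
  have h2 : T' (fun i j => (M ^ N) i j) y = (A ^ N) y := by
    change Matrix.toLin b b (M ^ N) y = _
    rw [show M ^ N = LinearMap.toMatrix b b (A ^ N) from LinearMap.toMatrix_pow b A N,
      Matrix.toLin_toMatrix]
  have h3 : ‖fun i j => (M ^ N) i j‖ ≤ ‖M ^ N‖ :=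
    (pi_norm_le_iff_of_nonneg (norm_nonneg _)).2 fun i =>
      (pi_norm_le_iff_of_nonneg (norm_nonneg _)).2 fun j => norm_entry_le _ i j
  rw [← h2]
  refine (ContinuousLinearMap.le_opNorm _ _).trans
    (mul_le_mul_of_nonneg_right ((T'.le_opNorm _).trans ?_) (norm_nonneg _))
  exact mul_le_mul_of_nonneg_left h3 (norm_nonneg _)

end Spectral

variable {m n : ℕ} {C : CutProjectScheme m n}

/-- A continuous character inherits regularity from a bump b near 0: with I = ∫ χ b ≠ 0 one has χ(u)
I = ∫ χ(z) b(z - u) dz, which is Lipschitz in u because b is. This linear rate makes the factors of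
the product summably close to 1. -/
theorem IsDualCharacter.exists_norm_sub_one_le {k : Euc m} {χ : Euc n → ℂ}
    (h : C.IsDualCharacter k χ) : ∃ B : ℝ, 0 ≤ B ∧ ∀ u, ‖χ u - 1‖ ≤ B * ‖u‖ := by
  have hχ := h.continuous
  obtain ⟨δ, hδ, hδχ⟩ := Metric.continuousAt_iff.1 (hχ.continuousAt (x := 0)) (1 / 2)
    one_half_pos
  rw [h.map_zero] at hδχ
  obtain ⟨b, hbs, hbc, hb, hb01, hb0⟩ := exists_contDiff_tsupport_subset (n := 1)
    (Metric.ball_mem_nhds (0 : Euc n) hδ)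
  have hbcont := hb.continuous
  have hb0' : ∀ y, 0 ≤ b y := fun y => (hb01 ⟨y, rfl⟩).1
  obtain ⟨Lb, hLb⟩ := hb.lipschitzWith_of_hasCompactSupport hbc (by simp)
  have hbi : Integrable b volume := hbcont.integrable_of_hasCompactSupport hbc
  have hbi' : Integrable (fun y => (b y : ℂ)) volume := hbi.ofReal
  have hbpos : 0 < ∫ y, b y := by
    refine hbcont.integral_pos_of_hasCompactSupport_nonneg_nonzero hbc hb0' (x := 0) ?_
    rw [hb0]; exact one_ne_zero
  have hint : ∀ u, Integrable fun z => χ z * (b (z - u) : ℂ) := fun u =>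
    Continuous.integrable_of_hasCompactSupport (by fun_prop)
      (HasCompactSupport.mul_left ((hbc.comp_homeomorph (Homeomorph.subRight u)).comp_left
        (g := fun r : ℝ => (r : ℂ)) Complex.ofReal_zero))
  set I := ∫ z, χ z * (b z : ℂ) with hI
  have hint0 : Integrable fun z => χ z * (b z : ℂ) := by simpa using hint 0
  have hI0 : I ≠ 0 := by
    have h1 : ‖I - ((∫ y, b y : ℝ) : ℂ)‖ ≤ (1 / 2) * ∫ y, b y := by
      rw [hI, ← integral_complex_ofReal, ← integral_sub hint0 hbi', ← integral_const_mul]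
      refine norm_integral_le_of_norm_le (hbi.const_mul _) (Eventually.of_forall fun y => ?_)
      by_cases hy : y ∈ tsupport b
      · have := (hδχ (x := y) (hbs hy)).le
        rw [← sub_one_mul, norm_mul, Complex.norm_real, Real.norm_eq_abs, abs_of_nonneg (hb0' _)]
        rw [dist_eq_norm] at this
        exact mul_le_mul_of_nonneg_right this (hb0' _)
      · rw [image_eq_zero_of_notMem_tsupport hy]; simp
    intro h0
    rw [h0, zero_sub, norm_neg, Complex.norm_real, Real.norm_eq_abs, abs_of_pos hbpos] at h1
    linarith
  have htrans : ∀ u, χ u * I = ∫ z, χ z * (b (z - u) : ℂ) := fun u => by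
    rw [hI, ← integral_const_mul, 
      ← integral_add_right_eq_self (fun z => χ z * (b (z - u) : ℂ)) u]
    refine integral_congr_ae (Eventually.of_forall fun y => ?_)
    simp only [add_sub_cancel_right]
    rw [h.map_add]; ring
  set V := (volume (Metric.closedBall (0 : Euc n) (δ + 1))).toReal
  have hV : 0 ≤ V := ENNReal.toReal_nonneg
  -- The first term serves ‖u‖ ≤ 1, where both bumps live in the ball of radius δ + 1; the 2 is the
  -- trivial bound for ‖u‖ > 1.
  refine ⟨‖I‖⁻¹ * (Lb * V) + 2, by positivity, fun u => ?_⟩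
  rcases le_or_gt ‖u‖ 1 with hu | hu
  · have h1 : ‖(χ u - 1) * I‖ ≤ Lb * ‖u‖ * V := by
      have e1 : (χ u - 1) * I = ∫ z in Metric.closedBall (0 : Euc n) (δ + 1),
          (χ z * (b (z - u) : ℂ) - χ z * (b z : ℂ)) := by
        rw [sub_one_mul, htrans, hI, ← integral_sub (hint u) hint0,
          setIntegral_eq_integral_of_forall_compl_eq_zero]
        intro z hz
        have hz' : δ + 1 < ‖z‖ := by simpa using hz
        have hout : ∀ y : Euc n, δ ≤ ‖y‖ → b y = 0 := fun y hy =>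
          image_eq_zero_of_notMem_tsupport fun hmem => by
            have := mem_ball_zero_iff.1 (hbs hmem)
            linarith
        rw [hout z (by linarith), hout (z - u) (by linarith [norm_sub_norm_le z u]), sub_self]
      rw [e1]
      refine norm_setIntegral_le_of_norm_le_const measure_closedBall_lt_top fun z _ => ?_
      rw [← mul_sub, norm_mul, h.norm_eq_one, one_mul, ← Complex.ofReal_sub, Complex.norm_real]
      have := hLb.dist_le_mul (z - u) z
      rw [dist_eq_norm, dist_eq_norm] at this
      simpa using this
    rw [norm_mul] at h1
    have hIp : 0 < ‖I‖ := norm_pos_iff.2 hI0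
    have h2 : ‖χ u - 1‖ ≤ ‖I‖⁻¹ * (Lb * V) * ‖u‖ := by
      rw [← div_eq_inv_mul, div_mul_eq_mul_div, le_div_iff₀ hIp]
      linarith
    nlinarith [norm_nonneg u]
  · have h1 : ‖χ u - 1‖ ≤ 2 := by
      refine (norm_sub_le _ _).trans ?_
      rw [h.norm_eq_one, norm_one]; norm_num
    have : 0 ≤ ‖I‖⁻¹ * (Lb * V) := by positivity
    nlinarith

end CutProjectScheme

/-! ### The refinement equation and the product formula. -/

namespace CutProjectScheme

open scoped ENNReal NNReal

variable {m n : ℕ} {C : CutProjectScheme m n}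

theorem isRegularWindow_of_isWindow {Ω : Set (Euc n)} (hΩ : IsWindow Ω)
    (h : (interior Ω).Nonempty) : IsRegularWindow Ω :=
  ⟨hΩ.isCompact, hΩ.volume_frontier, h⟩

theorem translationWindow_subset {A : Euc n →ₗ[ℝ] Euc n} {Ω : Set (Euc n)} (h0 : (0 : Euc n) ∈ Ω) :
    translationWindow A Ω ⊆ Ω := fun u hu => by simpa using hu 0 h0

theorem isClosed_translationWindow {A : Euc n →ₗ[ℝ] Euc n} {Ω : Set (Euc n)} (hΩ : IsClosed Ω) :
    IsClosed (translationWindow A Ω) := by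
  have : translationWindow A Ω = ⋂ y ∈ Ω, (fun u => A y + u) ⁻¹' Ω := by
    ext u; simp [translationWindow]
  rw [this]
  exact isClosed_biInter fun y _ => hΩ.preimage (by fun_prop)

theorem isRegularWindow_translationWindow {A : Euc n →ₗ[ℝ] Euc n} {Ω : Set (Euc n)}
    (hΩ : IsCompact Ω) (h0 : (0 : Euc n) ∈ Ω)
    (hcomp : (interior (translationWindow A Ω)).Nonempty)
    (hRiem : volume (frontier (translationWindow A Ω)) = 0) :
    IsRegularWindow (translationWindow A Ω) :=
  ⟨hΩ.of_isClosed_subset (isClosed_translationWindow hΩ.isClosed) (translationWindow_subset h0),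
    hRiem, hcomp⟩

/-- As p is real, the real part of the given profile represents it equally well; vanishing off Ω
makes the formula hold on the whole lattice. -/
theorem exists_real_profile {Ω : Set (Euc n)} {p : Euc m → ℝ}
    (hp0 : ∀ x, x ∉ C.modelSet Ω → p x = 0) (hpc : MemContinuousClass C Ω p) :
    ∃ f : Euc n → ℝ, Continuous f ∧ (∀ y, y ∉ Ω → f y = 0) ∧
      ∀ z ∈ C.lattice, p z.1 = (volume Ω).toReal * f z.2 := by
  obtain ⟨f, hf, hfs, hpf⟩ := hpc
  have hf0 : ∀ y, y ∉ Ω → f y = 0 := fun y hy => by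
    by_contra h; exact hy (hfs h)
  refine ⟨fun y => (f y).re, by fun_prop, fun y hy => by simp [hf0 y hy], fun z hz => ?_⟩
  by_cases h : z.2 ∈ Ω
  · have := congrArg Complex.re (hpf z.1 ((mem_modelSet_iff hz).2 h))
    rwa [Complex.ofReal_re, Complex.re_ofReal_mul, starMap_fst hz] at this
  · rw [hp0 _ (fun h' => h ((mem_modelSet_iff hz).1 h'))]; simp [hf0 _ h]

section Induced

variable {Q : Euc m ≃L[ℝ] Euc m} {A : Euc n →ₗ[ℝ] Euc n}

theorem IsInducedBy.map_mem (hA : C.IsInducedBy A Q) (hQL : Q '' C.L = C.L)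
    {z : Euc m × Euc n} (hz : z ∈ C.lattice) : (Q z.1, A z.2) ∈ C.lattice := by
  have hL : z.1 ∈ C.L := ⟨z, hz, rfl⟩
  have hQ : Q z.1 ∈ C.L := hQL ▸ Set.mem_image_of_mem Q hL
  have := hA _ hL
  rw [starMap_fst hz] at this
  rw [← this]
  exact mem_lattice_of_mem_L hQ

theorem IsInducedBy.exists_preimage (hA : C.IsInducedBy A Q) (hQL : Q '' C.L = C.L)
    {z : Euc m × Euc n} (hz : z ∈ C.lattice) :
    ∃ y, (Q.symm z.1, y) ∈ C.lattice ∧ A y = z.2 := by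
  have hL : z.1 ∈ C.L := ⟨z, hz, rfl⟩
  rw [← hQL] at hL
  obtain ⟨x, hx, hxz⟩ := hL
  have h1 : Q.symm z.1 = x := by rw [← hxz, Q.symm_apply_apply]
  refine ⟨C.starMap x, by rw [h1]; exact mem_lattice_of_mem_L hx, ?_⟩
  rw [← hA x hx, hxz, starMap_fst hz]

/-- Since QL = L, the range of A contains the dense set L^*; being a subspace, it is closed. -/
theorem IsInducedBy.surjective (hA : C.IsInducedBy A Q) (hQL : Q '' C.L = C.L) :
    Function.Surjective A := by
  rw [← LinearMap.range_eq_top]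
  have h1 : Dense (LinearMap.range A : Set (Euc n)) := by
    refine C.snd_dense.mono ?_
    rintro _ ⟨z, hz, rfl⟩
    obtain ⟨y, -, hy⟩ := hA.exists_preimage hQL hz
    exact ⟨y, hy⟩
  have h2 : IsClosed (LinearMap.range A : Set (Euc n)) :=
    Submodule.closed_of_finiteDimensional _
  rw [← SetLike.coe_set_eq, Submodule.top_coe, ← h2.closure_eq, h1.closure_eq]

theorem IsInducedBy.det_ne_zero (hA : C.IsInducedBy A Q) (hQL : Q '' C.L = C.L) :
    LinearMap.det A ≠ 0 :=
  (LinearMap.isUnit_iff_isUnit_det A).1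
    ((LinearMap.isUnit_iff_range_eq_top A).2 (LinearMap.range_eq_top.2 (hA.surjective hQL))) |>.ne_zero

/-- The inverse of the induced map. -/
def IsInducedBy.equiv (hA : C.IsInducedBy A Q) (hQL : Q '' C.L = C.L) : Euc n ≃L[ℝ] Euc n :=
  (LinearMap.equivOfDetNeZero A (hA.det_ne_zero hQL)).toContinuousLinearEquiv

theorem IsInducedBy.equiv_apply (hA : C.IsInducedBy A Q) (hQL : Q '' C.L = C.L) (y : Euc n) :
    hA.equiv hQL y = A y := rfl

theorem IsInducedBy.symm_mem (hA : C.IsInducedBy A Q) (hQL : Q '' C.L = C.L)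
    {z : Euc m × Euc n} (hz : z ∈ C.lattice) :
    (Q.symm z.1, (hA.equiv hQL).symm z.2) ∈ C.lattice := by
  obtain ⟨y, hy, hyz⟩ := hA.exists_preimage hQL hz
  rwa [← hyz, ← hA.equiv_apply hQL, ContinuousLinearEquiv.symm_apply_apply]

theorem IsDualCharacter.comp_induced (hA : C.IsInducedBy A Q) (hQL : Q '' C.L = C.L)
    {k : Euc m} {χ : Euc n → ℂ} (hχ : C.IsDualCharacter k χ) :
    C.IsDualCharacter (ContinuousLinearMap.adjoint (Q : Euc m →L[ℝ] Euc m) k)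
      (fun y => χ (A y)) := by
  refine ⟨hχ.continuous.comp A.continuous_of_finiteDimensional, fun z hz => ?_⟩
  have := hχ.apply_snd _ (hA.map_mem hQL hz)
  simp only at this
  rw [this, phase, phase, ContinuousLinearMap.adjoint_inner_left]
  rfl

theorem IsDualCharacter.comp_induced_pow (hA : C.IsInducedBy A Q) (hQL : Q '' C.L = C.L)
    {k : Euc m} {χ : Euc n → ℂ} (hχ : C.IsDualCharacter k χ) (N : ℕ) :
    C.IsDualCharacter ((ContinuousLinearMap.adjoint (Q : Euc m →L[ℝ] Euc m) ^ N) k)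
      (fun y => χ ((A ^ N) y)) := by
  induction N with
  | zero => simpa using hχ
  | succ N ih =>
    have := ih.comp_induced hA hQL
    simpa only [pow_succ' (ContinuousLinearMap.adjoint (Q : Euc m →L[ℝ] Euc m)), pow_succ A,
      Module.End.mul_apply, mul_apply_eq_comp] using this

variable {Ω : Set (Euc n)} {p : Euc m → ℝ} {f : Euc n → ℝ}

theorem integral_profile_eq_one (hΩ : IsRegularWindow Ω) (hf : Continuous f)
    (hf0 : ∀ y, y ∉ Ω → f y = 0) (hpf : ∀ z ∈ C.lattice, p z.1 = (volume Ω).toReal * f z.2)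
    (hnorm : Tendsto (ballMean (C.modelSet Ω) p) atTop (𝓝 1)) : ∫ y, f y = 1 := by
  have h := tendsto_ballMean_real (C := C) hΩ hΩ.isCompact hΩ.volume_frontier (Φ := p)
    (F := fun y => (volume Ω).toReal * f y) (by fun_prop) fun z hz => by
      simp only [Set.indicator, hpf z hz]
  rw [integral_const_mul, mul_div_cancel_left₀ _ hΩ.volume_pos.ne',
    setIntegral_eq_integral_of_forall_compl_eq_zero hf0] at h
  exact tendsto_nhds_unique h hnorm

/-- The invariance of the density as a refinement equation on internal space. -/
theorem refinement_equation (hΩ : IsRegularWindow Ω)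
    (hΩQ : IsRegularWindow (translationWindow A Ω)) (hA : C.IsInducedBy A Q)
    (hQL : Q '' C.L = C.L) (hf : Continuous f)
    (hpf : ∀ z ∈ C.lattice, p z.1 = (volume Ω).toReal * f z.2)
    (hinv : ∀ x ∈ C.L,
      Tendsto (fun s : ℝ => |LinearMap.det (Q : Euc m →ₗ[ℝ] Euc m)| *
        ballMean (C.modelSet (translationWindow A Ω)) (fun v => p (Q.symm (x - v))) s)
      atTop (𝓝 (p x))) :
    ∃ κ : ℝ, ∀ u, f u = κ * ∫ v in translationWindow A Ω, f ((hA.equiv hQL).symm (u - v)) := by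
  set d := |LinearMap.det (Q : Euc m →ₗ[ℝ] Euc m)|
  set W := translationWindow A Ω
  refine ⟨d / (volume W).toReal, fun u => ?_⟩
  have hc : Continuous fun u => ∫ v in W, f ((hA.equiv hQL).symm (u - v)) :=
    continuous_parametric_integral_of_continuous (by fun_prop) hΩQ.isCompact
  -- Both sides are continuous, so it suffices to compare them on L^*, where equidistribution in Ω_Q
  -- evaluates the limit in the invariance condition.
  refine congrFun (Continuous.ext_on (f := f)
    (g := fun u => d / (volume W).toReal * ∫ v in W, f ((hA.equiv hQL).symm (u - v)))
    C.snd_dense hf (by fun_prop) ?_) u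
  rintro _ ⟨z, hz, rfl⟩
  have h1 := tendsto_ballMean_real (C := C) hΩQ hΩQ.isCompact hΩQ.volume_frontier
    (Φ := fun v => p (Q.symm (z.1 - v)))
    (F := fun v => (volume Ω).toReal * f ((hA.equiv hQL).symm (z.2 - v))) (by fun_prop)
    fun w hw => by
      have := hpf _ (hA.symm_mem hQL (C.lattice.sub_mem hz hw))
      simp only [Set.indicator]
      rw [← Prod.fst_sub, ← Prod.snd_sub, this]
  have h2 := tendsto_nhds_unique (h1.const_mul d) (hinv z.1 ⟨z, hz, rfl⟩)
  rw [hpf z hz, integral_const_mul] at h2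
  have hv := hΩ.volume_pos.ne'
  have hvQ := hΩQ.volume_pos.ne'
  have h3 : (volume Ω).toReal * f z.2 = (volume Ω).toReal *
      (d / (volume W).toReal * ∫ v in W, f ((hA.equiv hQL).symm (z.2 - v))) := by
    rw [← h2]; ring
  exact mul_left_cancel₀ hv h3

/-- The Jacobian r need not be named: normalization determines κ r later. -/
theorem integral_comp_equiv_symm (e : Euc n ≃L[ℝ] Euc n) :
    ∃ r : ℝ, ∀ g : Euc n → ℂ, ∫ u, g (e.symm u) = r * ∫ w, g w := by
  have hdet : LinearMap.det (e.symm : Euc n →ₗ[ℝ] Euc n) ≠ 0 :=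
    (LinearEquiv.isUnit_det' e.symm.toLinearEquiv).ne_zero
  have h := Measure.map_linearMap_addHaar_eq_smul_addHaar (volume : Measure (Euc n)) hdet
  refine ⟨|(LinearMap.det (e.symm : Euc n →ₗ[ℝ] Euc n))⁻¹|, fun g => ?_⟩
  have h2 : ∫ u, g (e.symm u) = ∫ w, g w ∂(Measure.map e.symm volume) :=
    (e.symm.toHomeomorph.measurableEmbedding.integral_map g).symm
  have h3 : Measure.map e.symm (volume : Measure (Euc n)) =
    Measure.map (e.symm : Euc n →ₗ[ℝ] Euc n) volume := rfl
  rw [h2, h3, h, integral_smul_measure, ENNReal.toReal_ofReal (abs_nonneg _), Complex.real_smul]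

/-- Up to a constant f is the convolution of the indicator of Ω_Q with f∘A⁻¹, and a character turns
convolution into a product. -/
theorem integral_character_mul_recursion (hΩ : IsRegularWindow Ω)
    (hΩQ : IsRegularWindow (translationWindow A Ω)) (hA : C.IsInducedBy A Q)
    (hQL : Q '' C.L = C.L) (hf : Continuous f) (hf0 : ∀ y, y ∉ Ω → f y = 0)
    (hf1 : ∫ y, f y = 1) {κ : ℝ}
    (href : ∀ u, f u = κ * ∫ v in translationWindow A Ω, f ((hA.equiv hQL).symm (u - v)))
    {k : Euc m} {χ : Euc n → ℂ} (hχ : C.IsDualCharacter k χ) :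
    ∫ y, χ y * f y = (∫ y in translationWindow A Ω, χ y) /
      ((volume (translationWindow A Ω)).toReal : ℂ) * ∫ y, χ (A y) * f y := by
  set W := translationWindow A Ω
  set e := hA.equiv hQL
  obtain ⟨r, hr⟩ := integral_comp_equiv_symm e
  have key : ∀ (k : Euc m) (χ : Euc n → ℂ), C.IsDualCharacter k χ →
      ∫ y, χ y * f y = (κ * r : ℝ) * ((∫ y in W, χ y) * ∫ y, χ (A y) * f y) := by
    intro k χ hχ
    have hχc := hχ.continuous
    -- The definition of Ω_Q enters here: AΩ + v ⊆ Ω. Hence Fubini is needed only on the compact set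
    -- Ω × Ω_Q, while the inner integral over Ω is the full one.
    have hout : ∀ v ∈ W, ∀ u, u ∉ Ω → f (e.symm (u - v)) = 0 := by
      intro v hv u hu
      refine hf0 _ fun h => hu ?_
      have h1 : A (e.symm (u - v)) = u - v := e.apply_symm_apply (u - v)
      have h2 := hv _ h
      rwa [h1, sub_add_cancel] at h2
    have hinner : ∀ v ∈ W, ∫ u in Ω, χ u * (f (e.symm (u - v)) : ℂ) =
        χ v * (r * ∫ w, χ (A w) * f w) := by
      intro v hv
      rw [setIntegral_eq_integral_of_forall_compl_eq_zero (fun u hu => by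
        rw [hout v hv u hu]; simp), ← hr, ← integral_add_right_eq_self _ v, ← integral_const_mul]
      refine integral_congr_ae (Eventually.of_forall fun u => ?_)
      have h1 : A (e.symm u) = u := e.apply_symm_apply u
      simp only [add_sub_cancel_right]
      rw [hχ.map_add, h1]; ring
    calc ∫ y, χ y * f y = ∫ u in Ω, χ u * f u :=
          (setIntegral_eq_integral_of_forall_compl_eq_zero fun u hu => by
            rw [hf0 u hu]; simp).symm
      _ = ∫ u in Ω, ∫ v in W, (κ : ℂ) * (χ u * (f (e.symm (u - v)) : ℂ)) := by
          refine integral_congr_ae (Eventually.of_forall fun u => ?_)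
          simp only
          rw [integral_const_mul, integral_const_mul, href u, Complex.ofReal_mul,
            ← integral_complex_ofReal]
          ring
      _ = ∫ v in W, ∫ u in Ω, (κ : ℂ) * (χ u * (f (e.symm (u - v)) : ℂ)) := by
          refine integral_integral_swap ?_
          rw [Measure.prod_restrict, ← IntegrableOn]
          refine ContinuousOn.integrableOn_compact (hΩ.isCompact.prod hΩQ.isCompact)
            (Continuous.continuousOn ?_)
          change Continuous fun x : Euc n × Euc n =>
            (κ : ℂ) * (χ x.1 * (f (e.symm (x.1 - x.2)) : ℂ))
          fun_prop
      _ = ∫ v in W, (κ : ℂ) * (χ v * (r * ∫ w, χ (A w) * f w)) := by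
          refine setIntegral_congr_fun hΩQ.isCompact.measurableSet fun v hv => ?_
          rw [integral_const_mul, hinner v hv]
      _ = _ := by
          rw [integral_const_mul, integral_mul_const]
          push_cast; ring
  -- The trivial character, with ∫ f = 1, identifies κ r as 1 / vol(Ω_Q).
  have hone := key 0 _ isDualCharacter_zero
  simp only [one_mul] at hone
  rw [integral_complex_ofReal, hf1, setIntegral_const] at hone
  have hvol : ((volume W).toReal : ℂ) ≠ 0 := Complex.ofReal_ne_zero.2 hΩQ.volume_pos.ne'
  have hκ : ((κ * r : ℝ) : ℂ) * (volume W).toReal = 1 := by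
    have h1 : ((1 : ℝ) : ℂ) = (κ * r : ℝ) * ((volume W).toReal : ℂ) := by
      simpa [Measure.real] using hone
    rw [← h1, Complex.ofReal_one]
  rw [key k χ hχ, eq_div_of_mul_eq hvol hκ]
  ring

/-- The means of a character along the powers of the contraction tend to one summably. -/
theorem hasProd_character (hΩ : IsRegularWindow Ω) (h0 : (0 : Euc n) ∈ Ω)
    (hΩQ : IsRegularWindow (translationWindow A Ω)) (hA : C.IsInducedBy A Q)
    (hQL : Q '' C.L = C.L)
    (hAspec : ∀ z : ℂ, Polynomial.aeval z (LinearMap.charpoly A) = 0 → ‖z‖ < 1)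
    (hf : Continuous f) (hf0 : ∀ y, y ∉ Ω → f y = 0)
    (hf1 : ∫ y, f y = 1) {κ : ℝ}
    (href : ∀ u, f u = κ * ∫ v in translationWindow A Ω, f ((hA.equiv hQL).symm (u - v)))
    {k : Euc m} {χ : Euc n → ℂ} (hχ : C.IsDualCharacter k χ) :
    HasProd (fun N : ℕ => (∫ y in translationWindow A Ω, χ ((A ^ N) y)) /
      ((volume (translationWindow A Ω)).toReal : ℂ)) (∫ y, χ y * f y) := by
  set W := translationWindow A Ω
  set G : ℕ → ℂ := fun N => (∫ y in W, χ ((A ^ N) y)) / ((volume W).toReal : ℂ)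
  obtain ⟨ρ, hρ, hAρ⟩ := summable_norm_pow A hAspec
  obtain ⟨B, hB0, hB⟩ := hχ.exists_norm_sub_one_le
  obtain ⟨R, hR⟩ := hΩ.isCompact.isBounded.subset_closedBall 0
  have hWΩ : W ⊆ Ω := translationWindow_subset h0
  have hχN : ∀ N, ∀ y ∈ Ω, ‖χ ((A ^ N) y) - 1‖ ≤ |ρ N| * (B * R) := by
    intro N y hy
    have h1 : ‖y‖ ≤ R := mem_closedBall_zero_iff.1 (hR hy)
    calc _ ≤ B * ‖(A ^ N) y‖ := hB _
      _ ≤ B * (|ρ N| * R) := by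
        refine mul_le_mul_of_nonneg_left ((hAρ N y).trans ?_) hB0
        exact mul_le_mul (le_abs_self _) h1 (norm_nonneg _) (abs_nonneg _)
      _ = _ := by ring
  have hcont : ∀ N, Continuous fun y => χ ((A ^ N) y) := fun N =>
    hχ.continuous.comp (A ^ N).continuous_of_finiteDimensional
  have hvol : ((volume W).toReal : ℂ) ≠ 0 := Complex.ofReal_ne_zero.2 hΩQ.volume_pos.ne'
  have hG : ∀ N, ‖G N - 1‖ ≤ |ρ N| * (B * R) := by
    intro N
    have h1 : G N - 1 = (∫ y in W, (χ ((A ^ N) y) - 1)) / ((volume W).toReal : ℂ) := by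
      rw [integral_sub ((hcont N).continuousOn.integrableOn_compact hΩQ.isCompact)
        (continuousOn_const.integrableOn_compact hΩQ.isCompact), setIntegral_const, sub_div]
      congr 1
      simp [Measure.real, div_self hvol]
    rw [h1, norm_div, Complex.norm_real, Real.norm_eq_abs, abs_of_pos hΩQ.volume_pos,
      div_le_iff₀ hΩQ.volume_pos]
    exact norm_setIntegral_le_of_norm_le_const hΩQ.isCompact.measure_lt_top
      fun y hy => hχN N y (hWΩ hy)
  have hsum : Summable fun N => |ρ N| * (B * R) := hρ.abs.mul_right _
  -- Summability of |G N - 1| gives unconditional convergence even if some factors vanish.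
  have hmul : Multipliable G := by
    have := multipliable_one_add_of_summable (f := fun N => G N - 1)
      (hsum.of_nonneg_of_le (fun _ => norm_nonneg _) hG)
    simpa using this
  have hrec : ∀ N, ∫ y, χ ((A ^ N) y) * f y = G N * ∫ y, χ ((A ^ (N + 1)) y) * f y := by
    intro N
    have := integral_character_mul_recursion hΩ hΩQ hA hQL hf hf0 hf1 href
      (hχ.comp_induced_pow hA hQL N)
    rw [this]
    simp only [pow_succ A, Module.End.mul_apply]
    rfl
  -- Iterated recursion: the partial product times a remainder is constant in N, and the remainder
  -- tends to ∫ f = 1.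
  have hpart : ∀ N, ∫ y, χ y * f y =
      (∏ i ∈ Finset.range N, G i) * ∫ y, χ ((A ^ N) y) * f y := by
    intro N
    induction N with
    | zero => simp
    | succ N ih => rw [ih, hrec N, Finset.prod_range_succ, mul_assoc]
  have hlim : Tendsto (fun N => ∫ y, χ ((A ^ N) y) * f y) atTop (𝓝 1) := by
    have hfi : Integrable f := hf.integrable_of_hasCompactSupport
      (HasCompactSupport.intro hΩ.isCompact hf0)
    have hfc : HasCompactSupport fun y => (f y : ℂ) :=
      HasCompactSupport.intro hΩ.isCompact fun y hy => by rw [hf0 y hy]; simp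
    have hfi' : Integrable fun y => (f y : ℂ) := hfi.ofReal
    rw [tendsto_iff_norm_sub_tendsto_zero]
    refine squeeze_zero (fun _ => norm_nonneg _) (g := fun N => |ρ N| * (B * R) * ∫ y, |f y|)
      (fun N => ?_) ?_
    · have h1 : (∫ y, χ ((A ^ N) y) * f y) - 1 = ∫ y, (χ ((A ^ N) y) - 1) * f y := by
        simp_rw [sub_one_mul]
        have hint : Integrable fun y => χ ((A ^ N) y) * (f y : ℂ) :=
          ((hcont N).mul (Complex.continuous_ofReal.comp hf)).integrable_of_hasCompactSupport
            hfc.mul_left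
        rw [integral_sub hint hfi', integral_complex_ofReal, hf1, Complex.ofReal_one]
      rw [h1, ← integral_const_mul]
      refine norm_integral_le_of_norm_le (hfi.abs.const_mul _) (Eventually.of_forall fun y => ?_)
      rw [norm_mul, Complex.norm_real, Real.norm_eq_abs]
      by_cases hy : y ∈ Ω
      · exact mul_le_mul_of_nonneg_right (hχN N y hy) (abs_nonneg _)
      · rw [hf0 y hy]; simp
    · simpa using hsum.tendsto_atTop_zero.mul_const (∫ y, |f y|)
  have h2 := hmul.hasProd.tendsto_prod_nat.mul hlim
  rw [mul_one] at h2
  have h3 : Tendsto (fun N => (∏ i ∈ Finset.range N, G i) * ∫ y, χ ((A ^ N) y) * f y) atTop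
      (𝓝 (∫ y, χ y * f y)) := tendsto_const_nhds.congr hpart
  rw [tendsto_nhds_unique h3 h2]
  exact hmul.hasProd

end Induced

end CutProjectScheme

/-! ### Gaussian test functions and point masses. -/

namespace CutProjectScheme

open scoped ENNReal NNReal ContDiff

variable {m n : ℕ} {C : CutProjectScheme m n}

theorem one_add_pow_mul_exp_le {c : ℝ} (hc : 0 < c) (K : ℕ) {r : ℝ} (hr : 0 ≤ r) :
    (1 + r) ^ K * Real.exp (-c * r ^ 2) ≤ K.factorial * Real.exp (1 + 1 / (4 * c)) := by
  have h1 : (1 + r) ^ K ≤ K.factorial * Real.exp (1 + r) := by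
    have := Real.pow_div_factorial_le_exp (1 + r) (by linarith) K
    rwa [div_le_iff₀ (by positivity), mul_comm] at this
  calc _ ≤ K.factorial * Real.exp (1 + r) * Real.exp (-c * r ^ 2) := by gcongr
    _ = K.factorial * Real.exp (1 + r + -c * r ^ 2) := by rw [mul_assoc, ← Real.exp_add]
    _ ≤ _ := by
      refine mul_le_mul_of_nonneg_left (Real.exp_le_exp.2 ?_) (by positivity)
      have h2 : r ≤ 1 / (4 * c) + c * r ^ 2 := by
        have : 1 / (4 * c) + c * r ^ 2 - r = (2 * c * r - 1) ^ 2 / (4 * c) := by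
          field_simp; ring
        have : 0 ≤ (2 * c * r - 1) ^ 2 / (4 * c) := by positivity
        linarith
      linarith

/-- The Gaussian `exp(-c |x - k|²)` as a real Schwartz function. -/
def realGaussian (k : Euc m) (c : ℝ) (hc : 0 < c) : 𝓢(Euc m, ℝ) where
  toFun x := Real.exp (-c * ‖x - k‖ ^ 2)
  smooth' := by
    have : ContDiff ℝ ∞ fun x : Euc m => ‖x - k‖ ^ 2 := (contDiff_id.sub contDiff_const).norm_sq ℝ
    exact (contDiff_const.mul this).exp
  decay' a N := by
    have hf : (fun x : Euc m => ‖x - k‖ ^ 2).HasTemperateGrowth :=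
      (Function.hasTemperateGrowth_norm_sq (H := Euc m)).comp
        (Function.HasTemperateGrowth.id'.sub (Function.HasTemperateGrowth.const k))
    have hg : ContDiff ℝ ∞ fun t : ℝ => Real.exp (-c * t) := (contDiff_const.mul contDiff_id).exp
    obtain ⟨j, B, hB, hfB⟩ := hf.norm_iteratedFDeriv_le_uniform N
    refine ⟨N.factorial * (1 + c) ^ N * (1 + B) ^ N * (1 + ‖k‖) ^ (a + j * N) *
      ((a + j * N).factorial * Real.exp (1 + 1 / (4 * c))), fun x => ?_⟩
    set E := Real.exp (-c * ‖x - k‖ ^ 2)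
    -- The composition estimate wants bounds of the form C and D^i for the i-th derivatives.
    -- Replacing c by 1 + c and B by 1 + B makes the bases at least 1, so that powers only grow.
    have h1 : ‖iteratedFDeriv ℝ N ((fun t : ℝ => Real.exp (-c * t)) ∘
        fun x : Euc m => ‖x - k‖ ^ 2) x‖ ≤
        N.factorial * ((1 + c) ^ N * E) * ((1 + B) * (1 + ‖x‖) ^ j) ^ N := by
      refine norm_iteratedFDeriv_comp_le hg hf.1 (mod_cast le_top) x (fun i hi => ?_)
        (fun i hi hi' => ?_)
      · rw [norm_iteratedFDeriv_eq_norm_iteratedDeriv, iteratedDeriv_exp_const_mul, norm_mul,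
          norm_pow, Real.norm_eq_abs, abs_neg, abs_of_pos hc, Real.norm_eq_abs, Real.abs_exp]
        gcongr
        calc c ^ i ≤ (1 + c) ^ i := by gcongr; linarith
          _ ≤ (1 + c) ^ N := pow_le_pow_right₀ (by linarith) hi
      · calc _ ≤ B * (1 + ‖x‖) ^ j := hfB i hi' x
          _ ≤ (1 + B) * (1 + ‖x‖) ^ j := by gcongr; simp
          _ ≤ _ := by
            apply le_self_pow₀ (one_le_mul_of_one_le_of_one_le (by simp [hB])
              (by simp [one_le_pow₀]))
            omega
    have h2 : 1 + ‖x‖ ≤ (1 + ‖k‖) * (1 + ‖x - k‖) := by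
      have : ‖x‖ ≤ ‖x - k‖ + ‖k‖ := by simpa using norm_add_le (x - k) k
      nlinarith [norm_nonneg k, norm_nonneg (x - k)]
    have hE : 0 < E := Real.exp_pos _
    calc ‖x‖ ^ a * ‖iteratedFDeriv ℝ N (fun x : Euc m => Real.exp (-c * ‖x - k‖ ^ 2)) x‖
        ≤ (1 + ‖x‖) ^ a * (N.factorial * ((1 + c) ^ N * E) * ((1 + B) * (1 + ‖x‖) ^ j) ^ N) := by
          exact mul_le_mul (pow_le_pow_left₀ (norm_nonneg x) (by linarith) a) h1 (norm_nonneg _)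
            (by positivity)
      _ = N.factorial * (1 + c) ^ N * (1 + B) ^ N * ((1 + ‖x‖) ^ (a + j * N) * E) := by
          rw [mul_pow, ← pow_mul, pow_add]; ring
      _ ≤ N.factorial * (1 + c) ^ N * (1 + B) ^ N *
          (((1 + ‖k‖) * (1 + ‖x - k‖)) ^ (a + j * N) * E) := by gcongr
      _ = N.factorial * (1 + c) ^ N * (1 + B) ^ N * (1 + ‖k‖) ^ (a + j * N) *
          ((1 + ‖x - k‖) ^ (a + j * N) * E) := by rw [mul_pow]; ring
      _ ≤ _ := by
          exact mul_le_mul_of_nonneg_left (one_add_pow_mul_exp_le hc _ (norm_nonneg (x - k)))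
            (by positivity)

/-- The Gaussian `exp(-π s² |x - k|²)` as a Schwartz function. -/
def gaussianSchwartz (k : Euc m) {s : ℝ} (hs : 0 < s) : 𝓢(Euc m, ℂ) :=
  SchwartzMap.postcompCLM Complex.ofRealCLM
    (realGaussian k (Real.pi * s ^ 2) (mul_pos Real.pi_pos (pow_pos hs 2)))

theorem gaussianSchwartz_apply (k : Euc m) {s : ℝ} (hs : 0 < s) (x : Euc m) :
    gaussianSchwartz k hs x = (Real.exp (-(Real.pi * s ^ 2) * ‖x - k‖ ^ 2) : ℂ) := rfl

theorem fourier_gaussianSchwartz (k : Euc m) {s : ℝ} (hs : 0 < s) (w : Euc m) :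
    (𝓕 (gaussianSchwartz k hs) : 𝓢(Euc m, ℂ)) w = (gaussWeight m s w : ℂ) * phase k w := by
  have hpi := Real.pi_pos
  have hpi' : (Real.pi : ℂ) ≠ 0 := Complex.ofReal_ne_zero.2 hpi.ne'
  have hs' : (s : ℂ) ≠ 0 := Complex.ofReal_ne_zero.2 hs.ne'
  have hb : 0 < ((Real.pi * s ^ 2 : ℝ) : ℂ).re := by rw [Complex.ofReal_re]; positivity
  have h1 := fourier_gaussian_innerProductSpace hb w
  have h2 : (𝓕 (gaussianSchwartz k hs) : 𝓢(Euc m, ℂ)) w = phase k w *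
      𝓕 (fun v : Euc m => Complex.exp (-((Real.pi * s ^ 2 : ℝ) : ℂ) * (‖v‖ : ℂ) ^ 2)) w := by
    rw [SchwartzMap.fourier_coe, Real.fourier_eq', Real.fourier_eq', ← integral_const_mul,
      ← integral_add_right_eq_self _ k]
    refine integral_congr_ae (Eventually.of_forall fun v => ?_)
    simp only [gaussianSchwartz_apply, add_sub_cancel_right, smul_eq_mul, phase,
      Complex.ofReal_exp, ← Complex.exp_add, inner_add_left]
    congr 1
    push_cast
    ring
  rw [h2, h1, gaussWeight, mul_comm]
  congr 1
  have h3 : ((Real.pi : ℂ) / ((Real.pi * s ^ 2 : ℝ) : ℂ)) ^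
      ((Module.finrank ℝ (Euc m) : ℂ) / 2) = (((s ^ m)⁻¹ : ℝ) : ℂ) := by
    rw [finrank_euclideanSpace_fin, ← Complex.ofReal_div,
      show ((m : ℂ) / 2) = ((m / 2 : ℝ) : ℂ) by push_cast; rfl,
      ← Complex.ofReal_cpow (by positivity)]
    congr 1
    rw [show Real.pi / (Real.pi * s ^ 2) = (s⁻¹) ^ (2 : ℝ) by rw [Real.rpow_two]; field_simp,
      ← Real.rpow_mul (by positivity), mul_div_cancel₀ _ (two_ne_zero), Real.rpow_natCast, inv_pow]
  rw [h3, Complex.ofReal_mul (s ^ m)⁻¹, Complex.ofReal_exp]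
  congr 2
  push_cast
  field_simp

/-- Testing a measure with narrow Gaussians recovers the mass of a point. -/
theorem tendsto_integral_gaussian {ν : Measure (Euc m)} [IsLocallyFiniteMeasure ν] (k : Euc m)
    (hν : Integrable (gaussianSchwartz k one_pos) ν) :
    Tendsto (fun s : ℝ => ∫ x, (Real.exp (-(Real.pi * s ^ 2) * ‖x - k‖ ^ 2) : ℂ) ∂ν) atTop
      (𝓝 ((ν {k}).toReal : ℂ)) := by
  have hpi := Real.pi_pos
  have h1 : ∫ x, (({k} : Set (Euc m)).indicator (fun _ => (1 : ℂ)) x) ∂ν = ((ν {k}).toReal : ℂ) := by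
    rw [integral_indicator (measurableSet_singleton k), setIntegral_const]
    simp [Measure.real]
  rw [← h1]
  -- For s ≥ 1 the Gaussian of parameter 1 dominates, and the pointwise limit is the indicator of
  -- the point k.
  refine tendsto_integral_filter_of_dominated_convergence
    (fun x => ‖gaussianSchwartz k one_pos x‖) ?_ ?_ hν.norm ?_
  · exact Eventually.of_forall fun s => Continuous.aestronglyMeasurable (by fun_prop)
  · filter_upwards [eventually_ge_atTop 1] with s hs
    refine Eventually.of_forall fun x => ?_
    rw [gaussianSchwartz_apply, Complex.norm_real, Complex.norm_real, Real.norm_eq_abs,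
      Real.norm_eq_abs, Real.abs_exp, Real.abs_exp]
    apply Real.exp_le_exp.2
    have : (1 : ℝ) ^ 2 ≤ s ^ 2 := by gcongr
    have h3 : 0 ≤ Real.pi * ‖x - k‖ ^ 2 := by positivity
    nlinarith
  · refine Eventually.of_forall fun x => ?_
    by_cases hx : x = k
    · subst hx
      simp
    · rw [Set.indicator_of_notMem (by simpa using hx)]
      have hpos : 0 < ‖x - k‖ ^ 2 := by
        have := norm_pos_iff.2 (sub_ne_zero.2 hx); positivity
      have h2 : Tendsto (fun s : ℝ => -(Real.pi * s ^ 2) * ‖x - k‖ ^ 2) atTop atBot := by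
        have h3 : Tendsto (fun s : ℝ => (Real.pi * ‖x - k‖ ^ 2) * s ^ 2) atTop atTop :=
          (tendsto_pow_atTop two_ne_zero).const_mul_atTop (by positivity)
        refine (tendsto_neg_atTop_atBot.comp h3).congr fun s => ?_
        simp only [Function.comp]; ring
      have := (Complex.continuous_ofReal.tendsto 0).comp (Real.tendsto_exp_atBot.comp h2)
      simpa [Function.comp_def] using this

end CutProjectScheme

/-! ### Self-correlation of a window, and stability of means under truncation. -/

namespace CutProjectScheme

open scoped ENNReal NNReal

variable {m n : ℕ} {C : CutProjectScheme m n}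

/-- The normalized self-correlation of the function `F` restricted to the window `W`. -/
def windowCorr (W : Set (Euc n)) (F : Euc n → ℝ) (u : Euc n) : ℝ :=
  (∫ y, W.indicator F y * W.indicator F (y - u)) / (volume W).toReal

section WindowCorr

variable {W : Set (Euc n)} {F : Euc n → ℝ}

theorem windowCorr_nonneg (h0 : ∀ y ∈ W, 0 ≤ F y) (u : Euc n) : 0 ≤ windowCorr W F u :=
  div_nonneg (integral_nonneg fun _ => mul_nonneg (Set.indicator_nonneg h0 _)
    (Set.indicator_nonneg h0 _)) ENNReal.toReal_nonneg

theorem isCompact_sub_self (hW : IsCompact W) :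
    IsCompact ((fun q : Euc n × Euc n => q.1 - q.2) '' W ×ˢ W) :=
  (hW.prod hW).image (by fun_prop)

theorem windowCorr_eq_zero {u : Euc n}
    (hu : u ∉ (fun q : Euc n × Euc n => q.1 - q.2) '' W ×ˢ W) : windowCorr W F u = 0 := by
  rw [windowCorr]
  have : ∀ y, W.indicator F y * W.indicator F (y - u) = 0 := by
    intro y
    by_cases h1 : y ∈ W
    · rw [Set.indicator_of_notMem (a := y - u), mul_zero]
      exact fun h2 => hu ⟨(y, y - u), ⟨h1, h2⟩, by simp⟩
    · rw [Set.indicator_of_notMem h1, zero_mul]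
  simp [this]

theorem IsRegularWindow.exists_norm_indicator_le (hW : IsRegularWindow W) (hF : Continuous F) :
    ∃ M : ℝ, 0 ≤ M ∧ ∀ y, ‖W.indicator F y‖ ≤ M := by
  obtain ⟨M, hM⟩ := hW.isCompact.exists_bound_of_continuousOn hF.continuousOn
  refine ⟨|M|, abs_nonneg M, fun y => ?_⟩
  by_cases hy : y ∈ W
  · rw [Set.indicator_of_mem hy]; exact (hM y hy).trans (le_abs_self M)
  · rw [Set.indicator_of_notMem hy, norm_zero]; exact abs_nonneg M

theorem IsRegularWindow.integrable_indicator (hW : IsRegularWindow W) (hF : Continuous F) :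
    Integrable (W.indicator F) :=
  (integrable_indicator_iff hW.isCompact.measurableSet).2
    (hF.continuousOn.integrableOn_compact hW.isCompact)

theorem continuous_windowCorr (hW : IsRegularWindow W) (hF : Continuous F) :
    Continuous (windowCorr W F) := by
  refine Continuous.div_const (continuous_iff_continuousAt.2 fun u => ?_) _
  obtain ⟨M, hM0, hM⟩ := hW.exists_norm_indicator_le hF
  have hmeas : Measurable (W.indicator F) := hF.measurable.indicator hW.isCompact.measurableSet
  refine continuousAt_of_dominated (bound := fun y => ‖W.indicator F y‖ * M)
    (Eventually.of_forall fun v => ?_) (Eventually.of_forall fun v => ?_) ?_ ?_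
  · exact (hmeas.mul (hmeas.comp (measurable_id.sub_const v))).aestronglyMeasurable
  · refine Eventually.of_forall fun y => ?_
    rw [norm_mul]
    exact mul_le_mul_of_nonneg_left (hM _) (norm_nonneg _)
  · exact (hW.integrable_indicator hF).norm.mul_const M
  -- The cut-off function jumps only at the frontier of W, whose translate is null, so the integrand
  -- is continuous at u for almost every y.
  · have h0 : volume ((fun y => y - u) ⁻¹' frontier W) = 0 := by
      simp_rw [sub_eq_add_neg]
      rw [measure_preimage_add_right, hW.volume_frontier]
    filter_upwards [measure_eq_zero_iff_ae_notMem.1 h0] with y hy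
    refine continuousAt_const.mul ?_
    exact ContinuousAt.comp (f := fun v => y - v)
      (hF.continuousOn.continuousAt_indicator hy) (by fun_prop)

/-- Wiener's identity: times χ, the self-correlation is the convolution of χF on W with the
reflected function, whose integral is the complex conjugate. -/
theorem integral_character_mul_windowCorr (hW : IsRegularWindow W) (hF : Continuous F) {k : Euc m}
    {χ : Euc n → ℂ} (hχ : C.IsDualCharacter k χ) :
    ∫ u, χ u * windowCorr W F u =
      ((‖∫ y in W, χ y * F y‖ ^ 2 / (volume W).toReal : ℝ) : ℂ) := by
  have hi := hW.integrable_indicator hF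
  have hχc := hχ.continuous
  have hbd : ∀ g : Euc n → ℝ, Integrable g → Integrable (fun y => χ y * (g y : ℂ)) := fun g hg =>
    hg.ofReal.bdd_mul (c := 1) hχc.aestronglyMeasurable
      (Eventually.of_forall fun y => (hχ.norm_eq_one y).le)
  have h1 := integral_convolution (ContinuousLinearMap.mul ℝ ℂ) (μ := volume) (ν := volume)
    (hbd _ hi) (hbd (fun y => W.indicator F (-y)) hi.comp_neg)
  have h2 : ∫ y, χ y * ((W.indicator F y : ℝ) : ℂ) = ∫ y in W, χ y * F y := by
    rw [← integral_indicator hW.isCompact.measurableSet]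
    congr 1; ext y
    by_cases hy : y ∈ W <;> simp [hy]
  have h3 : ∫ y, χ y * ((W.indicator F (-y) : ℝ) : ℂ) = (starRingEnd ℂ) (∫ y in W, χ y * F y) := by
    rw [← h2, ← integral_conj, ← integral_neg_eq_self]
    congr 1; ext y
    rw [neg_neg, hχ.map_neg, map_mul, Complex.conj_ofReal]
  rw [h2, h3, ContinuousLinearMap.mul_apply', Complex.mul_conj'] at h1
  rw [Complex.ofReal_div, Complex.ofReal_pow, ← h1, ← integral_div]
  congr 1; ext u
  rw [windowCorr, Complex.ofReal_div, mul_div_assoc', convolution_def, ← integral_complex_ofReal,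
    ← integral_const_mul]
  congr 2; ext y
  rw [ContinuousLinearMap.mul_apply', neg_sub, Complex.ofReal_mul]
  have : χ u = χ y * χ (u - y) := by rw [← hχ.map_add, add_sub_cancel]
  rw [this]; ring

end WindowCorr

/-- Lets a summand be altered at points that enter or leave the ball under translation by t; these
are negligible by the `shift` property. The alteration may depend on s. -/
theorem tendsto_ballMean_of_shift {W : Set (Euc n)} (hW : IsRegularWindow W)
    {Φ : Euc m → ℂ} {Ψ : ℝ → Euc m → ℂ} (t : Euc m)
    (hΦ : C.IsAdmissible (fun z => W.indicator (fun _ => Φ z.1.1) z.1.2))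
    (hle : ∀ s : ℝ, 0 < s → ∀ x, ballWeight m s x * ‖Ψ s x - Φ x‖ ≤
      |ballWeight m s (x + t) - ballWeight m s x| * ‖Φ x‖)
    (hb : ∀ s x, ‖Ψ s x‖ ≤ ‖Φ x‖)
    {l : ℂ} (h : Tendsto (ballMean (C.modelSet W) Φ) atTop (𝓝 l)) :
    Tendsto (fun s => ballMean (C.modelSet W) (Ψ s) s) atTop (𝓝 l) := by
  have ha := C.isAveraging_ballWeight
  obtain ⟨K, M, hK, hd⟩ := id hΦ
  have hd' : ∀ s, C.IsDominated K M (fun z => W.indicator (fun _ => Ψ s z.1.1) z.1.2) := by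
    refine fun s z => (?_ : _ ≤ _).trans (hd z)
    by_cases hz : z.1.2 ∈ W
    · simpa only [Set.indicator_of_mem hz] using hb s z.1.1
    · simp only [Set.indicator_of_notMem hz]; exact le_rfl
  obtain ⟨B, hB⟩ := ha.wsum_bound hK
  have h3 : Tendsto (fun s => (M : ℝ≥0∞) * ∑' z : C.lattice, K.indicator (fun _ =>
      ENNReal.ofReal |ballWeight m s (z.1.1 + t) - ballWeight m s z.1.1|) z.1.2) atTop (𝓝 0) := by
    simpa using ENNReal.Tendsto.const_mul (ha.shift K hK t) (Or.inr ENNReal.coe_ne_top)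
  have h4 := (ENNReal.tendsto_toReal ENNReal.zero_ne_top).comp h3
  have hdiff : Tendsto (fun s => C.wsum (ballWeight m s)
      (fun z => W.indicator (fun _ => Ψ s z.1.1) z.1.2) - C.wsum (ballWeight m s)
      (fun z => W.indicator (fun _ => Φ z.1.1) z.1.2)) atTop (𝓝 0) := by
    refine squeeze_zero_norm' ?_ h4
    filter_upwards [hB, h3.eventually (gt_mem_nhds ENNReal.zero_lt_top), ha.nonneg,
      eventually_gt_atTop 0] with s s1 s3 s0 hs
    rw [wsum, wsum, ← (s1 M _ (hd' s)).1.tsum_sub (s1 M _ hd).1]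
    have h5 : ∑' z : C.lattice, ‖(ballWeight m s z.1.1 : ℂ) *
        W.indicator (fun _ => Ψ s z.1.1) z.1.2 - (ballWeight m s z.1.1 : ℂ) *
        W.indicator (fun _ => Φ z.1.1) z.1.2‖ₑ ≤ ∑' z : C.lattice,
        ‖((ballWeight m s (z.1.1 + t) - ballWeight m s z.1.1 : ℝ) : ℂ) *
          W.indicator (fun _ => Φ z.1.1) z.1.2‖ₑ := by
      refine ENNReal.tsum_le_tsum fun z => ?_
      rw [← ofReal_norm, ← ofReal_norm]
      refine ENNReal.ofReal_le_ofReal ?_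
      by_cases hz : z.1.2 ∈ W
      · simp only [Set.indicator_of_mem hz]
        rw [← mul_sub, norm_mul, norm_mul, Complex.norm_real, Complex.norm_real,
          Real.norm_eq_abs, Real.norm_eq_abs, abs_of_nonneg (s0 _)]
        exact hle s hs z.1.1
      · simp [Set.indicator_of_notMem hz]
    have h6 := (enorm_tsum_le_tsum_enorm.trans h5).trans
      (hd.tsum_enorm_le (fun x => ballWeight m s (x + t) - ballWeight m s x))
    rw [← ofReal_norm] at h6
    have := ENNReal.toReal_mono s3.ne h6
    rwa [ENNReal.toReal_ofReal (norm_nonneg _)] at this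
  rw [tendsto_iff_ultrafilter]
  intro U hU
  obtain ⟨c, hc0, hc⟩ := exists_umean_eq_integral ha hU
  have h2 := wsum_indicator_one ha hU hc0 hc hW
  have hne : (c : ℂ) * ((volume W).toReal : ℂ) ≠ 0 := mul_ne_zero
    (Complex.ofReal_ne_zero.2 hc0.ne') (Complex.ofReal_ne_zero.2 hW.volume_pos.ne')
  have h7 := ((hdiff.mono_left hU).div h2 hne).add (h.mono_left hU)
  rw [zero_div, zero_add] at h7
  refine h7.congr' ?_
  filter_upwards [hU (eventually_gt_atTop 0)] with s hs
  rw [ballMean_modelSet hW.isCompact hs, ballMean_modelSet hW.isCompact hs, Pi.div_apply, ← add_div,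
    sub_add_cancel]

end CutProjectScheme

/-! ### The autocorrelation as an explicit comb. -/

namespace CutProjectScheme

open scoped ENNReal NNReal

variable {m n : ℕ} {C : CutProjectScheme m n}

theorem ballMean_congr {T : Set (Euc m)} {K : Type} [Field K] {F G : Euc m → K} {s : ℝ}
    (h : ∀ x ∈ truncation T s, F x = G x) : ballMean T F s = ballMean T G s := by
  rw [ballMean, ballMean, finsum_mem_congr rfl h]

theorem ballMean_sum {W : Set (Euc n)} (hW : IsCompact W) {ι : Type*} (D : Finset ι) (c : ι → ℝ)
    (F : ι → Euc m → ℝ) (s : ℝ) :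
    ballMean (C.modelSet W) (fun x => ∑ i ∈ D, F i x * c i) s =
      ∑ i ∈ D, ballMean (C.modelSet W) (F i) s * c i := by
  have hfin := finite_truncation (C := C) hW s
  simp only [ballMean, finsum_mem_eq_finite_toFinset_sum _ hfin]
  rw [Finset.sum_comm, Finset.mul_sum]
  refine Finset.sum_congr rfl fun i _ => ?_
  rw [← Finset.sum_mul, mul_assoc]

section Pairs

variable {W : Set (Euc n)} {F : Euc n → ℝ} {w : Euc m → ℝ}

open Classical in
theorem tendsto_ballMean_pair (hW : IsRegularWindow W) (hF : Continuous F)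
    (hw : ∀ z ∈ C.lattice, z.2 ∈ W → w z.1 = F z.2) {z : Euc m × Euc n} (hz : z ∈ C.lattice) :
    Tendsto (ballMean (C.modelSet W)
      (fun x => if x - z.1 ∈ C.modelSet W then w x * w (x - z.1) else 0)) atTop
      (𝓝 (windowCorr W F z.2)) := by
  -- Both x and x - z lie in the model set exactly when x^* lies in W ∩ (W + z^*), again a compact
  -- set with null boundary.
  set V : Set (Euc n) := W ∩ (Homeomorph.subRight z.2) ⁻¹' W with hV
  have hVc : IsCompact V :=
    hW.isCompact.inter_right (hW.isCompact.isClosed.preimage (Homeomorph.continuous _))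
  have hV0 : volume (frontier V) = 0 := by
    refine measure_mono_null (t := frontier W ∪ (Homeomorph.subRight z.2) ⁻¹' frontier W) ?_
      (measure_union_null hW.volume_frontier ?_)
    · refine (frontier_inter_subset _ _).trans (Set.union_subset_union Set.inter_subset_left ?_)
      rw [← Homeomorph.preimage_frontier]
      exact Set.inter_subset_right
    · have : (Homeomorph.subRight z.2 : Euc n → Euc n) = fun y => y + -z.2 := by
        ext1 y; simp [sub_eq_add_neg]
      rw [this, measure_preimage_add_right, hW.volume_frontier]
  have h := tendsto_ballMean_real (C := C) hW hVc hV0 (F := fun y => F y * F (y - z.2))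
    (by fun_prop)
    (Φ := fun x => if x - z.1 ∈ C.modelSet W then w x * w (x - z.1) else 0) (fun q hq => by
      have hmem := mem_modelSet_iff (W := W) (C.lattice.sub_mem hq hz)
      rw [Prod.fst_sub, Prod.snd_sub] at hmem
      by_cases h1 : q.2 ∈ W
      · by_cases h2 : q.2 - z.2 ∈ W
        · have h3 : q.2 ∈ V := ⟨h1, h2⟩
          rw [Set.indicator_of_mem h1, Set.indicator_of_mem h3, if_pos (hmem.2 h2), hw q hq h1]
          have := hw _ (C.lattice.sub_mem hq hz) h2
          rw [Prod.fst_sub, Prod.snd_sub] at this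
          rw [this]
        · have h3 : q.2 ∉ V := fun h => h2 h.2
          rw [Set.indicator_of_mem h1, Set.indicator_of_notMem h3, if_neg (fun h => h2 (hmem.1 h))]
      · have h3 : q.2 ∉ V := fun h => h1 h.1
        rw [Set.indicator_of_notMem h1, Set.indicator_of_notMem h3])
  convert h using 2
  rw [windowCorr, ← integral_indicator hVc.measurableSet]
  congr 2
  ext y
  by_cases h1 : y ∈ W <;> by_cases h2 : y - z.2 ∈ W <;> simp [V, Set.indicator, h1, h2]

open Classical in
theorem tendsto_ballMean_truncated_pair (hW : IsRegularWindow W) (hF : Continuous F)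
    (hw : ∀ z ∈ C.lattice, z.2 ∈ W → w z.1 = F z.2) {z : Euc m × Euc n} (hz : z ∈ C.lattice) :
    Tendsto (fun s => ballMean (C.modelSet W) (fun x =>
        (truncation (C.modelSet W) s).indicator (fun y => w x * w y) (x - z.1)) s) atTop
      (𝓝 (windowCorr W F z.2)) := by
  set Φ : Euc m → ℝ := fun x => if x - z.1 ∈ C.modelSet W then w x * w (x - z.1) else 0 with hΦ
  have hT : ∀ s x, (truncation (C.modelSet W) s).indicator (fun y => w x * w y) (x - z.1) =
      if ‖x - z.1‖ ≤ s then Φ x else 0 := by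
    intro s x
    by_cases h1 : x - z.1 ∈ C.modelSet W <;> by_cases h2 : ‖x - z.1‖ ≤ s <;>
      simp [truncation, Set.indicator, Φ, h1, h2]
  obtain ⟨M, hM0, hM⟩ := hW.exists_norm_indicator_le hF
  have hwM : ∀ q ∈ C.lattice, q.2 ∈ W → |w q.1| ≤ M := fun q hq hqW => by
    have := hM q.2
    rwa [Set.indicator_of_mem hqW, ← hw q hq hqW] at this
  have hadm : C.IsAdmissible (fun q => W.indicator (fun _ => ((Φ q.1.1 : ℝ) : ℂ)) q.1.2) := by
    refine ⟨W, ⟨M * M, by positivity⟩, hW.isCompact, isDominated_of (fun q => ?_)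
      (fun q hq => Set.indicator_of_notMem hq _)⟩
    change _ ≤ M * M
    by_cases hq : q.1.2 ∈ W
    · have hmem := mem_modelSet_iff (W := W) (C.lattice.sub_mem q.2 hz)
      rw [Prod.fst_sub, Prod.snd_sub] at hmem
      rw [Set.indicator_of_mem hq, Complex.norm_real, Real.norm_eq_abs]
      by_cases h2 : q.1.1 - z.1 ∈ C.modelSet W
      · rw [hΦ]
        simp only [if_pos h2, abs_mul]
        exact mul_le_mul (hwM _ q.2 hq) (hwM _ (C.lattice.sub_mem q.2 hz) (hmem.1 h2))
          (abs_nonneg _) hM0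
      · rw [hΦ]
        simp only [if_neg h2, abs_zero]
        positivity
    · rw [Set.indicator_of_notMem hq, norm_zero]; positivity
  have h := (Complex.continuous_ofReal.tendsto _).comp (tendsto_ballMean_pair hW hF hw hz)
  -- Requiring x - z to lie in the ball of radius s as well only affects points near the boundary of
  -- the ball.
  have h1 := tendsto_ballMean_of_shift hW (Φ := fun x => ((Φ x : ℝ) : ℂ))
    (Ψ := fun s x => ((if ‖x - z.1‖ ≤ s then Φ x else 0 : ℝ) : ℂ)) (-z.1) hadm
    (fun s hs x => by
      have h2 : ballWeight m s (x + -z.1) = if ‖x - z.1‖ ≤ s then (s ^ m)⁻¹ else 0 := by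
        simp [ballWeight, Set.indicator, sub_eq_add_neg]
      have h3 : ballWeight m s x = if ‖x‖ ≤ s then (s ^ m)⁻¹ else 0 := by
        simp [ballWeight, Set.indicator]
      rw [h2, h3]
      have h4 : 0 ≤ (s ^ m)⁻¹ := by positivity
      by_cases h5 : ‖x - z.1‖ ≤ s <;> by_cases h6 : ‖x‖ ≤ s <;>
        simp [h5, h6, abs_of_nonneg h4, mul_nonneg h4])
    (fun s x => by
      by_cases h5 : ‖x - z.1‖ ≤ s <;> simp [h5])
    (h.congr fun s => ofReal_ballMean hW.isCompact s _)
  have h2 := (Complex.continuous_re.tendsto _).comp h1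
  rw [Complex.ofReal_re] at h2
  refine h2.congr fun s => ?_
  simp only [Function.comp, hT]
  rw [← ofReal_ballMean hW.isCompact, Complex.ofReal_re]

/-- Substituting y = x - z turns the inner sum into one over a fixed finite set of lattice
differences, so that the limit in s can be taken term by term. -/
theorem finsum_truncation_sub {D : Finset C.lattice} {φ : Euc m → ℝ} {s : ℝ}
    (hD : ∀ z : C.lattice, φ z.1.1 ≠ 0 →
      z.1.2 ∈ (fun q : Euc n × Euc n => q.1 - q.2) '' W ×ˢ W → z ∈ D) {x : Euc m}
    (hx : x ∈ C.modelSet W) :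
    ∑ᶠ y ∈ truncation (C.modelSet W) s, w x * w y * φ (x - y) =
      ∑ z ∈ D, (truncation (C.modelSet W) s).indicator (fun y => w x * w y) (x - z.1.1) *
        φ z.1.1 := by
  classical
  have hinj : Set.InjOn (fun z : C.lattice => x - z.1.1) D := fun z _ z' _ h =>
    Subtype.ext (C.fst_injOn z.2 z'.2 (sub_right_injective h))
  rw [finsum_mem_def, finsum_eq_sum_of_support_subset (s := D.image fun z : C.lattice => x - z.1.1),
    Finset.sum_image hinj]
  · refine Finset.sum_congr rfl fun z _ => ?_
    by_cases h : x - z.1.1 ∈ truncation (C.modelSet W) s <;> simp [h]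
  · intro y hy
    rw [Function.mem_support] at hy
    have hyT : y ∈ truncation (C.modelSet W) s := by
      by_contra h; exact hy (Set.indicator_of_notMem h _)
    rw [Set.indicator_of_mem hyT] at hy
    rw [Finset.coe_image]
    refine ⟨⟨_, C.lattice.sub_mem (mem_lattice_of_mem_L hx.1) (mem_lattice_of_mem_L hyT.1.1)⟩,
      hD _ (right_ne_zero_of_mul hy) ⟨(_, _), ⟨hx.2, hyT.1.2⟩, rfl⟩, ?_⟩
    simp

theorem tendsto_autocorrelation (hW : IsRegularWindow W) (hF : Continuous F)
    (hw : ∀ z ∈ C.lattice, z.2 ∈ W → w z.1 = F z.2) {φ : Euc m → ℝ} {D : Finset C.lattice}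
    (hD : ∀ z : C.lattice, φ z.1.1 ≠ 0 →
      z.1.2 ∈ (fun q : Euc n × Euc n => q.1 - q.2) '' W ×ˢ W → z ∈ D) :
    Tendsto (fun s : ℝ => ballMean (C.modelSet W)
        (fun x => ∑ᶠ y ∈ truncation (C.modelSet W) s, w x * w y * φ (x - y)) s) atTop
      (𝓝 (∑ z ∈ D, windowCorr W F z.1.2 * φ z.1.1)) := by
  refine (tendsto_finsetSum D fun z _ =>
    (tendsto_ballMean_truncated_pair hW hF hw z.2).mul_const (φ z.1.1)).congr fun s => ?_
  rw [ballMean_congr (fun x hx => finsum_truncation_sub hD hx.1), ballMean_sum hW.isCompact]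

end Pairs

section Comb

variable (C) in
/-- The pure point measure on physical space with mass `windowCorr W F x^*` at `x`. -/
def corrComb (W : Set (Euc n)) (F : Euc n → ℝ) : Measure (Euc m) :=
  Measure.sum fun z : C.lattice => ENNReal.ofReal (windowCorr W F z.1.2) • Measure.dirac z.1.1

variable {W : Set (Euc n)} {F : Euc n → ℝ} {w : Euc m → ℝ}

theorem exists_finset_lattice (hW : IsCompact W) {K : Set (Euc m)} (hK : IsCompact K) :
    ∃ D : Finset C.lattice, ∀ z : C.lattice, z.1.1 ∈ K →
      z.1.2 ∈ (fun q : Euc n × Euc n => q.1 - q.2) '' W ×ˢ W → z ∈ D := by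
  obtain ⟨R, hR⟩ := hK.isBounded.subset_closedBall 0
  have hfin := finite_setOf_lattice (C := C) (isCompact_sub_self hW) R
  refine ⟨hfin.toFinset, fun z h1 h2 => hfin.mem_toFinset.2 ⟨?_, h2⟩⟩
  simpa using hR h1

theorem isFiniteMeasureOnCompacts_corrComb (hW : IsCompact W) :
    IsFiniteMeasureOnCompacts (C.corrComb W F) := by
  refine ⟨fun K hK => ?_⟩
  obtain ⟨D, hD⟩ := exists_finset_lattice (C := C) hW hK
  rw [corrComb, Measure.sum_apply _ hK.measurableSet, tsum_eq_sum (s := D)]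
  · refine ENNReal.sum_lt_top.2 fun z _ => ?_
    rw [Measure.smul_apply, smul_eq_mul]
    exact ENNReal.mul_lt_top ENNReal.ofReal_lt_top (measure_lt_top _ _)
  · intro z hz
    rw [Measure.smul_apply, Measure.dirac_apply' _ hK.measurableSet, smul_eq_mul]
    by_cases h1 : z.1.1 ∈ K
    · rw [windowCorr_eq_zero fun h2 => hz (hD z h1 h2), ENNReal.ofReal_zero, zero_mul]
    · rw [Set.indicator_of_notMem h1, mul_zero]

theorem integral_corrComb (h0 : ∀ y ∈ W, 0 ≤ F y) {E : Type*} [NormedAddCommGroup E]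
    [NormedSpace ℝ E] [CompleteSpace E] {f : Euc m → E} (hf : Integrable f (C.corrComb W F)) :
    ∫ x, f x ∂(C.corrComb W F) = ∑' z : C.lattice, windowCorr W F z.1.2 • f z.1.1 := by
  rw [corrComb, ← (hasSum_integral_measure hf).tsum_eq]
  refine tsum_congr fun z => ?_
  rw [integral_smul_measure, integral_dirac, ENNReal.toReal_ofReal (windowCorr_nonneg h0 _)]

/-- Vague limits are unique: both measures are finite on compact sets and agree on continuous
functions of compact support, each of which sees only finitely many points of the comb. -/
theorem autocorrelation_eq_corrComb (hW : IsRegularWindow W) (hF : Continuous F)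
    (h0 : ∀ y ∈ W, 0 ≤ F y) (hw : ∀ z ∈ C.lattice, z.2 ∈ W → w z.1 = F z.2)
    {γ : Measure (Euc m)} (hγ : IsAutocorrelation (C.modelSet W) w γ) : γ = C.corrComb W F := by
  have := hγ.1
  have := isFiniteMeasureOnCompacts_corrComb (C := C) (F := F) hW.isCompact
  refine Measure.ext_of_integral_eq_on_compactlySupported fun φ => ?_
  have hφc := φ.hasCompactSupport
  obtain ⟨D, hD⟩ := exists_finset_lattice (C := C) hW.isCompact hφc
  have hD' : ∀ z : C.lattice, φ z.1.1 ≠ 0 →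
      z.1.2 ∈ (fun q : Euc n × Euc n => q.1 - q.2) '' W ×ˢ W → z ∈ D := fun z h1 h2 =>
    hD z (subset_tsupport _ h1) h2
  have hφi : Integrable (φ : Euc m → ℝ) (C.corrComb W F) :=
    φ.continuous.integrable_of_hasCompactSupport hφc
  rw [tendsto_nhds_unique (hγ.2 φ φ.continuous hφc) (tendsto_autocorrelation hW hF hw hD'),
    integral_corrComb h0 hφi,
    tsum_eq_sum (s := D)]
  · rfl
  · intro z hz
    by_cases h1 : φ z.1.1 = 0
    · rw [h1, smul_zero]
    · rw [windowCorr_eq_zero fun h2 => hz (hD' z h1 h2), zero_smul]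

end Comb

end CutProjectScheme

/-! ### Bragg peaks, and the main theorem. -/

namespace CutProjectScheme

open scoped ENNReal NNReal

variable {m n : ℕ} {C : CutProjectScheme m n}

section Bragg

variable {W : Set (Euc n)} {F : Euc n → ℝ} {w : Euc m → ℝ} {ν : Measure (Euc m)}

/-- The Fourier transform of a Gaussian narrowing at k is a widening Gaussian weight times the phase
of k. Integrated against the comb it is a Gaussian-weighted lattice sum, to which equidistribution
applies. -/
theorem tendsto_wsum_gaussWeight (hW : IsRegularWindow W) (hF : Continuous F)
    (h0 : ∀ y ∈ W, 0 ≤ F y) (hw : ∀ z ∈ C.lattice, z.2 ∈ W → w z.1 = F z.2)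
    (hν : IsDiffractionMeasure (C.modelSet W) w ν) (k : Euc m) :
    Tendsto (fun s => C.wsum (gaussWeight m s)
      (fun z => phase k z.1.1 * (windowCorr W F z.1.2 : ℂ))) atTop (𝓝 ((ν {k}).toReal : ℂ)) := by
  obtain ⟨hν, γ, hγ, h⟩ := hν
  rw [autocorrelation_eq_corrComb hW hF h0 hw hγ] at h
  refine (tendsto_integral_gaussian k (h _).2.1).congr' ?_
  filter_upwards [eventually_gt_atTop 0] with s hs
  have h1 := h (gaussianSchwartz k hs)
  rw [integral_corrComb h0 h1.1] at h1
  rw [wsum]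
  refine h1.2.2.symm.trans (tsum_congr fun z => ?_)
  rw [fourier_gaussianSchwartz, Complex.real_smul]
  ring

/-- The intensity of a Bragg peak is a positive multiple of the squared modulus of a Fourier
coefficient of the density on the window. -/
theorem measure_singleton_of_isDualCharacter (hW : IsRegularWindow W) (hF : Continuous F)
    (h0 : ∀ y ∈ W, 0 ≤ F y) (hw : ∀ z ∈ C.lattice, z.2 ∈ W → w z.1 = F z.2)
    (hν : IsDiffractionMeasure (C.modelSet W) w ν) {k : Euc m} {χ : Euc n → ℂ}
    (hχ : C.IsDualCharacter k χ) :
    ∃ c : ℝ, 0 < c ∧ (ν {k}).toReal = c * (‖∫ y in W, χ y * F y‖ ^ 2 / (volume W).toReal) := by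
  have ha := C.isAveraging_gaussWeight
  -- The limit is already known to exist, so one ultrafilter suffices to identify it; of c only
  -- positivity matters.
  have hU : (Ultrafilter.of (atTop : Filter ℝ) : Filter ℝ) ≤ atTop := Ultrafilter.of_le _
  obtain ⟨c, hc0, hc⟩ := exists_umean_eq_integral ha hU
  have hcont := continuous_windowCorr hW hF
  have hχc := hχ.continuous
  have hcs : HasCompactSupport (fun u => χ u * (windowCorr W F u : ℂ)) :=
    HasCompactSupport.intro (isCompact_sub_self hW.isCompact) fun u hu => by
      rw [windowCorr_eq_zero hu, Complex.ofReal_zero, mul_zero]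
  have h1 := tendsto_umean ha hU (isAdmissible_of_hasCompactSupport (C := C) (by fun_prop) hcs)
  rw [hc _ (by fun_prop) hcs, integral_character_mul_windowCorr hW hF hχ] at h1
  have h2 := (tendsto_wsum_gaussWeight hW hF h0 hw hν k).mono_left hU
  simp_rw [← fun z : C.lattice => hχ.apply_snd z.1 z.2] at h2
  refine ⟨c, hc0, ?_⟩
  have := tendsto_nhds_unique h2 h1
  exact_mod_cast this

theorem measure_singleton_eq_zero (hW : IsRegularWindow W) (hF : Continuous F)
    (h0 : ∀ y ∈ W, 0 ≤ F y) (hw : ∀ z ∈ C.lattice, z.2 ∈ W → w z.1 = F z.2)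
    (hν : IsDiffractionMeasure (C.modelSet W) w ν) {k : Euc m}
    (hk : ¬ ∃ χ, C.IsDualCharacter k χ) : (ν {k}).toReal = 0 := by
  have ha := C.isAveraging_gaussWeight
  have hU : (Ultrafilter.of (atTop : Filter ℝ) : Filter ℝ) ≤ atTop := Ultrafilter.of_le _
  have hcont := continuous_windowCorr hW hF
  have hcs : HasCompactSupport (fun u => (windowCorr W F u : ℂ)) :=
    HasCompactSupport.intro (isCompact_sub_self hW.isCompact) fun u hu => by
      rw [windowCorr_eq_zero hu, Complex.ofReal_zero]
  have h1 := tendsto_umean ha hU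
    ((isAdmissible_of_hasCompactSupport (C := C) (by fun_prop) hcs).mul_left (M' := 1)
      (e := fun z => phase k z.1.1) fun z => (norm_phase k z.1.1).le)
  rw [umean_phase_eq_zero ha hU hk (by fun_prop) hcs] at h1
  have h2 := (tendsto_wsum_gaussWeight hW hF h0 hw hν k).mono_left hU
  exact_mod_cast tendsto_nhds_unique h2 h1

theorem mem_braggPeaks_iff (hW : IsRegularWindow W) (hF : Continuous F)
    (h0 : ∀ y ∈ W, 0 ≤ F y) (hw : ∀ z ∈ C.lattice, z.2 ∈ W → w z.1 = F z.2)
    (hν : IsDiffractionMeasure (C.modelSet W) w ν) {k : Euc m} :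
    k ∈ braggPeaks ν ↔ ∃ χ, C.IsDualCharacter k χ ∧ ∫ y in W, χ y * F y ≠ 0 := by
  have := hν.1
  have hfin : ν {k} ≠ ∞ := isCompact_singleton.measure_lt_top.ne
  have hiff : k ∈ braggPeaks ν ↔ (ν {k}).toReal ≠ 0 := by
    simp [braggPeaks, ENNReal.toReal_eq_zero_iff, hfin]
  rw [hiff]
  constructor
  · intro h
    by_cases hk : ∃ χ, C.IsDualCharacter k χ
    · obtain ⟨χ, hχ⟩ := hk
      obtain ⟨c, -, hc⟩ := measure_singleton_of_isDualCharacter hW hF h0 hw hν hχ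
      refine ⟨χ, hχ, fun hz => h ?_⟩
      simp [hc, hz]
    · exact absurd (measure_singleton_eq_zero hW hF h0 hw hν hk) h
  · rintro ⟨χ, hχ, hne⟩
    obtain ⟨c, hc0, hc⟩ := measure_singleton_of_isDualCharacter hW hF h0 hw hν hχ
    rw [hc]
    have h1 := norm_pos_iff.2 hne
    have h2 := hW.volume_pos
    positivity

end Bragg

/-- Nonnegativity of p gives it on the dense set L^*, and it passes to the closure. -/
theorem profile_nonneg {Ω : Set (Euc n)} {p : Euc m → ℝ} {f : Euc n → ℝ} {v : ℝ} (hv : 0 < v)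
    (hf : Continuous f) (hpf : ∀ z ∈ C.lattice, p z.1 = v * f z.2)
    (hp0 : ∀ x, x ∉ C.modelSet Ω → p x = 0) (hp : ∀ x ∈ C.modelSet Ω, 0 ≤ p x) (y : Euc n) :
    0 ≤ f y := by
  have hcl : IsClosed {y | 0 ≤ f y} := isClosed_le continuous_const hf
  have hsub : closure (Prod.snd '' (C.lattice : Set (Euc m × Euc n))) ⊆ {y | 0 ≤ f y} := by
    refine hcl.closure_subset_iff.2 ?_
    rintro _ ⟨z, hz, rfl⟩
    have h1 : 0 ≤ p z.1 := by
      by_cases h : z.1 ∈ C.modelSet Ω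
      · exact hp _ h
      · rw [hp0 _ h]
    rw [hpf z hz] at h1
    exact nonneg_of_mul_nonneg_right h1 hv
  exact hsub (C.snd_dense y)

theorem tendsto_fourierBohrMean_fourierBohr {W : Set (Euc n)} (hW : IsRegularWindow W) {w : Euc m → ℝ}
    {F : Euc n → ℝ} (hF : Continuous F) (hw : ∀ z ∈ C.lattice, z.2 ∈ W → w z.1 = F z.2)
    (k : Euc m) : Tendsto (fourierBohrMean (C.modelSet W) w k) atTop
      (𝓝 (fourierBohr (C.modelSet W) w k)) := by
  refine tendsto_nhds_limUnder ?_
  by_cases hk : ∃ χ, C.IsDualCharacter k χ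
  · obtain ⟨χ, hχ⟩ := hk
    exact ⟨_, tendsto_fourierBohrMean hW hF hw hχ⟩
  · exact ⟨_, tendsto_fourierBohrMean_zero hW hF hw hk⟩

end CutProjectScheme

open CutProjectScheme

theorem proposition4 {m n : ℕ} (C : CutProjectScheme m n)
    -- the window
    (Ω : Set (Euc n)) (hΩ : IsWindow Ω) (hΩ0 : (0 : Euc n) ∈ interior Ω)
    -- the similarity and the induced contraction of internal space
    (Q : Euc m ≃L[ℝ] Euc m) (hQ : IsLinearSimilarity Q) (hQL : Q '' C.L = C.L)
    (A : Euc n →ₗ[ℝ] Euc n) (hA : C.IsInducedBy A Q)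
    -- the complex eigenvalues of the contraction are smaller than one in absolute value
    (hAspec : ∀ z : ℂ, Polynomial.aeval z (LinearMap.charpoly A) = 0 → ‖z‖ < 1)
    -- compatibility, and Riemann measurability of the window of translations
    (hcomp : (interior (translationWindow A Ω)).Nonempty)
    (hRiem : volume (frontier (translationWindow A Ω)) = 0)
    -- the continuous invariant density
    (p : Euc m → ℝ) (hp : IsInvariantDensity C Ω Q A p) (hpc : MemContinuousClass C Ω p)
    (g h : Euc m → ℂ)
    (hg : g = fourierBohr (C.modelSet (translationWindow A Ω)) (fun _ => 1))
    (hh : h = fourierBohr (C.modelSet Ω) p) :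
    -- the limits that define the two functions exist
    (∀ k, Tendsto (fourierBohrMean (C.modelSet (translationWindow A Ω)) (fun _ => 1) k)
      atTop (𝓝 (g k))) ∧
    (∀ k, Tendsto (fourierBohrMean (C.modelSet Ω) p k) atTop (𝓝 (h k))) ∧
    -- the product formula
    (∀ k, HasProd
      (fun N : ℕ => g ((ContinuousLinearMap.adjoint (Q : Euc m →L[ℝ] Euc m) ^ N) k)) (h k)) ∧
    -- the Bragg spectrum of the weighted set is supported inside that of the translation set
    (∀ νp νT : Measure (Euc m), IsDiffractionMeasure (C.modelSet Ω) p νp →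
      IsDiffractionMeasure (C.modelSet (translationWindow A Ω)) (fun _ => 1) νT →
      braggPeaks νp ⊆ braggPeaks νT) := by
  have h0 : (0 : Euc n) ∈ Ω := interior_subset hΩ0
  have hΩr := isRegularWindow_of_isWindow hΩ ⟨0, hΩ0⟩
  have hΩQ := isRegularWindow_translationWindow hΩ.isCompact h0 hcomp hRiem
  obtain ⟨f, hf, hf0, hpf⟩ := exists_real_profile hp.eq_zero_off hpc
  have hf1 := integral_profile_eq_one hΩr hf hf0 hpf hp.normalized
  obtain ⟨κ, hκ⟩ := refinement_equation hΩr hΩQ hA hQL hf hpf hp.invariant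
  have hvol := hΩr.volume_pos
  have hvol' : ((volume Ω).toReal : ℂ) ≠ 0 := Complex.ofReal_ne_zero.2 hvol.ne'
  have hF : Continuous fun y => (volume Ω).toReal * f y := by fun_prop
  have hpF : ∀ z ∈ C.lattice, z.2 ∈ Ω → p z.1 = (volume Ω).toReal * f z.2 :=
    fun z hz _ => hpf z hz
  have hg1 : ∀ k, Tendsto (fourierBohrMean (C.modelSet (translationWindow A Ω)) (fun _ => 1) k)
      atTop (𝓝 (g k)) := fun k =>
    hg ▸ tendsto_fourierBohrMean_fourierBohr hΩQ (F := fun _ => 1) continuous_const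
      (fun _ _ _ => rfl) k
  have hh1 : ∀ k, Tendsto (fourierBohrMean (C.modelSet Ω) p k) atTop (𝓝 (h k)) := fun k =>
    hh ▸ tendsto_fourierBohrMean_fourierBohr hΩr hF hpF k
  have hint : ∀ χ : Euc n → ℂ, ∫ y in Ω, χ y * ((volume Ω).toReal * f y : ℝ) =
      (volume Ω).toReal * ∫ y, χ y * f y := by
    intro χ
    rw [← integral_const_mul, setIntegral_eq_integral_of_forall_compl_eq_zero fun y hy => by
      rw [hf0 y hy, mul_zero, Complex.ofReal_zero, mul_zero]]
    congr 1; ext y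
    push_cast; ring
  have hgχ : ∀ k χ, C.IsDualCharacter k χ → g k = (∫ y in translationWindow A Ω, χ y) /
      ((volume (translationWindow A Ω)).toReal : ℂ) := fun k χ hχ => by
    have := tendsto_fourierBohrMean hΩQ (F := fun _ => 1) continuous_const
      (w := fun _ => 1) (fun _ _ _ => rfl) hχ
    simp only [Complex.ofReal_one, mul_one] at this
    exact tendsto_nhds_unique (hg1 k) this
  refine ⟨hg1, hh1, fun k => ?_, fun νp νT hνp hνT k hk => ?_⟩
  · by_cases hk : ∃ χ, C.IsDualCharacter k χ
    · obtain ⟨χ, hχ⟩ := hk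
      have hhk : h k = ∫ y, χ y * f y := by
        have := tendsto_nhds_unique (hh1 k) (tendsto_fourierBohrMean hΩr hF hpF hχ)
        rwa [hint, mul_div_cancel_left₀ _ hvol'] at this
      rw [hhk]
      simp_rw [fun N : ℕ => hgχ _ _ (hχ.comp_induced_pow hA hQL N)]
      exact hasProd_character hΩr h0 hΩQ hA hQL hAspec hf hf0 hf1 hκ hχ
    · have hhk : h k = 0 :=
        tendsto_nhds_unique (hh1 k) (tendsto_fourierBohrMean_zero hΩr hF hpF hk)
      have hgk : g k = 0 := tendsto_nhds_unique (hg1 k)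
        (tendsto_fourierBohrMean_zero hΩQ (F := fun _ => 1) continuous_const
          (fun _ _ _ => rfl) hk)
      rw [hhk]
      -- Without a dual character the factor N = 0, which is g k, already vanishes.
      exact hasProd_zero_of_exists_eq_zero ⟨0, by simpa using hgk⟩
  · have hf00 := profile_nonneg hvol hf hpf hp.eq_zero_off hp.nonneg
    obtain ⟨χ, hχ, hne⟩ := (mem_braggPeaks_iff hΩr hF
      (fun y _ => mul_nonneg hvol.le (hf00 y)) hpF hνp).1 hk
    refine (mem_braggPeaks_iff hΩQ (F := fun _ => 1) continuous_const (fun _ _ => zero_le_one)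
      (fun _ _ _ => rfl) hνT).2 ⟨χ, hχ, fun hz => hne ?_⟩
    simp only [Complex.ofReal_one, mul_one] at hz
    -- One step of the recursion suffices: if ∫ χ over Ω_Q vanishes, so does ∫ χ f.
    rw [hint, integral_character_mul_recursion hΩr hΩQ hA hQL hf hf0 hf1 hκ hχ, hz]
    simp

end
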